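/- A (finite normal-form) game $\Gamma$ consists of players $\mathcal N=\{1,\dots,N\}$, a finite non-empty action set $A^i$ for each player $i$, and payoffs $u^i : A \to \mathbb Q$ on the set $A = \prod_i A^i$ of action profiles. A symmetry of $\Gamma$ is a bijection $\phi$ of the disjoint union $\mathcal A=\bigsqcup_i A^i$ onto itself that maps the actions of each player $i$ to actions of one player $\pi(i)$ and satisfies $u^i(\mathbf a) = u^{\pi(i)}(\phi(\mathbf a))$ for all $i\in\mathcal N$ and $\mathbf a \in A$, where $\phi(\mathbf a)=\big(\phi(\mathbf a_{\pi^{-1}(j)})\big)_{j\in\mathcal N}$; the permutation $\pi$ of $\mathcal N$ is said to be induced by $\phi$. Games are given in explicit form, as the table of all payoffs written in binary; graphs are given by adjacency matrices. $\mathsf{GI}$ is the class of decision problems that are polynomial-time many-one reducible to the graph isomorphism problem; a problem is $\mathsf{GI}$-hard if every problem in $\mathsf{GI}$ is polynomial-time many-one reducible to it, and $\mathsf{GI}$-complete if it is in $\mathsf{GI}$ and $\mathsf{GI}$-hard. An instance of restricted graph isomorphism consists of two finite simple graphs $G,H$ and pairs $(u_1,v_1),\dots,(u_k,v_k)\in V_G\times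 V_H$, and asks whether there is an isomorphism $\psi:G\to H$ with $\psi(u_l)=v_l$ for all $l$. (1) The problem of deciding, given a game $\Gamma$, whether every permutation of the players is induced by some symmetry of $\Gamma$ is $\mathsf{GI}$-complete. (2) Its restriction to two-player zero-sum games is still $\mathsf{GI}$-hard. (3) There is a polynomial-time algorithm that maps a game $\Gamma$ to a list of instances $R_{ij}$ of restricted graph isomorphism, one for each transposition $(i\,j)$ of players, $i<j$, such that $R_{ij}$ is a yes-instance if and only if $(i\,j)$ is induced by some symmetry of $\Gamma$, and such that every permutation of the players is induced by some symmetry of $\Gamma$ if and only if all the instances $R_{ij}$ are yes-instances. -/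

import Mathlib

noncomputable section

namespace GameSym

open Computability

/-! ## Decision problems, polynomial-time many-one reductions -/

/-- A decision problem: a type of instances, an encoding of the instances as strings over a finite
alphabet, and the set of yes-instances. -/
structure DecisionProblem where
  Instance : Type
  Symbol : Type
  symbolFintype : Fintype Symbol
  encode : Instance → List Symbol
  encode_injective : Function.Injective encode
  Yes : Instance → Prop

/-- `f` is computed by a (multi-stack) Turing machine whose number of steps is bounded by a
polynomial in the length of the encoded input. -/
def PolyTimeComputable {α β S T : Type} (ea : α → List S) (eb : β → List T) (f : α → β) : Prop :=
  Nonempty (Turing.TM2ComputableInPolyTime ea eb f)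

/-- Polynomial-time many-one (Karp) reducibility. -/
def PolyTimeReduces (P Q : DecisionProblem) : Prop :=
  ∃ f : P.Instance → Q.Instance,
    PolyTimeComputable P.encode Q.encode f ∧ ∀ x, P.Yes x ↔ Q.Yes (f x)

/-! ## Encodings over the alphabet `Γ'` -/

/-- A self-delimiting code: it can be read off the front of any longer string. -/
def SelfDelimiting {α : Type*} (enc : α → List Γ') : Prop :=
  ∀ x y s t, enc x ++ s = enc y ++ t → x = y ∧ s = t

theorem SelfDelimiting.injective {α : Type*} {enc : α → List Γ'} (h : SelfDelimiting enc) :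
    Function.Injective enc := fun x y hxy => (h x y [] [] (by rw [hxy])).1

/-- A bit string, terminated by a comma. -/
def encodeBits (l : List Bool) : List Γ' := l.map Γ'.bit ++ [Γ'.comma]

/-- A natural number in unary. -/
def encodeUnary (n : ℕ) : List Γ' := encodeBits (List.replicate n true)

/-- A natural number in binary. -/
def encodeBinary (n : ℕ) : List Γ' := encodeBits (encodeNat n)

/-- A rational number: sign bit, then numerator and denominator (in lowest terms) in binary. -/
def encodeRat (q : ℚ) : List Γ' :=
  Γ'.bit (decide (q.num < 0)) :: (encodeBinary q.num.natAbs ++ encodeBinary q.den)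

/-- A list of objects, given a code for its members. -/
def encodeList {α : Type*} (enc : α → List Γ') (l : List α) : List Γ' :=
  l.flatMap (fun x => Γ'.bra :: enc x) ++ [Γ'.ket]

theorem encodeBits_selfDelimiting : SelfDelimiting encodeBits := by
  intro x
  induction x with
  | nil =>
    intro y s t h
    cases y with
    | nil => simpa [encodeBits] using h
    | cons b y => simp [encodeBits] at h
  | cons a x ih =>
    intro y s t h
    cases y with
    | nil => simp [encodeBits] at h
    | cons b y =>
      simp only [encodeBits, List.map_cons, List.cons_append, List.cons.injEq,
        Γ'.bit.injEq] at h
      obtain ⟨h1, h2⟩ := ih y s t h.2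
      exact ⟨by rw [h.1, h1], h2⟩

theorem encodeUnary_selfDelimiting : SelfDelimiting encodeUnary := by
  intro x y s t h
  obtain ⟨h1, h2⟩ := encodeBits_selfDelimiting _ _ _ _ h
  exact ⟨by simpa using congrArg List.length h1, h2⟩

theorem encodeBinary_selfDelimiting : SelfDelimiting encodeBinary := by
  intro x y s t h
  obtain ⟨h1, h2⟩ := encodeBits_selfDelimiting _ _ _ _ h
  exact ⟨encodingNatBool.encode_injective h1, h2⟩

theorem encodeRat_selfDelimiting : SelfDelimiting encodeRat := by
  intro x y s t h
  simp only [encodeRat, List.cons_append, List.append_assoc, List.cons.injEq, Γ'.bit.injEq,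
    decide_eq_decide] at h
  obtain ⟨hs, h⟩ := h
  obtain ⟨h1, h⟩ := encodeBinary_selfDelimiting _ _ _ _ h
  obtain ⟨h2, h⟩ := encodeBinary_selfDelimiting _ _ _ _ h
  exact ⟨Rat.ext (by omega) h2, h⟩

theorem encodeList_selfDelimiting {α : Type*} {enc : α → List Γ'} (he : SelfDelimiting enc) :
    SelfDelimiting (encodeList enc) := by
  intro x
  induction x with
  | nil =>
    intro y s t h
    cases y with
    | nil => simpa [encodeList] using h
    | cons b y => simp [encodeList] at h
  | cons a x ih =>
    intro y s t h
    cases y with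
    | nil => simp [encodeList] at h
    | cons b y =>
      simp only [encodeList, List.flatMap_cons, List.cons_append, List.append_assoc,
        List.cons.injEq, true_and] at h
      obtain ⟨h1, h2⟩ := he _ _ _ _ h
      obtain ⟨h3, h4⟩ := ih y s t (by simpa [encodeList] using h2)
      exact ⟨by rw [h1, h3], h4⟩

/-- Tables indexed by the same list. -/
theorem flatMap_selfDelimiting {ι α : Type*} {enc : α → List Γ'} (he : SelfDelimiting enc)
    (f g : ι → α) : ∀ (l : List ι) (s t : List Γ'),
    l.flatMap (fun i => enc (f i)) ++ s = l.flatMap (fun i => enc (g i)) ++ t →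
      (∀ i ∈ l, f i = g i) ∧ s = t := by
  intro l
  induction l with
  | nil => intro s t h; simpa using h
  | cons a l ih =>
    intro s t h
    simp only [List.flatMap_cons, List.append_assoc] at h
    obtain ⟨h1, h2⟩ := he _ _ _ _ h
    obtain ⟨h3, h4⟩ := ih s t h2
    exact ⟨by simpa [h1] using h3, h4⟩

/-! ## Graph isomorphism -/

/-- A finite simple graph on the vertices `0, …, order - 1`. -/
structure FinGraph where
  order : ℕ
  graph : SimpleGraph (Fin order)

open Classical in
/-- The number of vertices in unary, then the adjacency matrix row by row. -/
def FinGraph.encode (G : FinGraph) : List Γ' :=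
  encodeUnary G.order ++
    (List.finRange G.order).flatMap fun u =>
      (List.finRange G.order).flatMap fun v => [Γ'.bit (decide (G.graph.Adj u v))]

theorem bit_selfDelimiting : SelfDelimiting (fun b : Bool => [Γ'.bit b]) := by
  intro x y s t h
  simpa using h

theorem row_selfDelimiting (n : ℕ) : SelfDelimiting (fun r : Fin n → Bool =>
    (List.finRange n).flatMap fun v => [Γ'.bit (r v)]) := by
  intro x y s t h
  obtain ⟨h1, h2⟩ := flatMap_selfDelimiting bit_selfDelimiting x y _ s t h
  exact ⟨funext fun i => h1 i (List.mem_finRange i), h2⟩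

theorem FinGraph.encode_selfDelimiting : SelfDelimiting FinGraph.encode := by
  classical
  rintro ⟨n, G⟩ ⟨m, H⟩ s t h
  simp only [FinGraph.encode, List.append_assoc] at h
  obtain ⟨h1, h⟩ := encodeUnary_selfDelimiting _ _ _ _ h
  subst h1
  obtain ⟨h1, h2⟩ := flatMap_selfDelimiting (row_selfDelimiting n)
    (fun u v => decide (G.Adj u v)) (fun u v => decide (H.Adj u v)) _ s t (by convert h)
  refine ⟨?_, h2⟩
  congr 1
  ext u v
  simpa using congrFun (h1 u (List.mem_finRange u)) v

/-- The graph isomorphism problem. -/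
def graphIsomorphism : DecisionProblem where
  Instance := FinGraph × FinGraph
  Symbol := Γ'
  symbolFintype := inferInstance
  encode p := p.1.encode ++ p.2.encode
  encode_injective := by
    rintro ⟨G, H⟩ ⟨G', H'⟩ h
    obtain ⟨h1, h2⟩ := FinGraph.encode_selfDelimiting _ _ _ _ h
    exact Prod.ext h1 (FinGraph.encode_selfDelimiting.injective h2)
  Yes p := Nonempty (p.1.graph ≃g p.2.graph)

/-- The complexity class GI: the decision problems that reduce to graph isomorphism. -/
def GI : Set DecisionProblem := {P | PolyTimeReduces P graphIsomorphism}

/-- Every problem in GI reduces to `P`. -/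
def GIHard (P : DecisionProblem) : Prop := ∀ Q ∈ GI, PolyTimeReduces Q P

def GIComplete (P : DecisionProblem) : Prop := P ∈ GI ∧ GIHard P

/-- An instance of restricted graph isomorphism: two graphs, and a list of pairs `(u, v)` of a
vertex of the first and a vertex of the second. -/
structure RestrictedInstance where
  source : FinGraph
  target : FinGraph
  constraints : List (Fin source.order × Fin target.order)

/-- Some isomorphism maps `u` to `v` for each of the listed pairs `(u, v)`. -/
def RestrictedInstance.Yes (R : RestrictedInstance) : Prop :=
  ∃ e : R.source.graph ≃g R.target.graph, ∀ p ∈ R.constraints, e p.1 = p.2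

def RestrictedInstance.encode (R : RestrictedInstance) : List Γ' :=
  R.source.encode ++ R.target.encode ++
    encodeList (fun p => encodeUnary p.1.val ++ encodeUnary p.2.val) R.constraints

theorem RestrictedInstance.encode_selfDelimiting : SelfDelimiting RestrictedInstance.encode := by
  rintro ⟨G, H, l⟩ ⟨G', H', l'⟩ s t h
  simp only [RestrictedInstance.encode, List.append_assoc] at h
  obtain ⟨h1, h⟩ := FinGraph.encode_selfDelimiting _ _ _ _ h
  obtain ⟨h2, h⟩ := FinGraph.encode_selfDelimiting _ _ _ _ h
  subst h1 h2
  have hp : SelfDelimiting (fun p : Fin G.order × Fin H.order =>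
      encodeUnary p.1.val ++ encodeUnary p.2.val) := by
    rintro ⟨u, v⟩ ⟨u', v'⟩ s t h
    simp only [List.append_assoc] at h
    obtain ⟨h1, h⟩ := encodeUnary_selfDelimiting _ _ _ _ h
    obtain ⟨h2, h⟩ := encodeUnary_selfDelimiting _ _ _ _ h
    exact ⟨Prod.ext (Fin.ext h1) (Fin.ext h2), h⟩
  obtain ⟨h1, h2⟩ := encodeList_selfDelimiting hp _ _ _ _ h
  exact ⟨by rw [h1], h2⟩

/-! ## Games -/

/-- A finite normal-form game with rational payoffs. -/
structure Game where
  numPlayers : ℕ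
  numActions : Fin numPlayers → ℕ
  numActions_pos : ∀ i, 0 < numActions i
  payoff : Fin numPlayers → (∀ i, Fin (numActions i)) → ℚ

namespace Game

/-- The set of players. -/
abbrev Player (Γ : Game) : Type := Fin Γ.numPlayers

/-- Action profiles. -/
abbrev Profile (Γ : Game) : Type := ∀ i : Γ.Player, Fin (Γ.numActions i)

/-- The disjoint union of the action sets of all players. -/
abbrev Action (Γ : Game) : Type := Σ i : Γ.Player, Fin (Γ.numActions i)

/-- `φ` maps the actions of each player `i` to actions of the player `π i`. -/
def MapsPlayers (Γ : Game) (φ : Equiv.Perm Γ.Action) (π : Equiv.Perm Γ.Player) : Prop :=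
  ∀ a : Γ.Action, (φ a).1 = π a.1

/-- The image of a profile `s`: player `j` plays `φ (s (π⁻¹ j))`. -/
def mapProfile (Γ : Game) {φ : Equiv.Perm Γ.Action} {π : Equiv.Perm Γ.Player}
    (h : Γ.MapsPlayers φ π) (s : Γ.Profile) : Γ.Profile := fun j =>
  Fin.cast (congrArg Γ.numActions ((h ⟨π.symm j, s (π.symm j)⟩).trans (π.apply_symm_apply j)))
    (φ ⟨π.symm j, s (π.symm j)⟩).2

theorem mapProfile_spec (Γ : Game) {φ : Equiv.Perm Γ.Action} {π : Equiv.Perm Γ.Player}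
    (h : Γ.MapsPlayers φ π) (s : Γ.Profile) (j : Γ.Player) :
    (⟨j, Γ.mapProfile h s j⟩ : Γ.Action) = φ ⟨π.symm j, s (π.symm j)⟩ := by
  have e : (φ ⟨π.symm j, s (π.symm j)⟩).1 = j :=
    (h ⟨π.symm j, s (π.symm j)⟩).trans (π.apply_symm_apply j)
  refine Sigma.ext e.symm ?_
  simp only [mapProfile]
  exact (Fin.heq_ext_iff (congrArg Γ.numActions e.symm)).2 rfl

/-- `φ` is a symmetry of the game, and `π` is the player permutation it induces. -/
def IsSymmetryInducing (Γ : Game) (φ : Equiv.Perm Γ.Action) (π : Equiv.Perm Γ.Player) : Prop :=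
  ∃ h : Γ.MapsPlayers φ π,
    ∀ (i : Γ.Player) (s : Γ.Profile), Γ.payoff i s = Γ.payoff (π i) (Γ.mapProfile h s)

/-- The player permutation `π` is induced by some symmetry of the game. -/
def Induced (Γ : Game) (π : Equiv.Perm Γ.Player) : Prop :=
  ∃ φ : Equiv.Perm Γ.Action, Γ.IsSymmetryInducing φ π

def AllPlayerPermsInduced (Γ : Game) : Prop := ∀ π : Equiv.Perm Γ.Player, Γ.Induced π

def IsTwoPlayerZeroSum (Γ : Game) : Prop :=
  Γ.numPlayers = 2 ∧ ∀ s : Γ.Profile, ∑ i, Γ.payoff i s = 0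

/-- The pairs `(i, j)` of players with `i < j`, that is, the transpositions of the player set. -/
def transpositions (Γ : Game) : List (Γ.Player × Γ.Player) :=
  (List.finRange Γ.numPlayers).flatMap fun i =>
    ((List.finRange Γ.numPlayers).filter fun j => i < j).map fun j => (i, j)

/-- All profiles for the given numbers of actions, in lexicographic order. -/
def allProfiles : (N : ℕ) → (m : Fin N → ℕ) → List (∀ i, Fin (m i))
  | 0, _ => [fun i => i.elim0]
  | N + 1, m => (List.finRange (m 0)).flatMap fun a =>
      (allProfiles N fun i => m i.succ).map fun s => Fin.cons a s

theorem mem_allProfiles : ∀ (N : ℕ) (m : Fin N → ℕ) (s : ∀ i, Fin (m i)), s ∈ allProfiles N m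
  | 0, m, s => by
      simp only [allProfiles, List.mem_singleton]
      exact funext fun i => i.elim0
  | N + 1, m, s => by
      simp only [allProfiles, List.mem_flatMap, List.mem_map]
      exact ⟨s 0, List.mem_finRange _, Fin.tail s, mem_allProfiles N _ _, Fin.cons_self_tail s⟩

/-- The game in explicit form: the number of players and their numbers of actions, then the table
of the payoffs of all players at all profiles. -/
def encode (Γ : Game) : List Γ' :=
  encodeUnary Γ.numPlayers ++
    (List.finRange Γ.numPlayers).flatMap (fun i => encodeUnary (Γ.numActions i)) ++
    (allProfiles Γ.numPlayers Γ.numActions).flatMap fun s =>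
      (List.finRange Γ.numPlayers).flatMap fun i => encodeRat (Γ.payoff i s)

theorem encode_injective : Function.Injective encode := by
  rintro ⟨N, m, hm, u⟩ ⟨N', m', hm', u'⟩ h
  simp only [encode, List.append_assoc] at h
  obtain ⟨h1, h⟩ := encodeUnary_selfDelimiting _ _ _ _ h
  subst h1
  obtain ⟨h1, h⟩ := flatMap_selfDelimiting encodeUnary_selfDelimiting m m' _ _ _ h
  have h1 : m = m' := funext fun i => h1 i (List.mem_finRange i)
  subst h1
  have hr : SelfDelimiting (fun r : Fin N → ℚ =>
      (List.finRange N).flatMap fun i => encodeRat (r i)) := by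
    intro x y s t h
    obtain ⟨h1, h2⟩ := flatMap_selfDelimiting encodeRat_selfDelimiting x y _ s t h
    exact ⟨funext fun i => h1 i (List.mem_finRange i), h2⟩
  obtain ⟨h1, -⟩ := flatMap_selfDelimiting hr (fun s i => u i s) (fun s i => u' i s)
    (allProfiles N m) [] [] (by simpa using h)
  have h1 : u = u' := funext fun i => funext fun s => congrFun (h1 s (mem_allProfiles N m s)) i
  subst h1
  rfl

end Game

/-- Given a game, is every player permutation induced by some symmetry of the game? -/
def allPlayerPermsInduced : DecisionProblem where
  Instance := Game
  Symbol := Γ'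
  symbolFintype := inferInstance
  encode := Game.encode
  encode_injective := Game.encode_injective
  Yes := Game.AllPlayerPermsInduced

/-- The same problem, restricted to two-player zero-sum games. -/
def allPlayerPermsInducedTwoPlayerZeroSum : DecisionProblem where
  Instance := {Γ : Game // Γ.IsTwoPlayerZeroSum}
  Symbol := Γ'
  symbolFintype := inferInstance
  encode Γ := Γ.1.encode
  encode_injective := fun _ _ h => Subtype.ext (Game.encode_injective h)
  Yes Γ := Γ.1.AllPlayerPermsInduced

end GameSym

end

/-!
To a game we associate a graph with a vertex for each player `k`, each action, each profile `s` and
each pair of a player `k` and an entry of the payoff table (a cell). A player is joined to their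
actions, a profile to its actions, and a profile `s` to the cells of `k` at the entries equal to the
payoff of `k` at `s`. The symmetries that induce a player permutation `π` correspond to the
automorphisms that act on players and cells by applying `π` to the player. So whether `π` is induced
is an instance of restricted graph isomorphism. Transpositions generate the symmetric group, hence
finitely many such instances decide whether all permutations are induced, and these are merged into
a single instance of graph isomorphism: take a disjoint copy of the graph for each transposition and
replace the prescribed values by colours, and the colours by numbers of leaves.

Conversely, two graphs give a zero-sum game with two players whose actions are the vertices of both
graphs. The payoff matrix is block diagonal: it is positive on the block of the first graph and
negative on the block of the second, and its absolute values record adjacency and equality of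
vertices. Swapping the players transposes and negates the matrix, so a symmetry that induces the
swap exchanges the blocks. The entries that record equality make its action on rows determine its
action on columns, and it is then an isomorphism of the two graphs.

Polynomial-time functions are closed under composition, case distinction and recursion with values
of polynomial length because these operations are carried out by structured programs on stacks,
which compile to Turing machines.
-/

noncomputable section

namespace GameSym

open Computability Turing Function

/-! ## Structured stack programs and their compilation to Turing machines -/

/-- `StepsTo f n a b`: the configuration `b` is reached from `a` by exactly `n` steps of `f`. -/
inductive StepsTo {σ : Type*} (f : σ → Option σ) : ℕ → σ → σ → Prop
  | refl (a : σ) : StepsTo f 0 a a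
  | head {n : ℕ} {a b c : σ} (hab : f a = some b) (hbc : StepsTo f n b c) : StepsTo f (n + 1) a c

namespace StepsTo

variable {σ τ : Type*} {f : σ → Option σ} {g : τ → Option τ} {m n : ℕ} {a b c : σ}

theorem single (h : f a = some b) : StepsTo f 1 a b := .head h (.refl b)

theorem trans (h₁ : StepsTo f m a b) (h₂ : StepsTo f n b c) : StepsTo f (m + n) a c := by
  induction h₁ with
  | refl => simpa using h₂
  | head h _ ih => simpa only [Nat.add_right_comm] using .head h (ih h₂)

theorem map (e : σ → τ) (he : ∀ a b, f a = some b → g (e a) = some (e b))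
    (h : StepsTo f n a b) : StepsTo g n (e a) (e b) := by
  induction h with
  | refl => exact .refl _
  | head h _ ih => exact .head (he _ _ h) ih

theorem le_add_mul (size : σ → ℕ) {c : ℕ} (hc : ∀ a b, f a = some b → size b ≤ size a + c)
    (h : StepsTo f n a b) : size b ≤ size a + n * c := by
  induction h with
  | refl => simp
  | head h _ ih => linarith [hc _ _ h]

end StepsTo

theorem iterate_bind_none {σ : Type*} (f : σ → Option σ) (n : ℕ) :
    (flip bind f)^[n] none = none :=
  iterate_fixed rfl n

theorem stepsTo_iff_iterate {σ : Type*} {f : σ → Option σ} {n : ℕ} {a b : σ} :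
    StepsTo f n a b ↔ (flip bind f)^[n] (some a) = some b := by
  constructor
  · intro h
    induction h with
    | refl => rfl
    | head h _ ih => rwa [iterate_succ_apply, show flip bind f (some _) = some _ from h]
  · intro h
    induction n generalizing a with
    | zero => exact Option.some.inj h ▸ .refl a
    | succ n ih =>
      rw [iterate_succ_apply, show flip bind f (some a) = f a from rfl] at h
      cases ha : f a with
      | none => simp only [ha, iterate_bind_none, reduceCtorEq] at h
      | some a' => exact .head ha (ih (ha ▸ h))

theorem polyTimeComputable_iff {α β S T : Type} {ea : α → List S} {eb : β → List T} {f : α → β} :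
    PolyTimeComputable ea eb f ↔
      ∃ (tm : FinTM2) (i : tm.Γ tm.k₀ ≃ S) (o : tm.Γ tm.k₁ ≃ T) (P : Polynomial ℕ), ∀ x,
        ∃ t ≤ P.eval (ea x).length, StepsTo tm.step t
          (initList tm ((ea x).map i.symm)) (haltList tm ((eb (f x)).map o.symm)) := by
  constructor
  · rintro ⟨F⟩
    refine ⟨F.tm, F.inputAlphabet, F.outputAlphabet, F.time, fun x => ?_⟩
    obtain ⟨⟨t, h⟩, ht⟩ := F.outputsFun x
    exact ⟨t, ht, stepsTo_iff_iterate.2 h⟩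
  · rintro ⟨tm, i, o, P, h⟩
    choose t ht hs using h
    exact ⟨⟨⟨tm, i, o⟩, P, fun x => ⟨⟨t x, stepsTo_iff_iterate.1 (hs x)⟩, ht x⟩⟩⟩

theorem initList_eq_update (tm : FinTM2) (x : List (tm.Γ tm.k₀)) : initList tm x =
    (⟨some tm.main, tm.initialState, update (fun _ => []) tm.k₀ x⟩ :
      TM2.Cfg tm.Γ tm.Λ tm.σ) := by
  unfold initList
  congr 1
  funext k
  by_cases h : k = tm.k₀
  · subst h; simp
  · simp [h]

theorem haltList_eq_update (tm : FinTM2) (x : List (tm.Γ tm.k₁)) : haltList tm x =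
    (⟨none, tm.initialState, update (fun _ => []) tm.k₁ x⟩ :
      TM2.Cfg tm.Γ tm.Λ tm.σ) := by
  unfold haltList
  congr 1
  funext k
  by_cases h : k = tm.k₁
  · subst h; simp
  · simp [h]

/-- Structured programs acting on stacks of symbols indexed by natural numbers; `cas k br` branches
on the top of the stack `k`, and `loop k p` repeats `p` until the stack `k` is empty. -/
inductive Prog
  | skip
  | push (k : ℕ) (c : Γ')
  | pop (k : ℕ)
  | seq (p q : Prog)
  | cas (k : ℕ) (br : Option Γ' → Prog)
  | loop (k : ℕ) (p : Prog)

/-- The contents of all stacks. -/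
abbrev Store : Type := ℕ → List Γ'

namespace Prog

/-- `p.Run s s' t`: started on the stacks `s`, the program `p` stops after exactly `t` steps with
the stacks `s'`. -/
inductive Run : Prog → Store → Store → ℕ → Prop
  | skip (s) : Run .skip s s 1
  | push (k c s) : Run (.push k c) s (update s k (c :: s k)) 1
  | pop (k s) : Run (.pop k) s (update s k (s k).tail) 1
  | seq {p q s s' s'' t t'} : Run p s s' t → Run q s' s'' t' → Run (.seq p q) s s'' (t + t')
  | cas {k br s s' t} : Run (br (s k).head?) s s' t → Run (.cas k br) s s' (t + 1)
  | loop_nil {k p s} : s k = [] → Run (.loop k p) s s 1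
  | loop_cons {k p s s' s'' t t'} : s k ≠ [] → Run p s s' t → Run (.loop k p) s' s'' t' →
      Run (.loop k p) s s'' (t + t' + 1)

/-- All stacks used by the program have an index below `n`. -/
def Below (n : ℕ) : Prog → Prop
  | .skip => True
  | .push k _ => k < n
  | .pop k => k < n
  | .seq p q => p.Below n ∧ q.Below n
  | .cas k br => k < n ∧ ∀ o, (br o).Below n
  | .loop k p => k < n ∧ p.Below n

theorem Below.mono {n m : ℕ} (h : n ≤ m) : ∀ {p : Prog}, p.Below n → p.Below m
  | .skip, _ => trivial
  | .push _ _, hp => hp.trans_le h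
  | .pop _, hp => hp.trans_le h
  | .seq _ _, hp => ⟨hp.1.mono h, hp.2.mono h⟩
  | .cas _ _, hp => ⟨hp.1.trans_le h, fun o => (hp.2 o).mono h⟩
  | .loop _ _, hp => ⟨hp.1.trans_le h, hp.2.mono h⟩

theorem exists_below (p : Prog) : ∃ n, p.Below n := by
  induction p with
  | skip => exact ⟨0, trivial⟩
  | push k c => exact ⟨k + 1, k.lt_succ_self⟩
  | pop k => exact ⟨k + 1, k.lt_succ_self⟩
  | seq p q hp hq =>
    obtain ⟨n, hn⟩ := hp
    obtain ⟨m, hm⟩ := hq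
    exact ⟨max n m, hn.mono (le_max_left _ _), hm.mono (le_max_right _ _)⟩
  | cas k br ih =>
    choose n hn using ih
    exact ⟨max (k + 1) (Finset.univ.sup n), k.lt_succ_self.trans_le (le_max_left _ _),
      fun o => (hn o).mono ((Finset.le_sup (Finset.mem_univ o)).trans (le_max_right _ _))⟩
  | loop k p hp =>
    obtain ⟨n, hn⟩ := hp
    exact ⟨max (k + 1) n, k.lt_succ_self.trans_le (le_max_left _ _), hn.mono (le_max_right _ _)⟩

/-- The control points of a program. -/
def Label : Prog → Type
  | .skip => Unit
  | .push _ _ => Unit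
  | .pop _ => Unit
  | .seq p q => p.Label ⊕ q.Label
  | .cas _ br => Option (Σ o, (br o).Label)
  | .loop _ p => Option p.Label

/-- The control point where a program starts. -/
def start : (p : Prog) → p.Label
  | .skip => ()
  | .push _ _ => ()
  | .pop _ => ()
  | .seq p _ => Sum.inl p.start
  | .cas _ _ => none
  | .loop _ _ => none

instance fintypeLabel : (p : Prog) → Fintype p.Label
  | .skip => inferInstanceAs (Fintype Unit)
  | .push _ _ => inferInstanceAs (Fintype Unit)
  | .pop _ => inferInstanceAs (Fintype Unit)
  | .seq p q =>
    haveI := p.fintypeLabel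
    haveI := q.fintypeLabel
    inferInstanceAs (Fintype (p.Label ⊕ q.Label))
  | .cas _ br =>
    haveI := fun o => (br o).fintypeLabel
    inferInstanceAs (Fintype (Option (Σ o, (br o).Label)))
  | .loop _ p =>
    haveI := p.fintypeLabel
    inferInstanceAs (Fintype (Option p.Label))

/-- The statement at each control point of a program compiled for a machine with `n` stacks. The
control points are renamed by `emb`, and `exit` is where control goes after the program. The state
of the machine remembers the symbol seen last. -/
def code (n : ℕ) [NeZero n] {L : Type} : (p : Prog) → (emb : p.Label → L) → (exit : L) →
    p.Label → TM2.Stmt (fun _ : Fin n => Γ') L (Option Γ')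
  | .skip, _, exit, _ => .goto fun _ => exit
  | .push k c, _, exit, _ => .push (Fin.ofNat n k) (fun _ => c) (.goto fun _ => exit)
  | .pop k, _, exit, _ => .pop (Fin.ofNat n k) (fun v _ => v) (.goto fun _ => exit)
  | .seq p q, emb, exit, l => match l with
    | Sum.inl l => p.code n (fun x => emb (Sum.inl x)) (emb (Sum.inr q.start)) l
    | Sum.inr l => q.code n (fun x => emb (Sum.inr x)) exit l
  | .cas k br, emb, exit, l => match l with
    | none => .peek (Fin.ofNat n k) (fun _ o => o)
        (.goto fun v => emb (some ⟨v, (br v).start⟩))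
    | some ⟨o, l⟩ => (br o).code n (fun x => emb (some ⟨o, x⟩)) exit l
  | .loop k p, emb, exit, l => match l with
    | none => .peek (Fin.ofNat n k) (fun _ o => o)
        (.goto fun v => if v.isSome then emb (some p.start) else exit)
    | some l => p.code n (fun x => emb (some x)) (emb none) l

end Prog

namespace Store

variable {n k : ℕ}

/-- The first `n` stacks. -/
def take (n : ℕ) (s : Store) : Fin n → List Γ' := fun i => s i

theorem take_ofNat [NeZero n] (hk : k < n) (s : Store) : s.take n (Fin.ofNat n k) = s k := by
  simp only [take, Fin.val_ofNat, Nat.mod_eq_of_lt hk]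

theorem take_update [NeZero n] (hk : k < n) (s : Store) (l : List Γ') :
    take n (update s k l) = update (s.take n) (Fin.ofNat n k) l := by
  have hk' : (Fin.ofNat n k : ℕ) = k := Nat.mod_eq_of_lt hk
  have h := update_comp_eq_of_injective s Fin.val_injective (Fin.ofNat n k) l
  rwa [hk'] at h

/-- The store whose stacks are all empty except that the stack `k` contains `l`. -/
def single (k : ℕ) (l : List Γ') : Store := update (fun _ => []) k l

end Store

namespace Prog

theorem Run.stepsTo_step {n : ℕ} [NeZero n] {L : Type}
    {M : L → TM2.Stmt (fun _ : Fin n => Γ') L (Option Γ')} {p : Prog} {s s' : Store} {t : ℕ}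
    (h : p.Run s s' t) (hp : p.Below n) (emb : p.Label → L) (exit : L)
    (hM : ∀ l, M (emb l) = p.code n emb exit l) (v : Option Γ') :
    ∃ v', StepsTo (TM2.step M) t ⟨some (emb p.start), v, s.take n⟩
      ⟨some exit, v', s'.take n⟩ := by
  induction h generalizing exit v with
  | skip s => exact ⟨v, .single (by rw [TM2.step, hM]; rfl)⟩
  | push k c s =>
    refine ⟨v, .single ?_⟩
    rw [TM2.step, hM, Store.take_update hp]
    simp only [code, TM2.stepAux, Store.take_ofNat hp]
  | pop k s =>
    refine ⟨v, .single ?_⟩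
    rw [TM2.step, hM, Store.take_update hp]
    simp only [code, TM2.stepAux, Store.take_ofNat hp]
  | seq _ _ ih₁ ih₂ =>
    obtain ⟨v₁, h₁⟩ := ih₁ hp.1 _ _ (fun l => hM (Sum.inl l)) v
    obtain ⟨v₂, h₂⟩ := ih₂ hp.2 _ _ (fun l => hM (Sum.inr l)) v₁
    exact ⟨v₂, h₁.trans h₂⟩
  | @cas k br s s' t _ ih =>
    obtain ⟨v', h'⟩ := ih (hp.2 _) (fun x => emb (some ⟨_, x⟩)) exit (fun l => hM (some ⟨_, l⟩))
      (s k).head?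
    refine ⟨v', .head ?_ h'⟩
    rw [TM2.step, hM]
    simp only [code, start, TM2.stepAux, Store.take_ofNat hp.1]
    rw [Store.take_ofNat hp.1]
  | @loop_nil k p s hs =>
    refine ⟨none, .single ?_⟩
    rw [TM2.step, hM]
    simp only [code, start, TM2.stepAux, Store.take_ofNat hp.1, hs, List.head?_nil,
      Option.isSome_none, Bool.false_eq_true, if_false]
  | @loop_cons k p s s' s'' t t' hs _ _ ih₁ ih₂ =>
    obtain ⟨v₁, h₁⟩ := ih₁ hp.2 (fun x => emb (some x)) (emb none) (fun l => hM (some l))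
      (s k).head?
    obtain ⟨v₂, h₂⟩ := ih₂ hp emb exit hM v₁
    refine ⟨v₂, .head ?_ (h₁.trans h₂)⟩
    obtain ⟨c, l, hl⟩ := List.exists_cons_of_ne_nil hs
    rw [TM2.step, hM]
    simp only [code, start, TM2.stepAux, Store.take_ofNat hp.1, hl, List.head?_cons,
      Option.isSome_some, if_true]

/-- The Turing machine with `n + 2` stacks that runs a program, with its input on the stack `0` and
its output on the stack `1`. -/
def machine (p : Prog) (n : ℕ) : FinTM2 where
  K := Fin (n + 2)
  k₀ := 0
  k₁ := 1
  Γ _ := Γ'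
  Λ := Option p.Label
  main := some p.start
  σ := Option Γ'
  initialState := none
  Γk₀Fin := inferInstanceAs (Fintype Γ')
  m l := match l with
    | none => .load (fun _ => none) .halt
    | some l => p.code (n + 2) some none l

theorem Run.stepsTo_machine {p : Prog} {n : ℕ} (hp : p.Below n) {x y : List Γ'} {t : ℕ}
    (h : p.Run (Store.single 0 x) (Store.single 1 y) t) :
    StepsTo (p.machine n).step (t + 1) (initList (p.machine n) x) (haltList (p.machine n) y) := by
  obtain ⟨v, hv⟩ := h.stepsTo_step (M := (p.machine n).m) (hp.mono (Nat.le_add_right n 2))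
    some none (fun _ => rfl) none
  simp only [Store.single, Store.take_update (show 0 < n + 2 by lia),
    Store.take_update (show 1 < n + 2 by lia)] at hv
  have hx := initList_eq_update (p.machine n) x
  have hy := haltList_eq_update (p.machine n) y
  exact hx ▸ hy ▸ hv.trans (.single rfl)

end Prog

theorem polyTimeComputable_of_run {α β : Type} {ea : α → List Γ'} {eb : β → List Γ'} {f : α → β}
    (p : Prog) (P : Polynomial ℕ)
    (h : ∀ x, ∃ t ≤ P.eval (ea x).length,
      p.Run (Store.single 0 (ea x)) (Store.single 1 (eb (f x))) t) :
    PolyTimeComputable ea eb f := by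
  obtain ⟨n, hn⟩ := p.exists_below
  refine polyTimeComputable_iff.2
    ⟨p.machine n, Equiv.refl _, Equiv.refl _, P + 1, fun x => ?_⟩
  obtain ⟨t, ht, hr⟩ := h x
  refine ⟨t + 1, by simpa using ht, ?_⟩
  have hid (l : List Γ') : l.map (Equiv.refl Γ').symm = l := List.map_id l
  have hrun := hr.stepsTo_machine hn
  rw [← hid (ea x), ← hid (eb (f x))] at hrun
  exact hrun

/-! ## Composition of polynomial-time computations -/

/-- The number of push instructions in a machine statement, which bounds how much one step of the
machine can lengthen a stack. -/
def pushCount {K : Type*} {Γ : K → Type*} {Λ σ : Type*} : TM2.Stmt Γ Λ σ → ℕ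
  | .push _ _ q => pushCount q + 1
  | .peek _ _ q => pushCount q
  | .pop _ _ q => pushCount q
  | .load _ q => pushCount q
  | .branch _ q r => pushCount q + pushCount r
  | .goto _ => 0
  | .halt => 0

theorem length_stepAux_le {K : Type*} [DecidableEq K] {Γ : K → Type*} {Λ σ : Type*} (k : K)
    (q : TM2.Stmt Γ Λ σ) (v : σ) (S : ∀ k, List (Γ k)) :
    ((TM2.stepAux q v S).stk k).length ≤ (S k).length + pushCount q := by
  induction q generalizing v S with
  | push k' _ _ ih =>
    refine (ih _ _).trans ?_
    rcases eq_or_ne k k' with rfl | h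
    · rw [update_self, List.length_cons, pushCount]
      lia
    · rw [update_of_ne h, pushCount]
      lia
  | peek k' _ _ ih => exact ih _ _
  | pop k' _ _ ih =>
    refine (ih _ _).trans ?_
    rcases eq_or_ne k k' with rfl | h
    · rw [update_self, List.length_tail, pushCount]
      lia
    · rw [update_of_ne h, pushCount]
  | load _ _ ih => exact ih _ _
  | branch f q r ihq ihr =>
    simp only [TM2.stepAux, pushCount]
    cases f v
    · exact (ihr _ _).trans (by lia)
    · exact (ihq _ _).trans (by lia)
  | goto f => exact Nat.le_add_right _ _
  | halt => exact Nat.le_add_right _ _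

theorem exists_length_step_le (tm : FinTM2) (k : tm.K) : ∃ c, ∀ a b, tm.step a = some b →
    (b.stk k).length ≤ (a.stk k).length + c := by
  have := tm.ΛFin
  refine ⟨Finset.univ.sup fun l => pushCount (tm.m l), ?_⟩
  rintro ⟨_ | l, v, S⟩ b h
  · cases h
  · cases h
    exact (length_stepAux_le k _ _ _).trans
      (Nat.add_le_add_left (Finset.le_sup (f := fun l => pushCount (tm.m l)) (Finset.mem_univ l)) _)

theorem length_update_nil_le {K : Type*} [DecidableEq K] {Γ : K → Type*} (k k' : K)
    (x : List (Γ k)) : (update (fun _ => []) k x k' : List (Γ k')).length ≤ x.length := by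
  rcases eq_or_ne k' k with rfl | h
  · rw [update_self]
  · rw [update_of_ne h]
    exact Nat.zero_le _

theorem exists_length_output_le (tm : FinTM2) : ∃ c, ∀ {x y t},
    StepsTo tm.step t (initList tm x) (haltList tm y) → y.length ≤ x.length + t * c := by
  obtain ⟨c, hc⟩ := exists_length_step_le tm tm.k₁
  refine ⟨c, fun {x y t} h => ?_⟩
  have hle := h.le_add_mul (fun a => (a.stk tm.k₁).length) hc
  rw [initList_eq_update, haltList_eq_update] at hle
  dsimp only at hle
  rw [update_self] at hle
  exact hle.trans (Nat.add_le_add_right (length_update_nil_le _ _ _) _)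

theorem monotone_polynomial_eval (P : Polynomial ℕ) : Monotone fun n => P.eval n := by
  intro a b hab
  simp only [Polynomial.eval_eq_sum]
  exact Finset.sum_le_sum fun i _ => Nat.mul_le_mul_left _ (Nat.pow_le_pow_left hab i)

namespace composite

variable (M N : FinTM2)

/-- The stack alphabets of the machine that runs `M` and then `N`. The stack `none` is an extra one,
used for moving the output of `M` to the input stack of `N`. -/
abbrev Alphabet : Option (M.K ⊕ N.K) → Type
  | none => N.Γ N.k₀
  | some (Sum.inl k) => M.Γ k
  | some (Sum.inr k) => N.Γ k

/-- The labels of the machine that runs `M` and then `N`: besides those of `M` and `N`, the label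
`false` moves symbols to the extra stack and `true` moves symbols from it. -/
abbrev Label : Type := M.Λ ⊕ Bool ⊕ N.Λ

/-- The internal states of the machine that runs `M` and then `N`; the last component holds the
symbol that is being moved. -/
abbrev State : Type := M.σ × N.σ × Option (N.Γ N.k₀)

variable {M N}

/-- A statement of `M`, as a statement of the machine that runs `M` and then `N`. -/
def liftFst : TM2.Stmt M.Γ M.Λ M.σ → TM2.Stmt (Alphabet M N) (Label M N) (State M N)
  | .push k f q => .push (some (Sum.inl k)) (fun v => f v.1) (liftFst q)
  | .peek k f q => .peek (some (Sum.inl k)) (fun v o => (f v.1 o, v.2)) (liftFst q)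
  | .pop k f q => .pop (some (Sum.inl k)) (fun v o => (f v.1 o, v.2)) (liftFst q)
  | .load f q => .load (fun v => (f v.1, v.2)) (liftFst q)
  | .branch f q r => .branch (fun v => f v.1) (liftFst q) (liftFst r)
  | .goto f => .goto fun v => Sum.inl (f v.1)
  | .halt => .goto fun _ => Sum.inr (Sum.inl false)

/-- A statement of `N`, as a statement of the machine that runs `M` and then `N`. -/
def liftSnd : TM2.Stmt N.Γ N.Λ N.σ → TM2.Stmt (Alphabet M N) (Label M N) (State M N)
  | .push k f q => .push (some (Sum.inr k)) (fun v => f v.2.1) (liftSnd q)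
  | .peek k f q => .peek (some (Sum.inr k)) (fun v o => (v.1, f v.2.1 o, v.2.2)) (liftSnd q)
  | .pop k f q => .pop (some (Sum.inr k)) (fun v o => (v.1, f v.2.1 o, v.2.2)) (liftSnd q)
  | .load f q => .load (fun v => (v.1, f v.2.1, v.2.2)) (liftSnd q)
  | .branch f q r => .branch (fun v => f v.2.1) (liftSnd q) (liftSnd r)
  | .goto f => .goto fun v => Sum.inr (Sum.inr (f v.2.1))
  | .halt => .halt

/-- The joint contents of the stacks of `M`, those of `N`, and the extra stack. -/
def join (S : ∀ k, List (M.Γ k)) (T : ∀ k, List (N.Γ k)) (l : List (N.Γ N.k₀)) :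
    ∀ k, List (Alphabet M N k)
  | none => l
  | some (Sum.inl k) => S k
  | some (Sum.inr k) => T k

theorem join_nil : join (M := M) (N := N) (fun _ => []) (fun _ => []) [] = fun _ => [] := by
  funext i
  rcases i with _ | i | i <;> rfl

variable (S : ∀ k, List (M.Γ k)) (T : ∀ k, List (N.Γ k)) (l : List (N.Γ N.k₀))

theorem update_join_inl (k : M.K) (x : List (M.Γ k)) :
    update (join S T l) (some (Sum.inl k)) x = join (update S k x) T l := by
  funext i
  rcases i with _ | i | i
  · exact update_of_ne (by simp) _ _
  · rcases eq_or_ne i k with rfl | h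
    · exact (update_self (some (Sum.inl i)) _ _).trans (update_self i x S).symm
    · have hi : update S k x i = S i := update_of_ne h x S
      exact (update_of_ne (by simpa using h) _ _).trans hi.symm
  · exact update_of_ne (by simp) _ _

theorem update_join_inr (k : N.K) (x : List (N.Γ k)) :
    update (join S T l) (some (Sum.inr k)) x = join S (update T k x) l := by
  funext i
  rcases i with _ | i | i
  · exact update_of_ne (by simp) _ _
  · exact update_of_ne (by simp) _ _
  · rcases eq_or_ne i k with rfl | h
    · exact (update_self (some (Sum.inr i)) _ _).trans (update_self i x T).symm
    · have hi : update T k x i = T i := update_of_ne h x T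
      exact (update_of_ne (by simpa using h) _ _).trans hi.symm

theorem update_join_none (x : List (N.Γ N.k₀)) : update (join S T l) none x = join S T x := by
  funext i
  rcases i with _ | i | i
  · exact update_self none _ _
  · exact update_of_ne (by simp) _ _
  · exact update_of_ne (by simp) _ _

/-- A configuration of `M`, as a configuration of the machine that runs `M` and then `N`. Where `M`
has halted, the moving of its output begins. -/
def embFst (T : ∀ k, List (N.Γ k)) (l : List (N.Γ N.k₀)) (w : N.σ × Option (N.Γ N.k₀))
    (c : TM2.Cfg M.Γ M.Λ M.σ) : TM2.Cfg (Alphabet M N) (Label M N) (State M N) :=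
  ⟨some (c.l.elim (Sum.inr (Sum.inl false)) Sum.inl), (c.var, w), join c.stk T l⟩

/-- A configuration of `N`, as a configuration of the machine that runs `M` and then `N`. -/
def embSnd (S : ∀ k, List (M.Γ k)) (l : List (N.Γ N.k₀)) (v : M.σ) (o : Option (N.Γ N.k₀))
    (c : TM2.Cfg N.Γ N.Λ N.σ) : TM2.Cfg (Alphabet M N) (Label M N) (State M N) :=
  ⟨c.l.map fun x => Sum.inr (Sum.inr x), (v, c.var, o), join S c.stk l⟩

theorem stepAux_liftFst (q : TM2.Stmt M.Γ M.Λ M.σ) (v : M.σ) (w : N.σ × Option (N.Γ N.k₀)) :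
    TM2.stepAux (liftFst q) (v, w) (join S T l) = embFst T l w (TM2.stepAux q v S) := by
  induction q generalizing v S with
  | push k f q ih => simp only [liftFst, TM2.stepAux]; rw [← ih, ← update_join_inl]; rfl
  | peek k f q ih => simp only [liftFst, TM2.stepAux]; rw [← ih]; rfl
  | pop k f q ih => simp only [liftFst, TM2.stepAux]; rw [← ih, ← update_join_inl]; rfl
  | load f q ih => simp only [liftFst, TM2.stepAux]; rw [← ih]
  | branch f q r ihq ihr =>
    simp only [liftFst, TM2.stepAux]
    cases f v
    · exact ihr _ _
    · exact ihq _ _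
  | goto f => rfl
  | halt => rfl

theorem stepAux_liftSnd (q : TM2.Stmt N.Γ N.Λ N.σ) (v : M.σ) (w : N.σ) (o : Option (N.Γ N.k₀)) :
    TM2.stepAux (liftSnd q) (v, w, o) (join S T l) = embSnd S l v o (TM2.stepAux q w T) := by
  induction q generalizing w T with
  | push k f q ih => simp only [liftSnd, TM2.stepAux]; rw [← ih, ← update_join_inr]; rfl
  | peek k f q ih => simp only [liftSnd, TM2.stepAux]; rw [← ih]; rfl
  | pop k f q ih => simp only [liftSnd, TM2.stepAux]; rw [← ih, ← update_join_inr]; rfl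
  | load f q ih => simp only [liftSnd, TM2.stepAux]; rw [← ih]
  | branch f q r ihq ihr =>
    simp only [liftSnd, TM2.stepAux]
    cases f w
    · exact ihr _ _
    · exact ihq _ _
  | goto f => rfl
  | halt => rfl

end composite

open composite in
/-- The machine that runs `M`, translates its output by `e` while moving it through an extra stack
to the input stack of `N`, and runs `N`. The symbol `d` is a default value and is never pushed. -/
def composite (M N : FinTM2) (e : M.Γ M.k₁ → N.Γ N.k₀) (d : N.Γ N.k₀) : FinTM2 where
  K := Option (M.K ⊕ N.K)
  kFin := haveI := M.kFin; haveI := N.kFin; inferInstance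
  k₀ := some (Sum.inl M.k₀)
  k₁ := some (Sum.inr N.k₁)
  Γ := Alphabet M N
  Λ := Label M N
  main := Sum.inl M.main
  ΛFin := haveI := M.ΛFin; haveI := N.ΛFin; inferInstance
  σ := State M N
  initialState := (M.initialState, N.initialState, none)
  σFin := haveI := M.σFin; haveI := N.σFin; haveI := N.Γk₀Fin; inferInstance
  Γk₀Fin := M.Γk₀Fin
  m
    | Sum.inl x => liftFst (M.m x)
    | Sum.inr (Sum.inl false) =>
      .pop (some (Sum.inl M.k₁)) (fun v o => (v.1, v.2.1, o.map e))
        (.branch (fun v => v.2.2.isSome)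
          (.push none (fun v => v.2.2.getD d) (.goto fun _ => Sum.inr (Sum.inl false)))
          (.goto fun _ => Sum.inr (Sum.inl true)))
    | Sum.inr (Sum.inl true) =>
      .pop none (fun v o => (v.1, v.2.1, o))
        (.branch (fun v => v.2.2.isSome)
          (.push (some (Sum.inr N.k₀)) (fun v => v.2.2.getD d)
            (.goto fun _ => Sum.inr (Sum.inl true)))
          (.goto fun _ => Sum.inr (Sum.inr N.main)))
    | Sum.inr (Sum.inr x) => liftSnd (N.m x)

namespace composite

variable {M N : FinTM2} (S : ∀ k, List (M.Γ k)) (T : ∀ k, List (N.Γ k)) (l : List (N.Γ N.k₀))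
  (e : M.Γ M.k₁ → N.Γ N.k₀) (d : N.Γ N.k₀)

theorem stepsTo_embFst {n : ℕ} {a b : M.Cfg} (h : StepsTo M.step n a b)
    (w : N.σ × Option (N.Γ N.k₀)) :
    StepsTo (composite M N e d).step n (embFst T l w a) (embFst T l w b) := by
  refine h.map (embFst T l w) ?_
  rintro ⟨_ | x, v, S⟩ b h
  · cases h
  · cases h
    exact congrArg some (stepAux_liftFst S T l _ v w)

theorem stepsTo_embSnd {n : ℕ} {a b : N.Cfg} (h : StepsTo N.step n a b) (v : M.σ)
    (o : Option (N.Γ N.k₀)) :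
    StepsTo (composite M N e d).step n (embSnd S l v o a) (embSnd S l v o b) := by
  refine h.map (embSnd S l v o) ?_
  rintro ⟨_ | x, w, T⟩ b h
  · cases h
  · cases h
    exact congrArg some (stepAux_liftSnd S T l _ v w o)

theorem step_unload (v : M.σ) (w : N.σ) (o : Option (N.Γ N.k₀)) :
    (composite M N e d).step ⟨some (Sum.inr (Sum.inl false)), (v, w, o), join S T l⟩ =
      some (bif ((S M.k₁).head?.map e).isSome then
        ⟨some (Sum.inr (Sum.inl false)), (v, w, (S M.k₁).head?.map e),
          join (update S M.k₁ (S M.k₁).tail) T (((S M.k₁).head?.map e).getD d :: l)⟩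
      else
        ⟨some (Sum.inr (Sum.inl true)), (v, w, (S M.k₁).head?.map e),
          join (update S M.k₁ (S M.k₁).tail) T l⟩) := by
  rw [← update_join_none (update S M.k₁ (S M.k₁).tail) T l (_ :: _), ← update_join_inl]
  rfl

theorem step_load (v : M.σ) (w : N.σ) (o : Option (N.Γ N.k₀)) :
    (composite M N e d).step ⟨some (Sum.inr (Sum.inl true)), (v, w, o), join S T l⟩ =
      some (bif l.head?.isSome then
        ⟨some (Sum.inr (Sum.inl true)), (v, w, l.head?),
          join S (update T N.k₀ (l.head?.getD d :: T N.k₀)) l.tail⟩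
      else
        ⟨some (Sum.inr (Sum.inr N.main)), (v, w, l.head?), join S T l.tail⟩) := by
  rw [← update_join_inr S T l.tail, ← update_join_none S T l l.tail]
  rfl

theorem stepsTo_unload (v : M.σ) (w : N.σ) (o : Option (N.Γ N.k₀)) (x : List (M.Γ M.k₁)) :
    StepsTo (composite M N e d).step (x.length + 1)
      ⟨some (Sum.inr (Sum.inl false)), (v, w, o), join (update S M.k₁ x) T l⟩
      ⟨some (Sum.inr (Sum.inl true)), (v, w, none),
        join (update S M.k₁ []) T ((x.map e).reverse ++ l)⟩ := by
  induction x generalizing o l with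
  | nil =>
    refine .single ?_
    rw [step_unload, update_self, update_idem]
    rfl
  | cons c x ih =>
    refine .head ?_ (by simpa using ih (e c :: l) (some (e c)))
    rw [step_unload, update_self, update_idem]
    rfl

theorem stepsTo_load (v : M.σ) (w : N.σ) (o : Option (N.Γ N.k₀)) (x y : List (N.Γ N.k₀)) :
    StepsTo (composite M N e d).step (x.length + 1)
      ⟨some (Sum.inr (Sum.inl true)), (v, w, o), join S (update T N.k₀ y) x⟩
      ⟨some (Sum.inr (Sum.inr N.main)), (v, w, none),
        join S (update T N.k₀ (x.reverse ++ y)) []⟩ := by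
  induction x generalizing o y with
  | nil =>
    refine .single ?_
    rw [step_load]
    rfl
  | cons c x ih =>
    refine .head ?_ (by simpa using ih (some c) (c :: y))
    rw [step_load, update_self, update_idem]
    rfl

theorem stepsTo_initList_haltList {x : List (M.Γ M.k₀)} {y : List (M.Γ M.k₁)}
    {z : List (N.Γ N.k₁)} {t u : ℕ}
    (hM : StepsTo M.step t (initList M x) (haltList M y))
    (hN : StepsTo N.step u (initList N (y.map e)) (haltList N z)) :
    StepsTo (composite M N e d).step (t + (y.length + 1) + (y.length + 1) + u)
      (initList (composite M N e d) x) (haltList (composite M N e d) z) := by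
  rw [initList_eq_update, haltList_eq_update] at hM hN
  have hrunM := stepsTo_embFst (fun _ => []) [] e d hM (N.initialState, none)
  have hunload := stepsTo_unload (fun _ => []) (fun _ => []) [] e d M.initialState
    N.initialState none y
  have hload := stepsTo_load (update (fun _ => []) M.k₁ []) (fun _ => []) e d
    M.initialState N.initialState none (y.map e).reverse []
  have hrunN := stepsTo_embSnd (fun _ => []) [] e d hN M.initialState none
  have hS : (update (fun _ => []) M.k₁ [] : ∀ k, List (M.Γ k)) = fun _ => [] :=
    update_eq_self _ _
  have hT : (update (fun _ => []) N.k₀ [] : ∀ k, List (N.Γ k)) = fun _ => [] :=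
    update_eq_self _ _
  simp only [hS, hT, List.append_nil, List.reverse_reverse, List.length_reverse,
    List.length_map] at hunload hload
  have hrun := ((hrunM.trans hunload).trans hload).trans hrunN
  simp only [embFst, embSnd, ← update_join_inl, ← update_join_inr, join_nil] at hrun
  have hx := initList_eq_update (composite M N e d) x
  have hz := haltList_eq_update (composite M N e d) z
  exact hx ▸ hz ▸ hrun

end composite

theorem PolyTimeComputable.comp {α β γ A B C : Type} [Inhabited B] {ea : α → List A}
    {eb : β → List B} {ec : γ → List C} {f : α → β} {g : β → γ}
    (hg : PolyTimeComputable eb ec g) (hf : PolyTimeComputable ea eb f) :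
    PolyTimeComputable ea ec (fun x => g (f x)) := by
  obtain ⟨M, iM, oM, P, hM⟩ := polyTimeComputable_iff.1 hf
  obtain ⟨N, iN, oN, R, hN⟩ := polyTimeComputable_iff.1 hg
  obtain ⟨c, hc⟩ := exists_length_output_le M
  let Q : Polynomial ℕ := Polynomial.X + P * Polynomial.C c
  refine polyTimeComputable_iff.2
    ⟨composite M N (fun z => iN.symm (oM z)) (iN.symm default), iM, oN, P + (2 * Q + 2) + R.comp Q,
      fun x => ?_⟩
  obtain ⟨t, ht, hxy⟩ := hM x
  obtain ⟨u, hu, hyz⟩ := hN (f x)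
  have hlen : (eb (f x)).length ≤ Q.eval (ea x).length := by
    have hout := hc hxy
    simp only [List.length_map] at hout
    simp only [Q, Polynomial.eval_add, Polynomial.eval_X, Polynomial.eval_mul, Polynomial.eval_C]
    exact hout.trans (Nat.add_le_add_left (Nat.mul_le_mul_right c ht) _)
  have htranslate : ((eb (f x)).map oM.symm).map (fun z => iN.symm (oM z)) =
      (eb (f x)).map iN.symm := by
    simp only [List.map_map, comp_def, Equiv.apply_symm_apply]
  rw [← htranslate] at hyz
  refine ⟨_, ?_, composite.stepsTo_initList_haltList _ _ hxy hyz⟩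
  have huQ := hu.trans (monotone_polynomial_eval R hlen)
  simp only [List.length_map, Polynomial.eval_add, Polynomial.eval_mul, Polynomial.eval_comp,
    Polynomial.eval_ofNat]
  lia

theorem PolyTimeReduces.trans {P Q R : DecisionProblem} [Inhabited Q.Symbol]
    (h₁ : PolyTimeReduces P Q) (h₂ : PolyTimeReduces Q R) : PolyTimeReduces P R := by
  obtain ⟨f, hf, hf'⟩ := h₁
  obtain ⟨g, hg, hg'⟩ := h₂
  exact ⟨fun x => g (f x), hg.comp hf, fun x => (hf' x).trans (hg' _)⟩

theorem GIHard.of_reduces {P : DecisionProblem} (h : PolyTimeReduces graphIsomorphism P) :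
    GIHard P := fun _ hQ =>
  haveI : Inhabited graphIsomorphism.Symbol := inferInstanceAs (Inhabited Γ')
  PolyTimeReduces.trans hQ h

/-! ## Polynomial-time functions -/

namespace Prog

/-- `p.RunsWithin s s' T`: started on the stacks `s`, the program `p` stops after at most `T` steps
with the stacks `s'`. -/
def RunsWithin (p : Prog) (s s' : Store) (T : ℕ) : Prop := ∃ t ≤ T, p.Run s s' t

namespace RunsWithin

variable {p q : Prog} {s s' s'' : Store} {k T T' : ℕ}

theorem mono (h : p.RunsWithin s s' T) (hT : T ≤ T') : p.RunsWithin s s' T' := by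
  obtain ⟨t, ht, hr⟩ := h
  exact ⟨t, ht.trans hT, hr⟩

theorem congr (h : p.RunsWithin s s' T) (hs : s' = s'') (hT : T ≤ T') : p.RunsWithin s s'' T' :=
  hs ▸ h.mono hT

theorem skip (s : Store) : RunsWithin .skip s s 1 := ⟨1, le_rfl, .skip s⟩

theorem push (k : ℕ) (c : Γ') (s : Store) :
    RunsWithin (.push k c) s (update s k (c :: s k)) 1 :=
  ⟨1, le_rfl, .push k c s⟩

theorem pop (k : ℕ) (s : Store) : RunsWithin (.pop k) s (update s k (s k).tail) 1 :=
  ⟨1, le_rfl, .pop k s⟩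

theorem seq (h : p.RunsWithin s s' T) (h' : q.RunsWithin s' s'' T') :
    RunsWithin (.seq p q) s s'' (T + T') := by
  obtain ⟨t, ht, hr⟩ := h
  obtain ⟨t', ht', hr'⟩ := h'
  exact ⟨t + t', add_le_add ht ht', hr.seq hr'⟩

theorem cas {br : Option Γ' → Prog} (h : (br (s k).head?).RunsWithin s s' T) :
    RunsWithin (.cas k br) s s' (T + 1) := by
  obtain ⟨t, ht, hr⟩ := h
  exact ⟨t + 1, Nat.succ_le_succ ht, .cas hr⟩

theorem loop_nil (h : s k = []) : RunsWithin (.loop k p) s s 1 := ⟨1, le_rfl, .loop_nil h⟩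

theorem loop_cons (hk : s k ≠ []) (h : p.RunsWithin s s' T)
    (h' : RunsWithin (.loop k p) s' s'' T') : RunsWithin (.loop k p) s s'' (T + T' + 1) := by
  obtain ⟨t, ht, hr⟩ := h
  obtain ⟨t', ht', hr'⟩ := h'
  exact ⟨t + t' + 1, by lia, .loop_cons hk hr hr'⟩

end RunsWithin

/-- Take the symbols off the stack `a` one by one, running the program `f c` after taking off the
symbol `c`. -/
def drain (a : ℕ) (f : Γ' → Prog) : Prog :=
  .loop a (.cas a fun
    | none => .skip
    | some c => .seq (.pop a) (f c))

/-- Empty the stack `a`. -/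
def clear (a : ℕ) : Prog := drain a fun _ => .skip

/-- Move the stack `a` to the top of the stack `b`, reversing it. -/
def move (a b : ℕ) : Prog := drain a fun c => .push b c

/-- Move the stack `a` to the tops of both stacks `b` and `c`, reversing it. -/
def fork (a b c : ℕ) : Prog := drain a fun x => .seq (.push b x) (.push c x)

/-- Copy the stack `a` to the top of the stack `o`, with the help of the empty stack `m`. -/
def copy (a o m : ℕ) : Prog := .seq (move a m) (fork m a o)

/-- Move the stack `a` to the top of the stack `o`, with the help of the empty stack `m`. -/
def transfer (a o m : ℕ) : Prog := .seq (move a m) (move m o)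

/-- Replace the stack `k` by what the program `p` puts on the empty stack `o`, with the help of the
empty stack `m`. -/
def replace (p : Prog) (k o m : ℕ) : Prog := .seq (.seq p (clear k)) (transfer o k m)

theorem runsWithin_drain {a T : ℕ} {f : Γ' → Prog} (G : List Γ' → Store) (l : List Γ')
    (hf : ∀ r c l', r.reverse ++ c :: l' = l →
      (f c).RunsWithin (update (G r) a l') (update (G (c :: r)) a l') T) :
    (drain a f).RunsWithin (update (G []) a l) (update (G l.reverse) a [])
      (l.length * (T + 3) + 1) := by
  suffices ∀ l' r, r.reverse ++ l' = l → (drain a f).RunsWithin (update (G r) a l')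
      (update (G l.reverse) a []) (l'.length * (T + 3) + 1) from this l [] rfl
  intro l'
  induction l' with
  | nil =>
    rintro r rfl
    rw [List.append_nil, List.reverse_reverse]
    exact (RunsWithin.loop_nil (update_self a [] (G r))).mono (by simp)
  | cons c l' ih =>
    intro r hr
    have hpop := RunsWithin.pop a (update (G r) a (c :: l'))
    rw [update_self, update_idem, List.tail_cons] at hpop
    have hrest := ih (c :: r) (by rw [List.reverse_cons, List.append_assoc]; exact hr)
    refine (RunsWithin.loop_cons (by simp) (.cas (T := 1 + T) ?_) hrest).mono
      (by rw [List.length_cons]; lia)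
    rw [update_self]
    exact hpop.seq (hf r c l' hr)

theorem runsWithin_clear (a : ℕ) (s : Store) :
    (clear a).RunsWithin s (update s a []) (4 * (s a).length + 1) := by
  have h := runsWithin_drain (a := a) (fun _ => s) (s a) fun _ _ _ _ => .skip _
  rw [update_eq_self] at h
  exact h.mono (by lia)

theorem runsWithin_move {a b : ℕ} (hab : a ≠ b) (s : Store) :
    (move a b).RunsWithin s (update (update s a []) b ((s a).reverse ++ s b))
      (4 * (s a).length + 1) := by
  have h := runsWithin_drain (a := a) (T := 1) (f := .push b) (fun r => update s b (r ++ s b))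
    (s a) fun r c l' _ => (RunsWithin.push b c _).congr (by grind [update_apply]) le_rfl
  simp only [List.nil_append, update_eq_self] at h
  exact h.congr (update_comm hab.symm _ _ _) (by lia)

theorem runsWithin_fork {a b c : ℕ} (hab : a ≠ b) (hac : a ≠ c) (hbc : b ≠ c) (s : Store) :
    (fork a b c).RunsWithin s
      (update (update (update s a []) b ((s a).reverse ++ s b)) c ((s a).reverse ++ s c))
      (5 * (s a).length + 1) := by
  have h := runsWithin_drain (a := a) (T := 2) (f := fun x => .seq (.push b x) (.push c x))
    (fun r => update (update s b (r ++ s b)) c (r ++ s c)) (s a)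
    fun r x l' _ => ((RunsWithin.push b x _).seq (.push c x _)).congr (by grind [update_apply])
      le_rfl
  simp only [List.nil_append, update_eq_self] at h
  exact h.congr (by grind [update_apply]) (by lia)

theorem runsWithin_copy {a o m : ℕ} (hao : a ≠ o) (ham : a ≠ m) (hom : o ≠ m) {s : Store}
    (hm : s m = []) :
    (copy a o m).RunsWithin s (update s o (s a ++ s o)) (9 * (s a).length + 2) :=
  ((runsWithin_move ham s).seq (runsWithin_fork ham.symm hom.symm hao _)).congr
    (by grind [update_apply]) (by grind [update_apply])

theorem runsWithin_transfer {a o m : ℕ} (hao : a ≠ o) (ham : a ≠ m) (hom : o ≠ m) {s : Store}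
    (hm : s m = []) :
    (transfer a o m).RunsWithin s (update (update s a []) o (s a ++ s o))
      (8 * (s a).length + 2) :=
  ((runsWithin_move ham s).seq (runsWithin_move hom.symm _)).congr
    (by grind [update_apply]) (by grind [update_apply])

theorem runsWithin_replace {p : Prog} {k o m T : ℕ} (hko : k ≠ o) (hkm : k ≠ m) (hom : o ≠ m)
    {s : Store} {w : List Γ'} (ho : s o = []) (hm : s m = [])
    (hp : p.RunsWithin s (update s o w) T) :
    (replace p k o m).RunsWithin s (update s k w) (T + 4 * (s k).length + 8 * w.length + 3) :=
  ((hp.seq (runsWithin_clear k _)).seq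
    (runsWithin_transfer hko.symm hom hkm (by grind [update_apply]))).congr
    (by grind [update_apply]) (by grind [update_apply])

theorem runsWithin_drain_counting {q : Prog} {a b k T : ℕ} (hab : a ≠ b) (hbk : b ≠ k)
    (s : Store) (w : ℕ → List Γ') (l : List Γ')
    (hq : ∀ i < l.length, ∀ l',
      q.RunsWithin (update (update (update s b (List.replicate i (Γ'.bit true))) k (w i)) a l')
        (update (update (update s b (List.replicate i (Γ'.bit true))) k (w (i + 1))) a l') T) :
    (drain a fun _ => .seq q (.push b (Γ'.bit true))).RunsWithin
      (update (update (update s b []) k (w 0)) a l)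
      (update (update (update s b (List.replicate l.length (Γ'.bit true))) k (w l.length)) a [])
      (l.length * (T + 4) + 1) := by
  have h := runsWithin_drain (a := a) (T := T + 1) (f := fun _ => .seq q (.push b (Γ'.bit true)))
    (fun r => update (update s b (List.replicate r.length (Γ'.bit true))) k (w r.length)) l ?_
  · simpa only [List.length_reverse, List.length_nil, List.replicate_zero] using h
  · intro r c l' hr
    have hlt : r.length < l.length := by
      rw [← hr, List.length_append, List.length_reverse, List.length_cons]
      lia
    exact ((hq r.length hlt l').seq (.push b _ _)).congr
      (by grind [update_apply]) le_rfl

end Prog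

/-- Types whose elements are written as strings. In contrast to the encodings of the problems,
`str` need not be injective: natural numbers are written in unary and propositions are nonempty
strings if they are true. -/
class Str (β : Type) where
  str : β → List Γ'

/-- Types whose elements are stored as a family of strings, one on each of a family of stacks. The
arguments of polynomial-time functions are measured by `size`. -/
class Data (α : Type) where
  Idx : Type
  enc : α → Idx → List Γ'
  size : α → ℕ
  length_le : ∀ x i, (enc x i).length ≤ size x

open Str Data

instance : Str (List Γ') := ⟨fun l => l⟩

instance : Str ℕ := ⟨fun n => List.replicate n (Γ'.bit true)⟩

open Classical in
instance : Str Prop := ⟨fun p => if p then [Γ'.bit true] else []⟩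

theorem str_list (l : List Γ') : str l = l := rfl

theorem str_nat (n : ℕ) : str n = List.replicate n (Γ'.bit true) := rfl

open Classical in
theorem str_prop (p : Prop) : str p = if p then [Γ'.bit true] else [] := rfl

theorem length_str_nat (n : ℕ) : (str n).length = n := List.length_replicate

instance {β : Type} [Str β] : Data β where
  Idx := Unit
  enc x _ := str x
  size x := (str x).length
  length_le _ _ := le_rfl

instance {α β : Type} [Data α] [Data β] : Data (α × β) where
  Idx := Idx α ⊕ Idx β
  enc x := Sum.elim (enc x.1) (enc x.2)
  size x := size x.1 + size x.2
  length_le x i := by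
    rcases i with i | i
    · exact (length_le x.1 i).trans (Nat.le_add_right _ _)
    · exact (length_le x.2 i).trans (Nat.le_add_left _ _)

section

variable {α β γ δ : Type} [Data α]

/-- `T` is bounded by a polynomial in the size of the argument. -/
def PolyBounded (T : α → ℕ) : Prop := ∃ P : Polynomial ℕ, ∀ x, T x ≤ P.eval (size x)

namespace PolyBounded

variable {T T' : α → ℕ}

theorem mono (h : PolyBounded T') (hT : ∀ x, T x ≤ T' x) : PolyBounded T := by
  obtain ⟨P, hP⟩ := h
  exact ⟨P, fun x => (hT x).trans (hP x)⟩

theorem const (c : ℕ) : PolyBounded fun _ : α => c := ⟨Polynomial.C c, fun _ => by simp⟩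

theorem size : PolyBounded (Data.size : α → ℕ) := ⟨Polynomial.X, fun _ => by simp⟩

theorem add (h : PolyBounded T) (h' : PolyBounded T') : PolyBounded fun x => T x + T' x := by
  obtain ⟨P, hP⟩ := h
  obtain ⟨P', hP'⟩ := h'
  exact ⟨P + P', fun x => by simpa using add_le_add (hP x) (hP' x)⟩

theorem mul (h : PolyBounded T) (h' : PolyBounded T') : PolyBounded fun x => T x * T' x := by
  obtain ⟨P, hP⟩ := h
  obtain ⟨P', hP'⟩ := h'
  exact ⟨P * P', fun x => by simpa using Nat.mul_le_mul (hP x) (hP' x)⟩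

theorem sum {ι : Type} [Fintype ι] {T : ι → α → ℕ} (h : ∀ i, PolyBounded (T i)) :
    PolyBounded fun x => ∑ i, T i x := by
  choose P hP using h
  exact ⟨∑ i, P i, fun x => by
    simpa only [Polynomial.eval_finsetSum] using Finset.sum_le_sum fun i _ => hP i x⟩

theorem exists_uniform [Data β] {T : β → ℕ} {B : α → ℕ} (h : PolyBounded T) (hB : PolyBounded B) :
    ∃ T' : α → ℕ, PolyBounded T' ∧ ∀ x y, Data.size y ≤ B x → T y ≤ T' x := by
  obtain ⟨P, hP⟩ := h
  obtain ⟨Q, hQ⟩ := hB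
  exact ⟨fun x => P.eval (Q.eval (Data.size x)), ⟨P.comp Q, fun x => by rw [Polynomial.eval_comp]⟩,
    fun x y hy => (hP y).trans (monotone_polynomial_eval P (hy.trans (hQ x)))⟩

end PolyBounded

/-- `f` can be computed in time `T`: wherever the argument is stored, there is a program that puts
the value on top of a given stack `o` and leaves all other stacks unchanged, provided that the
stacks from `m` on are empty at the start. -/
def Implements [Str β] (T : α → ℕ) (f : α → β) : Prop :=
  ∀ (a : Idx α → ℕ) (o m : ℕ), (∀ i, a i < m) → o < m → (∀ i, a i ≠ o) →
    ∃ p : Prog, ∀ (x : α) (s : Store), (∀ i, s (a i) = enc x i) → (∀ j, m ≤ j → s j = []) →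
      p.RunsWithin s (update s o (str (f x) ++ s o)) (T x)

/-- The functions computable in polynomial time, with the arguments and values in memory. -/
structure PolyTime [Str β] (f : α → β) : Prop where
  exists_implements : ∃ T, PolyBounded T ∧ Implements T f
  polyBounded_length : PolyBounded fun x => (str (f x)).length

/-- `φ` only rearranges the strings that its argument consists of. -/
def Rearranges [Data β] (φ : α → β) : Prop :=
  ∃ r : Idx β → Idx α, (∀ x i, enc (φ x) i = enc x (r i)) ∧ ∃ c, ∀ x, size (φ x) ≤ c * size x

namespace Rearranges

variable [Data β] [Data γ]

theorem id : Rearranges (fun x : α => x) :=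
  ⟨fun i => i, fun _ _ => rfl, 1, fun x => (one_mul (size x)).ge⟩

theorem fst {φ : α → β × γ} (h : Rearranges φ) : Rearranges fun x => (φ x).1 := by
  obtain ⟨r, hr, c, hc⟩ := h
  exact ⟨fun i => r (Sum.inl i), fun x i => hr x (Sum.inl i), c, fun x =>
    (Nat.le_add_right _ _).trans (hc x)⟩

theorem snd {φ : α → β × γ} (h : Rearranges φ) : Rearranges fun x => (φ x).2 := by
  obtain ⟨r, hr, c, hc⟩ := h
  exact ⟨fun i => r (Sum.inr i), fun x i => hr x (Sum.inr i), c, fun x =>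
    (Nat.le_add_left _ _).trans (hc x)⟩

theorem pair {φ : α → β} {ψ : α → γ} (h : Rearranges φ) (h' : Rearranges ψ) :
    Rearranges fun x => (φ x, ψ x) := by
  obtain ⟨r, hr, c, hc⟩ := h
  obtain ⟨r', hr', c', hc'⟩ := h'
  refine ⟨Sum.elim r r', ?_, c + c', fun x => ?_⟩
  · rintro x (i | i)
    · exact hr x i
    · exact hr' x i
  · rw [add_mul]
    exact add_le_add (hc x) (hc' x)

end Rearranges

namespace Implements

open Prog

theorem rearrange [Data β] [Str γ] {T : β → ℕ} {f : β → γ} {φ : α → β} (hf : Implements T f)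
    {r : Idx β → Idx α} (hr : ∀ x i, enc (φ x) i = enc x (r i)) :
    Implements (fun x => T (φ x)) fun x => f (φ x) := by
  intro a o m ham hom hao
  obtain ⟨p, hp⟩ := hf (fun i => a (r i)) o m (fun _ => ham _) hom (fun _ => hao _)
  exact ⟨p, fun x s hs hj => hp (φ x) s (fun i => (hs _).trans (hr x i).symm) hj⟩

theorem nil : Implements (fun _ : α => 1) fun _ => ([] : List Γ') :=
  fun _ o _ _ _ _ => ⟨.skip, fun _ s _ _ =>
    (RunsWithin.skip s).congr (by rw [str_list, List.nil_append, update_eq_self]) le_rfl⟩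

theorem id [Str β] : Implements (fun x : β => 9 * (str x).length + 2) fun x => x := by
  intro a o m ham hom hao
  refine ⟨copy (a ()) o m, fun x s hs hj => ?_⟩
  have h := runsWithin_copy (hao ()) (ham ()).ne hom.ne (hj m le_rfl)
  rwa [hs] at h

theorem bind [Str β] [Str γ] {g : α → β} {f : α × β → γ} {T : α → ℕ} {T' : α × β → ℕ}
    (hg : Implements T g) (hf : Implements T' f) :
    Implements (fun x => T x + T' (x, g x) + (4 * (str (g x)).length + 1))
      fun x => f (x, g x) := by
  intro a o m ham hom hao
  have ham' : ∀ i, a i < m + 1 := fun i => (ham i).trans m.lt_succ_self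
  obtain ⟨q, hq⟩ := hg a m (m + 1) ham' m.lt_succ_self fun i => (ham i).ne
  obtain ⟨p, hp⟩ := hf (Sum.elim a fun _ => m) o (m + 1) (Sum.forall.2 ⟨ham', fun _ => by simp⟩)
    (hom.trans m.lt_succ_self) (Sum.forall.2 ⟨hao, fun _ => hom.ne'⟩)
  refine ⟨.seq (.seq q p) (clear m), fun x s hs hj => ?_⟩
  have hm : s m = [] := hj m le_rfl
  have hq' := hq x s hs fun j hjm => hj j (by lia)
  rw [hm, List.append_nil] at hq'
  have hp' := hp (x, g x) (update s m (str (g x)))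
    (Sum.forall.2 ⟨fun i => by rw [Sum.elim_inl, update_of_ne (ham i).ne]; exact hs i,
      fun _ => update_self ..⟩)
    fun j hjm => by rw [update_of_ne (by lia), hj j (by lia)]
  exact ((hq'.seq hp').seq (runsWithin_clear m _)).congr (by grind [update_apply])
    (by rw [update_of_ne hom.ne', update_self])

theorem cons {T : α → ℕ} {f : α → List Γ'} (hf : Implements T f) (c : Γ') :
    Implements (fun x => T x + 1) fun x => c :: f x := by
  intro a o m ham hom hao
  obtain ⟨p, hp⟩ := hf a o m ham hom hao
  exact ⟨.seq p (.push o c), fun x s hs hj =>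
    ((hp x s hs hj).seq (.push o c _)).congr (by simp [str_list]) le_rfl⟩

theorem append {T T' : α → ℕ} {f g : α → List Γ'} (hf : Implements T f) (hg : Implements T' g) :
    Implements (fun x => T' x + T x) fun x => f x ++ g x := by
  intro a o m ham hom hao
  obtain ⟨p, hp⟩ := hf a o m ham hom hao
  obtain ⟨q, hq⟩ := hg a o m ham hom hao
  refine ⟨.seq q p, fun x s hs hj => ?_⟩
  exact ((hq x s hs hj).seq (hp x _ (fun i => by rw [update_of_ne (hao i), hs i])
    fun j hjm => by rw [update_of_ne (by lia), hj j hjm])).congr (by simp [str_list]) le_rfl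

theorem tail {T : α → ℕ} {f : α → List Γ'} (hf : Implements T f) :
    Implements (fun x => T x + 1 + (8 * (f x).length + 2)) fun x => (f x).tail := by
  intro a o m ham hom _
  obtain ⟨p, hp⟩ := hf a m (m + 1) (fun i => (ham i).trans m.lt_succ_self) m.lt_succ_self
    fun i => (ham i).ne
  refine ⟨.seq (.seq p (.pop m)) (transfer m o (m + 1)), fun x s hs hj => ?_⟩
  have hm : s m = [] := hj m le_rfl
  have hm' : s (m + 1) = [] := hj _ (by lia)
  have hp' := hp x s hs fun j hjm => hj j (by lia)
  rw [hm, List.append_nil, str_list] at hp'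
  exact ((hp'.seq (.pop m _)).seq (runsWithin_transfer (o := o) (m := m + 1) hom.ne' (by lia)
    (by lia) (by grind [update_apply]))).congr (by grind [update_apply, str_list])
    (by simp only [update_self, List.length_tail]; lia)

theorem cases [Str β] {T : α → ℕ} {T' : Option Γ' → α → ℕ} {g : α → List Γ'}
    {f : Option Γ' → α → β} (hg : Implements T g) (hf : ∀ c, Implements (T' c) (f c)) :
    Implements (fun x => T x + (4 * (g x).length + 1 + T' (g x).head? x + 1))
      fun x => f (g x).head? x := by
  intro a o m ham hom hao
  obtain ⟨q, hq⟩ := hg a m (m + 1) (fun i => (ham i).trans m.lt_succ_self) m.lt_succ_self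
    fun i => (ham i).ne
  choose p hp using fun c => hf c a o m ham hom hao
  refine ⟨.seq q (.cas m fun c => .seq (clear m) (p c)), fun x s hs hj => ?_⟩
  have hm : s m = [] := hj m le_rfl
  have hq' := hq x s hs fun j hjm => hj j (by lia)
  rw [hm, List.append_nil, str_list] at hq'
  have hclear := runsWithin_clear m (update s m (g x))
  rw [update_self, update_idem, ← hm, update_eq_self] at hclear
  refine hq'.seq (.cas ?_)
  rw [update_self]
  exact hclear.seq (hp _ x s hs hj)

end Implements

namespace PolyTime

theorem of_str_eq [Str β] [Str γ] {f : α → β} {g : α → γ} (hf : PolyTime f)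
    (h : ∀ x, str (f x) = str (g x)) : PolyTime g := by
  obtain ⟨⟨T, hT, hfT⟩, hl⟩ := hf
  exact ⟨⟨T, hT, fun a o m ham hom hao => by simpa only [h] using hfT a o m ham hom hao⟩,
    by simpa only [h] using hl⟩

theorem congr [Str β] {f g : α → β} (hf : PolyTime f) (h : ∀ x, f x = g x) : PolyTime g :=
  (funext h : f = g) ▸ hf

theorem rearrange [Data β] [Str γ] {f : β → γ} {φ : α → β} (hf : PolyTime f)
    (h : Rearranges φ) : PolyTime fun x => f (φ x) := by
  obtain ⟨⟨T, hT, hfT⟩, hl⟩ := hf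
  obtain ⟨r, hr, c, hc⟩ := h
  have hB : PolyBounded fun x : α => c * size x := (PolyBounded.const c).mul .size
  obtain ⟨T', hT', hle⟩ := hT.exists_uniform hB
  obtain ⟨L, hL, hlL⟩ := hl.exists_uniform hB
  exact ⟨⟨_, hT'.mono fun x => hle x _ (hc x), hfT.rearrange hr⟩,
    hL.mono fun x => hlL x _ (hc x)⟩

theorem nil : PolyTime fun _ : α => ([] : List Γ') :=
  ⟨⟨_, .const 1, Implements.nil⟩, .const 0⟩

theorem id [Str β] : PolyTime fun x : β => x :=
  ⟨⟨_, ((PolyBounded.const 9).mul .size).add (.const 2), Implements.id⟩, .size⟩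

theorem bind [Str β] [Str γ] {g : α → β} {f : α × β → γ} (hf : PolyTime f) (hg : PolyTime g) :
    PolyTime fun x => f (x, g x) := by
  obtain ⟨⟨T, hT, hgT⟩, hgl⟩ := hg
  obtain ⟨⟨T', hT', hfT'⟩, hfl⟩ := hf
  have hB := PolyBounded.size.add hgl
  obtain ⟨U, hU, hle⟩ := hT'.exists_uniform hB
  obtain ⟨L, hL, hlL⟩ := hfl.exists_uniform hB
  exact ⟨⟨_, (hT.add (hU.mono fun x => hle x (x, g x) le_rfl)).add
    (((PolyBounded.const 4).mul hgl).add (.const 1)), hgT.bind hfT'⟩,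
    hL.mono fun x => hlL x (x, g x) le_rfl⟩

theorem cons (c : Γ') {f : α → List Γ'} (hf : PolyTime f) : PolyTime fun x => c :: f x := by
  obtain ⟨⟨T, hT, hfT⟩, hl⟩ := hf
  exact ⟨⟨_, hT.add (.const 1), hfT.cons c⟩, hl.add (.const 1)⟩

theorem append {f g : α → List Γ'} (hf : PolyTime f) (hg : PolyTime g) :
    PolyTime fun x => f x ++ g x := by
  obtain ⟨⟨T, hT, hfT⟩, hfl⟩ := hf
  obtain ⟨⟨T', hT', hgT'⟩, hgl⟩ := hg
  exact ⟨⟨_, hT'.add hT, hfT.append hgT'⟩, (hfl.add hgl).mono fun x => List.length_append.le⟩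

theorem tail {f : α → List Γ'} (hf : PolyTime f) : PolyTime fun x => (f x).tail := by
  obtain ⟨⟨T, hT, hfT⟩, hl⟩ := hf
  exact ⟨⟨_, (hT.add (.const 1)).add (((PolyBounded.const 8).mul hl).add (.const 2)), hfT.tail⟩,
    hl.mono fun x => by simp [str_list]⟩

theorem cases [Str β] {g : α → List Γ'} {f : Option Γ' → α → β} (hf : ∀ c, PolyTime (f c))
    (hg : PolyTime g) : PolyTime fun x => f (g x).head? x := by
  obtain ⟨⟨T, hT, hgT⟩, hgl⟩ := hg
  choose T' hT' hfT' using fun c => (hf c).exists_implements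
  have hsum : ∀ (V : Option Γ' → α → ℕ), (∀ c, PolyBounded (V c)) →
      PolyBounded fun x => V (g x).head? x := fun V hV => (PolyBounded.sum hV).mono fun x =>
    Finset.single_le_sum (f := fun c => V c x) (fun _ _ => Nat.zero_le _) (Finset.mem_univ _)
  exact ⟨⟨_, hT.add (((((PolyBounded.const 4).mul hgl).add (.const 1)).add (hsum T' hT')).add
    (.const 1)), hgT.cases hfT'⟩, hsum _ fun c => (hf c).polyBounded_length⟩

end PolyTime

end

/-! ## Bounded recursion -/

section

open Str Data Prog

variable {α β γ δ : Type} [Data α] [Str γ] [Str δ]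

theorem Implements.exists_runsWithin_step {h : (α × ℕ) × γ → γ} {T : (α × ℕ) × γ → ℕ}
    (hh : Implements T h) {a : Idx α → ℕ} {m : ℕ} (ham : ∀ i, a i < m) :
    ∃ p : Prog, ∀ (x : α) (i : ℕ) (y : γ) (s : Store) (l : List Γ'), (∀ j, s (a j) = enc x j) →
      (∀ j, m ≤ j → s j = []) → p.RunsWithin
        (update (update (update s (m + 1) (str i)) (m + 2) (str y)) m l)
        (update (update (update s (m + 1) (str i)) (m + 2) (str (h ((x, i), y)))) m l)
        (T ((x, i), y) + 4 * (str y).length + 8 * (str (h ((x, i), y))).length + 3) := by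
  obtain ⟨p, hp⟩ := hh (Sum.elim (Sum.elim a fun _ => m + 1) fun _ => m + 2) (m + 3) (m + 4)
    (Sum.forall.2 ⟨Sum.forall.2 ⟨fun i => (ham i).trans (by lia), by simp⟩, by simp⟩) (by lia)
    (Sum.forall.2 ⟨Sum.forall.2 ⟨fun i => ((ham i).trans (by lia)).ne, by simp⟩, by simp⟩)
  refine ⟨replace p (m + 2) (m + 3) (m + 4), fun x i y s l hs hj => ?_⟩
  set S := update (update (update s (m + 1) (str i)) (m + 2) (str y)) m l
  have hrun := hp ((x, i), y) S
    (Sum.forall.2 ⟨Sum.forall.2 ⟨fun j => ?_, fun _ => ?_⟩, fun _ => ?_⟩)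
    fun j hjm => by grind [update_apply]
  · have h₃ : S (m + 3) = [] := by grind [update_apply]
    rw [h₃, List.append_nil] at hrun
    exact (runsWithin_replace (by lia) (by lia) (by lia) h₃ (by grind [update_apply]) hrun).congr
      (by grind [update_apply]) (by grind [update_apply])
  · have := ham j
    exact (by grind [update_apply] : S (a j) = s (a j)).trans (hs j)
  · exact (by grind [update_apply] : S (m + 1) = str i)
  · exact (by grind [update_apply] : S (m + 2) = str y)

theorem Implements.recursion {g : α → γ} {n : α → δ} {h : (α × ℕ) × γ → γ} {R : α → ℕ → γ}
    {Tg Tn Th L : α → ℕ} {T : (α × ℕ) × γ → ℕ} (hg : Implements Tg g) (hn : Implements Tn n)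
    (hh : Implements T h) (hR₀ : ∀ x, R x 0 = g x) (hR : ∀ x i, R x (i + 1) = h ((x, i), R x i))
    (hL : ∀ x, ∀ i ≤ (str (n x)).length, (str (R x i)).length ≤ L x)
    (hT : ∀ x, ∀ i < (str (n x)).length, T ((x, i), R x i) ≤ Th x) :
    Implements (fun x => Tn x + Tg x + ((str (n x)).length * (Th x + 12 * L x + 7) + 1) +
      (4 * (str (n x)).length + 1) + (8 * L x + 2)) fun x => R x (str (n x)).length := by
  intro a o m ham hom _
  obtain ⟨pn, hpn⟩ := hn a m (m + 3) (fun i => (ham i).trans (by lia)) (by lia) fun i => (ham i).ne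
  obtain ⟨pg, hpg⟩ := hg a (m + 2) (m + 3) (fun i => (ham i).trans (by lia)) (by lia)
    fun i => ((ham i).trans (by lia)).ne
  obtain ⟨ph, hph⟩ := hh.exists_runsWithin_step ham
  refine ⟨.seq (.seq (.seq (.seq pn pg) (drain m fun _ => .seq ph (.push (m + 1) (Γ'.bit true))))
    (clear (m + 1))) (transfer (m + 2) o (m + 3)), fun x s hs hj => ?_⟩
  have hempty : ∀ k, s (m + k) = [] := fun k => hj _ (Nat.le_add_right _ _)
  have hm : s m = [] := hempty 0
  have hinit := (hpn x s hs fun j hjm => hj j (by lia)).seq (hpg x _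
    (fun i => by rw [update_of_ne (ham i).ne, hs i])
    fun j hjm => by rw [update_of_ne (by lia), hj j (by lia)])
  rw [hm, List.append_nil, update_of_ne (by lia), hempty 2, List.append_nil, ← hR₀] at hinit
  have hloop := runsWithin_drain_counting (q := ph) (a := m) (b := m + 1) (k := m + 2)
    (T := Th x + 12 * L x + 3) (by lia) (by lia) s (fun i => str (R x i)) (str (n x))
    fun i hi l => (hph x i (R x i) s l hs hj).congr (by rw [hR, str_nat]) <| by
      have := hL x i hi.le
      have := hL x (i + 1) hi
      have := hT x i hi
      rw [hR] at *
      lia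
  have hend := hL x _ le_rfl
  exact (((hinit.congr (by grind [update_apply]) le_rfl).seq hloop).seq
    (runsWithin_clear (m + 1) _)).seq (runsWithin_transfer (o := o) (m := m + 3) (by lia) (by lia)
      (by lia) (by grind [update_apply])) |>.congr (by grind [update_apply])
    (by grind [update_apply])

theorem PolyTime.recursion {g : α → γ} {n : α → δ} {h : (α × ℕ) × γ → γ} {R : α → ℕ → γ}
    {L : α → ℕ} (hh : PolyTime h) (hg : PolyTime g) (hn : PolyTime n) (hL : PolyBounded L)
    (hR₀ : ∀ x, R x 0 = g x) (hR : ∀ x i, R x (i + 1) = h ((x, i), R x i))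
    (hRL : ∀ x, ∀ i ≤ (str (n x)).length, (str (R x i)).length ≤ L x) :
    PolyTime fun x => R x (str (n x)).length := by
  obtain ⟨Tg, hTg, hgT⟩ := hg.exists_implements
  obtain ⟨Tn, hTn, hnT⟩ := hn.exists_implements
  obtain ⟨T, hT, hhT⟩ := hh.exists_implements
  obtain ⟨Th, hTh, hle⟩ := hT.exists_uniform ((PolyBounded.size.add hn.polyBounded_length).add hL)
  have hstep : ∀ x, ∀ i < (str (n x)).length, T ((x, i), R x i) ≤ Th x := fun x i hi =>
    hle x _ (add_le_add (add_le_add_right ((length_str_nat i).trans_le hi.le) _) (hRL x i hi.le))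
  have hbound := ((((hTn.add hTg).add ((hn.polyBounded_length.mul
    ((hTh.add ((PolyBounded.const 12).mul hL)).add (.const 7))).add (.const 1))).add
    (((PolyBounded.const 4).mul hn.polyBounded_length).add (.const 1))).add
    (((PolyBounded.const 8).mul hL).add (.const 2)))
  exact ⟨⟨_, hbound, hgT.recursion hnT hhT hR₀ hR hRL hstep⟩, hL.mono fun x => hRL x _ le_rfl⟩

end

/-! ## A calculus of polynomial-time functions -/

section

open Str Data

variable {α β γ : Type} [Data α] [Str β] [Str γ]

theorem Rearranges.polyTime {φ : α → β} (h : Rearranges φ) : PolyTime φ := PolyTime.id.rearrange h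

theorem polyBounded_of_nat {f : α → ℕ} (hf : PolyTime f) : PolyBounded f :=
  hf.polyBounded_length.mono fun x => (length_str_nat (f x)).ge

namespace PolyTime

theorem to_str {f : α → β} (hf : PolyTime f) : PolyTime fun x => str (f x) :=
  hf.of_str_eq fun _ => rfl

theorem of_str {f : α → β} (hf : PolyTime fun x => str (f x)) : PolyTime f :=
  hf.of_str_eq fun _ => rfl

theorem const (b : β) : PolyTime fun _ : α => b := by
  refine of_str ?_
  generalize str b = l
  induction l with
  | nil => exact nil
  | cons c l ih => exact ih.cons c

theorem succ {f : α → ℕ} (hf : PolyTime f) : PolyTime fun x => f x + 1 :=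
  of_str (hf.to_str.cons (Γ'.bit true))

theorem add {f g : α → ℕ} (hf : PolyTime f) (hg : PolyTime g) : PolyTime fun x => f x + g x :=
  (hf.to_str.append hg.to_str).of_str_eq fun x => by simp [str_nat, str_list]

theorem pred {f : α → ℕ} (hf : PolyTime f) : PolyTime fun x => f x - 1 :=
  hf.to_str.tail.of_str_eq fun x => by simp [str_nat, str_list]

theorem length {f : α → List Γ'} (hf : PolyTime f) : PolyTime fun x => (f x).length :=
  recursion (R := fun _ i => i) (h := fun p : (α × ℕ) × ℕ => p.2 + 1) (g := fun _ => 0)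
    Rearranges.id.snd.polyTime.succ (const 0) hf hf.polyBounded_length (fun _ => rfl)
    (fun _ _ => rfl) fun _ i hi => (length_str_nat i).trans_le hi

theorem recursion_nat {g : α → γ} {n : α → ℕ} {h : (α × ℕ) × γ → γ} {R : α → ℕ → γ} {L : α → ℕ}
    (hh : PolyTime h) (hg : PolyTime g) (hn : PolyTime n) (hL : PolyBounded L)
    (hR₀ : ∀ x, R x 0 = g x) (hR : ∀ x i, R x (i + 1) = h ((x, i), R x i))
    (hRL : ∀ x, ∀ i ≤ n x, (str (R x i)).length ≤ L x) : PolyTime fun x => R x (n x) :=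
  (recursion hh hg hn hL hR₀ hR (by simpa only [length_str_nat] using hRL)).congr fun x => by
    rw [length_str_nat]

theorem sub {f g : α → ℕ} (hf : PolyTime f) (hg : PolyTime g) : PolyTime fun x => f x - g x :=
  recursion_nat (R := fun x i => f x - i) (h := fun p : (α × ℕ) × ℕ => p.2 - 1)
    Rearranges.id.snd.polyTime.pred hf hg (polyBounded_of_nat hf) (fun _ => rfl)
    (fun _ _ => Nat.sub_succ _ _) fun _ _ _ => (length_str_nat _).trans_le (Nat.sub_le _ _)

theorem mul {f g : α → ℕ} (hf : PolyTime f) (hg : PolyTime g) : PolyTime fun x => f x * g x :=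
  recursion_nat (R := fun x i => f x * i) (h := fun p : (α × ℕ) × ℕ => p.2 + f p.1.1)
    (Rearranges.id.snd.polyTime.add (hf.rearrange Rearranges.id.fst.fst)) (const 0) hg
    ((polyBounded_of_nat hf).mul (polyBounded_of_nat hg)) (fun _ => rfl)
    (fun _ _ => Nat.mul_succ _ _)
    fun x _ hi => (length_str_nat _).trans_le (Nat.mul_le_mul_left (f x) hi)

theorem drop {f : α → List Γ'} {n : α → ℕ} (hf : PolyTime f) (hn : PolyTime n) :
    PolyTime fun x => (f x).drop (n x) :=
  recursion_nat (R := fun x i => (f x).drop i) (h := fun p : (α × ℕ) × List Γ' => p.2.tail)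
    Rearranges.id.snd.polyTime.tail hf hn hf.polyBounded_length (fun _ => rfl)
    (fun _ _ => List.tail_drop.symm) fun _ _ _ => List.length_drop.trans_le (Nat.sub_le _ _)

theorem ite {p : α → Prop} [∀ x, Decidable (p x)] {f g : α → β} (hp : PolyTime p)
    (hf : PolyTime f) (hg : PolyTime g) : PolyTime fun x => if p x then f x else g x := by
  refine (cases (f := fun c x => c.elim (g x) fun _ => f x) (g := fun x => str (p x))
    (fun c => by cases c; exacts [hg, hf]) hp.to_str).congr fun x => ?_
  by_cases h : p x <;> simp [h, str_prop]

open Classical in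
theorem not {p : α → Prop} (hp : PolyTime p) : PolyTime fun x => ¬p x :=
  (ite hp (const False) (const True)).congr fun x => by by_cases h : p x <;> simp [h]

open Classical in
theorem and {p q : α → Prop} (hp : PolyTime p) (hq : PolyTime q) : PolyTime fun x => p x ∧ q x :=
  (ite hp hq (const False)).congr fun x => by by_cases h : p x <;> simp [h]

open Classical in
theorem or {p q : α → Prop} (hp : PolyTime p) (hq : PolyTime q) : PolyTime fun x => p x ∨ q x :=
  (ite hp (const True) hq).congr fun x => by by_cases h : p x <;> simp [h]

theorem eq_nil {f : α → List Γ'} (hf : PolyTime f) : PolyTime fun x => f x = [] :=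
  (cases (f := fun c _ => c = none) (fun _ => const _) hf).congr fun x => by simp

theorem le {f g : α → ℕ} (hf : PolyTime f) (hg : PolyTime g) : PolyTime fun x => f x ≤ g x :=
  (hf.sub hg).to_str.eq_nil.congr fun x => by simp [str_nat, Nat.sub_eq_zero_iff_le]

theorem lt {f g : α → ℕ} (hf : PolyTime f) (hg : PolyTime g) : PolyTime fun x => f x < g x :=
  hf.succ.le hg

theorem eq {f g : α → ℕ} (hf : PolyTime f) (hg : PolyTime g) : PolyTime fun x => f x = g x :=
  ((hf.le hg).and (hg.le hf)).congr fun _ => propext le_antisymm_iff.symm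

theorem getElem?_eq_some {f : α → List Γ'} {i : α → ℕ} (hf : PolyTime f) (hi : PolyTime i)
    (c : Γ') : PolyTime fun x => (f x)[i x]? = some c :=
  (cases (f := fun a _ => a = some c) (fun _ => const _) (hf.drop hi)).congr fun x => by
    simp only [List.head?_drop]

theorem getElem?_toList {f : α → List Γ'} {i : α → ℕ} (hf : PolyTime f) (hi : PolyTime i) :
    PolyTime fun x => (f x)[i x]?.toList :=
  (cases (f := fun a _ => a.toList) (fun _ => const _) (hf.drop hi)).congr fun x => by
    simp only [List.head?_drop]

theorem flatMap_range {n : α → ℕ} {f : α → ℕ → List Γ'} (hn : PolyTime n)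
    (hf : PolyTime fun p : α × ℕ => f p.1 p.2) :
    PolyTime fun x => (List.range (n x)).flatMap (f x) := by
  have hn' := polyBounded_of_nat hn
  obtain ⟨L, hL, hfL⟩ := hf.polyBounded_length.exists_uniform (PolyBounded.size.add hn')
  refine recursion_nat (R := fun x i => (List.range i).flatMap (f x))
    (h := fun p : (α × ℕ) × List Γ' => p.2 ++ f p.1.1 p.1.2)
    (Rearranges.id.snd.polyTime.append (hf.rearrange Rearranges.id.fst)) nil hn
    (hn'.mul hL) (fun _ => rfl) (fun _ _ => by simp [List.range_succ]) fun x i hi => ?_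
  have hlen : ∀ j ∈ List.range i, (f x j).length ≤ L x := fun j hj => hfL x (x, j)
    (add_le_add_right ((length_str_nat j).trans_le ((List.mem_range.1 hj).le.trans hi)) _)
  calc (str ((List.range i).flatMap (f x))).length
      = ((List.range i).map fun j => (f x j).length).sum := by rw [str_list, List.length_flatMap]
    _ ≤ i * L x := by
      simpa using List.sum_le_card_nsmul ((List.range i).map fun j => (f x j).length) (L x)
        (List.forall_mem_map.2 hlen)
    _ ≤ n x * L x := Nat.mul_le_mul_right _ hi

theorem sum_range {n : α → ℕ} {f : α → ℕ → ℕ} (hn : PolyTime n)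
    (hf : PolyTime fun p : α × ℕ => f p.1 p.2) :
    PolyTime fun x => ∑ i ∈ Finset.range (n x), f x i := by
  refine (flatMap_range (f := fun x i => str (f x i)) hn hf.to_str).of_str_eq fun x => ?_
  simp only [str_list, str_nat]
  induction n x with
  | zero => rfl
  | succ k ih => simp [List.range_succ, Finset.sum_range_succ, ih]

theorem exists_lt {n : α → ℕ} {p : α → ℕ → Prop} (hn : PolyTime n)
    (hp : PolyTime fun q : α × ℕ => p q.1 q.2) : PolyTime fun x => ∃ i < n x, p x i := by
  refine (flatMap_range (f := fun x i => str (p x i)) hn hp.to_str).eq_nil.not.congr fun x => ?_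
  simp [List.flatMap_eq_nil_iff, str_prop]

theorem forall_lt {n : α → ℕ} {p : α → ℕ → Prop} (hn : PolyTime n)
    (hp : PolyTime fun q : α × ℕ => p q.1 q.2) : PolyTime fun x => ∀ i < n x, p x i :=
  (exists_lt (p := fun x i => ¬p x i) hn hp.not).not.congr fun x => by simp

/-- `a / b` is the number of `i < a` with `(i + 1) * b ≤ a`. -/
theorem div {f g : α → ℕ} (hf : PolyTime f) (hg : PolyTime g) : PolyTime fun x => f x / g x := by
  classical
  refine (ite (hg.eq (const 0)) (const 0) (sum_range
    (f := fun x i => if (i + 1) * g x ≤ f x then 1 else 0) hf (ite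
    ((Rearranges.id.snd.polyTime.succ.mul (hg.rearrange Rearranges.id.fst)).le
      (hf.rearrange Rearranges.id.fst)) (const 1) (const 0)))).congr fun x => ?_
  split_ifs with h
  · simp [h]
  · rw [← Finset.card_filter, ← Finset.card_range (f x / g x)]
    congr 1
    ext i
    have := Nat.div_le_self (f x) (g x)
    rw [Finset.mem_filter, Finset.mem_range, Finset.mem_range,
      ← Nat.le_div_iff_mul_le (Nat.pos_of_ne_zero h)]
    lia

theorem mod {f g : α → ℕ} (hf : PolyTime f) (hg : PolyTime g) : PolyTime fun x => f x % g x :=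
  (hf.sub (hg.mul (hf.div hg))).congr fun _ => Nat.mod_eq_sub_mul_div.symm

theorem bit {p : α → Prop} [∀ x, Decidable (p x)] (hp : PolyTime p) :
    PolyTime fun x => [Γ'.bit (decide (p x))] :=
  (ite hp (const [Γ'.bit true]) (const [Γ'.bit false])).congr fun x => by
    by_cases h : p x <;> simp [h]

theorem unary {f : α → ℕ} (hf : PolyTime f) : PolyTime fun x => encodeUnary (f x) :=
  (hf.to_str.append (const [Γ'.comma])).congr fun x => by
    simp [encodeUnary, encodeBits, str_nat]

end PolyTime

theorem PolyTime.polyTimeComputable {A B : Type} [Str A] [Str B] {F : A → B} (hF : PolyTime F) :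
    PolyTimeComputable (str : A → List Γ') (str : B → List Γ') F := by
  obtain ⟨⟨T, ⟨P, hP⟩, hT⟩, -⟩ := hF
  obtain ⟨p, hp⟩ := hT (fun _ => 0) 1 2 (by simp) (by simp) (by simp)
  refine polyTimeComputable_of_run (.seq p (Prog.clear 0)) (P + (4 * Polynomial.X + 1)) fun x => ?_
  have hrun := (hp x (Store.single 0 (str x)) (fun _ => update_self ..) fun j hj =>
    update_of_ne (by lia) _ _).seq (Prog.runsWithin_clear 0 _)
  refine hrun.congr (by simp only [Store.single]; grind [update_apply]) ?_
  have := hP x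
  simp only [Store.single] at *
  simp [size] at *
  lia

theorem PolyTimeComputable.transport {A A' B B' S T : Type} {ea : A → List S} {eb : B → List T}
    {F : A → B} (h : PolyTimeComputable ea eb F) {ea' : A' → List S} {eb' : B' → List T}
    {F' : A' → B'} (i : A' → A) (hi : ∀ x, ea (i x) = ea' x)
    (hF : ∀ x, eb (F (i x)) = eb' (F' x)) : PolyTimeComputable ea' eb' F' := by
  obtain ⟨M⟩ := h
  refine ⟨{ M.toTM2ComputableAux with time := M.time, outputsFun := fun x => ?_ }⟩
  have := M.outputsFun (i x)
  rwa [hi, hF] at this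

end

/-! ## Reading and writing graphs -/

section

open Str

variable {α : Type} [Data α]

open Classical in
/-- The `i`-th of the substrings of `x` that are separated by commas, and the empty string if there
are too few of them. -/
def token (x : List Γ') (i : ℕ) : List Γ' :=
  (List.range x.length).flatMap fun q =>
    if (∑ r ∈ Finset.range q, if x[r]? = some Γ'.comma then 1 else 0) = i ∧
      x[q]? ≠ some Γ'.comma then x[q]?.toList else []

theorem PolyTime.token {f : α → List Γ'} {i : α → ℕ} (hf : PolyTime f) (hi : PolyTime i) :
    PolyTime fun x => token (f x) (i x) := by
  classical
  have hq : PolyTime fun q : α × ℕ => q.2 := Rearranges.id.snd.polyTime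
  have hcomma : PolyTime fun q : (α × ℕ) × ℕ => (f q.1.1)[q.2]? = some Γ'.comma :=
    (hf.rearrange Rearranges.id.fst.fst).getElem?_eq_some Rearranges.id.snd.polyTime _
  have hcount : PolyTime fun q : α × ℕ =>
      ∑ r ∈ Finset.range q.2, if (f q.1)[r]? = some Γ'.comma then 1 else 0 :=
    sum_range hq (hcomma.ite (const 1) (const 0))
  have hf' : PolyTime fun q : α × ℕ => f q.1 := hf.rearrange Rearranges.id.fst
  exact flatMap_range hf.length (ite ((hcount.eq (hi.rearrange Rearranges.id.fst)).and
    (hf'.getElem?_eq_some hq _).not) (hf'.getElem?_toList hq) nil)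

theorem token_cons (c : Γ') (x : List Γ') (i : ℕ) : token (c :: x) i =
    if c = Γ'.comma then (if i = 0 then [] else token x (i - 1))
    else if i = 0 then c :: token x 0 else token x i := by
  unfold token
  rw [List.length_cons, List.range_succ_eq_map, List.flatMap_cons, List.flatMap_map]
  simp only [Finset.sum_range_succ', List.getElem?_cons_succ, List.getElem?_cons_zero]
  by_cases hc : c = Γ'.comma <;> rcases i with _ | i <;> simp [hc]

theorem token_zero {w : List Γ'} (hw : Γ'.comma ∉ w) : token w 0 = w := by
  induction w with
  | nil => rfl
  | cons c w ih =>
    rw [List.mem_cons, not_or] at hw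
    simp [token_cons, Ne.symm hw.1, ih hw.2]

theorem token_append_zero {w : List Γ'} (hw : Γ'.comma ∉ w) (y : List Γ') :
    token (w ++ Γ'.comma :: y) 0 = w := by
  induction w with
  | nil => simp [token_cons]
  | cons c w ih =>
    rw [List.mem_cons, not_or] at hw
    simp [token_cons, Ne.symm hw.1, ih hw.2]

theorem token_append_succ {w : List Γ'} (hw : Γ'.comma ∉ w) (y : List Γ') (i : ℕ) :
    token (w ++ Γ'.comma :: y) (i + 1) = token y i := by
  induction w with
  | nil => simp [token_cons]
  | cons c w ih =>
    rw [List.mem_cons, not_or] at hw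
    simp [token_cons, Ne.symm hw.1, ih hw.2]

theorem token_flatMap {L : List (List Γ')} (hL : ∀ w ∈ L, Γ'.comma ∉ w) (i : ℕ) :
    token (L.flatMap fun w => w ++ [Γ'.comma]) i = L[i]?.getD [] := by
  induction L generalizing i with
  | nil => rfl
  | cons w L ih =>
    simp only [List.flatMap_cons, List.append_assoc, List.cons_append, List.nil_append]
    have hw := hL w List.mem_cons_self
    cases i with
    | zero => simp [token_append_zero hw]
    | succ i =>
      rw [token_append_succ hw, ih fun w h => hL w (List.mem_cons_of_mem _ h),
        List.getElem?_cons_succ]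

theorem getElem?_flatMap_of_length {ι X : Type*} {f : ι → List X} {c : ℕ} (l : List ι)
    (hf : ∀ i, (f i).length = c) {b : ℕ} (hb : b < c) (a : ℕ) :
    (l.flatMap f)[a * c + b]? = l[a]?.bind fun i => (f i)[b]? := by
  induction l generalizing a with
  | nil => simp
  | cons i l ih =>
    rw [List.flatMap_cons]
    cases a with
    | zero =>
      rw [zero_mul, zero_add, List.getElem?_append_left (by rwa [hf])]
      simp
    | succ a =>
      rw [List.getElem?_append_right (by rw [hf, Nat.succ_mul]; lia), hf, Nat.succ_mul,
        show a * c + c + b - c = a * c + b by lia, ih, List.getElem?_cons_succ]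

theorem finRange_flatMap {X : Type*} (n : ℕ) (f : ℕ → List X) :
    (List.finRange n).flatMap (fun i : Fin n => f i) = (List.range n).flatMap f := by
  rw [← List.map_coe_finRange_eq_range, List.flatMap_map]

namespace FinGraph

/-- Adjacency of the vertices with the numbers `u` and `v`, which is false for numbers that are too
large. -/
def adj (G : FinGraph) (u v : ℕ) : Prop :=
  ∃ (hu : u < G.order) (hv : v < G.order), G.graph.Adj ⟨u, hu⟩ ⟨v, hv⟩

theorem adj_coe (G : FinGraph) (u v : Fin G.order) : G.adj u v ↔ G.graph.Adj u v :=
  ⟨fun ⟨_, _, h⟩ => h, fun h => ⟨u.2, v.2, h⟩⟩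

open Classical in
/-- The entries of the adjacency matrix, row by row. -/
def bits (G : FinGraph) : List Bool :=
  (List.finRange G.order).flatMap fun u => (List.finRange G.order).map fun v =>
    decide (G.graph.Adj u v)

theorem encode_eq_bits (G : FinGraph) : G.encode = encodeUnary G.order ++ G.bits.map Γ'.bit := by
  simp only [encode, bits, List.map_flatMap, List.map_map]
  congr 2
  funext u
  induction List.finRange G.order with
  | nil => rfl
  | cons v l ih => simp_all

theorem length_bits (G : FinGraph) : G.bits.length = G.order * G.order := by
  simp [bits, List.length_flatMap]

theorem getElem?_bits (G : FinGraph) {u v : ℕ} (hu : u < G.order) (hv : v < G.order) :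
    G.bits[u * G.order + v]? = some true ↔ G.adj u v := by
  rw [bits, getElem?_flatMap_of_length _ (by simp) hv]
  simp [hu, hv, adj]

theorem encode_eq_adj (G : FinGraph) [∀ u v, Decidable (G.adj u v)] :
    G.encode = encodeUnary G.order ++ (List.range G.order).flatMap fun u =>
      (List.range G.order).flatMap fun v => [Γ'.bit (decide (G.adj u v))] := by
  rw [encode, ← finRange_flatMap]
  refine congrArg _ (List.flatMap_congr fun u _ => ?_)
  rw [← finRange_flatMap]
  refine List.flatMap_congr fun v _ => ?_
  simp [adj_coe]

theorem adj_iff_of_prefix (G : FinGraph) {w : List Γ'} (hw : G.bits.map Γ'.bit <+: w) (u v : ℕ) :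
    G.adj u v ↔ (u < G.order ∧ v < G.order) ∧ w[u * G.order + v]? = some (Γ'.bit true) := by
  obtain ⟨y, rfl⟩ := hw
  suffices u < G.order → v < G.order → (G.adj u v ↔
      (G.bits.map Γ'.bit ++ y)[u * G.order + v]? = some (Γ'.bit true)) from
    ⟨fun h => ⟨⟨h.1, h.2.1⟩, (this h.1 h.2.1).1 h⟩, fun h => (this h.1.1 h.1.2).2 h.2⟩
  intro hu hv
  rw [List.getElem?_append_left (by rw [List.length_map, length_bits]; nlinarith),
    ← G.getElem?_bits hu hv]
  simp

end FinGraph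

instance : Str FinGraph := ⟨FinGraph.encode⟩

theorem PolyTime.finGraph {n : α → ℕ} {A : α → ℕ → ℕ → Prop} {f : α → FinGraph}
    (hn : PolyTime n) (hA : PolyTime fun p : (α × ℕ) × ℕ => A p.1.1 p.1.2 p.2)
    (hfn : ∀ x, (f x).order = n x)
    (hfA : ∀ x u v, u < n x → v < n x → ((f x).adj u v ↔ A x u v)) : PolyTime f := by
  classical
  refine of_str ((hn.unary.append (flatMap_range
    (f := fun x u => (List.range (n x)).flatMap fun v => [Γ'.bit (decide (A x u v))]) hn
    (flatMap_range (hn.rearrange Rearranges.id.fst) hA.bit))).congr fun x => ?_)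
  change _ = (f x).encode
  rw [FinGraph.encode_eq_adj, hfn]
  refine congrArg _ (List.flatMap_congr fun u hu => List.flatMap_congr fun v hv => ?_)
  simp [hfA x u v (List.mem_range.1 hu) (List.mem_range.1 hv)]

theorem PolyTime.adj_of_prefix {G : α → FinGraph} {w : α → List Γ'} {u v : α → ℕ}
    (hG : PolyTime fun x => (G x).order) (hw : PolyTime w)
    (hGw : ∀ x, (G x).bits.map Γ'.bit <+: w x) (hu : PolyTime u) (hv : PolyTime v) :
    PolyTime fun x => (G x).adj (u x) (v x) :=
  (((hu.lt hG).and (hv.lt hG)).and (hw.getElem?_eq_some ((hu.mul hG).add hv) _)).congr fun x =>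
    propext ((G x).adj_iff_of_prefix (hGw x) (u x) (v x)).symm

/-- Pairs of graphs, written one after the other: the instances of graph isomorphism. -/
structure GraphPair where
  fst : FinGraph
  snd : FinGraph

instance : Str GraphPair := ⟨fun p => p.1.encode ++ p.2.encode⟩

namespace GraphPair

theorem str_eq (p : GraphPair) : str p =
    List.replicate p.1.order (Γ'.bit true) ++ Γ'.comma :: ((p.1.bits.map Γ'.bit ++
      List.replicate p.2.order (Γ'.bit true)) ++ Γ'.comma :: p.2.bits.map Γ'.bit) := by
  change p.1.encode ++ p.2.encode = _
  simp [FinGraph.encode_eq_bits, encodeUnary, encodeBits]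

theorem token_str_zero (p : GraphPair) :
    token (str p) 0 = List.replicate p.1.order (Γ'.bit true) := by
  rw [str_eq, token_append_zero (by simp)]

theorem token_str_one (p : GraphPair) : token (str p) 1 =
    p.1.bits.map Γ'.bit ++ List.replicate p.2.order (Γ'.bit true) := by
  rw [str_eq, token_append_succ (by simp), token_append_zero (by simp)]

theorem token_str_two (p : GraphPair) : token (str p) 2 = p.2.bits.map Γ'.bit := by
  rw [str_eq, token_append_succ (by simp), token_append_succ (by simp), token_zero (by simp)]

end GraphPair

namespace PolyTime

theorem graphPair {f g : α → FinGraph} (hf : PolyTime f) (hg : PolyTime g) :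
    PolyTime fun x => GraphPair.mk (f x) (g x) :=
  (hf.to_str.append hg.to_str).of_str_eq fun _ => rfl

variable {f : α → GraphPair}

theorem order_fst (hf : PolyTime f) : PolyTime fun x => (f x).1.order :=
  (hf.to_str.token (const 0)).length.congr fun x => by simp [GraphPair.token_str_zero]

theorem order_snd (hf : PolyTime f) : PolyTime fun x => (f x).2.order :=
  ((hf.to_str.token (const 1)).length.sub (hf.order_fst.mul hf.order_fst)).congr fun x => by
    simp [GraphPair.token_str_one, FinGraph.length_bits]

variable {u v : α → ℕ}

theorem adj_fst (hf : PolyTime f) (hu : PolyTime u) (hv : PolyTime v) :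
    PolyTime fun x => (f x).1.adj (u x) (v x) :=
  adj_of_prefix hf.order_fst (hf.to_str.token (const 1))
    (fun x => by rw [GraphPair.token_str_one]; exact List.prefix_append _ _) hu hv

theorem adj_snd (hf : PolyTime f) (hu : PolyTime u) (hv : PolyTime v) :
    PolyTime fun x => (f x).2.adj (u x) (v x) :=
  adj_of_prefix hf.order_snd (hf.to_str.token (const 2))
    (fun x => by rw [GraphPair.token_str_two]) hu hv

end PolyTime

end

section

open Str Data

instance : Str Game := ⟨Game.encode⟩

instance : Str ℚ := ⟨encodeRat⟩

/-! ## Symmetries of games -/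

namespace Game

variable {Γ : Game} {φ : Equiv.Perm Γ.Action} {π π' : Equiv.Perm Γ.Player}

theorem mapProfile_eq_iff (h : Γ.MapsPlayers φ π) (s t : Γ.Profile) :
    Γ.mapProfile h s = t ↔ ∀ k, φ ⟨k, s k⟩ = ⟨π k, t (π k)⟩ := by
  constructor
  · rintro rfl k
    rw [Γ.mapProfile_spec h s (π k), π.symm_apply_apply]
  · intro hk
    funext j
    have hj := Γ.mapProfile_spec h s j
    rw [hk, π.apply_symm_apply] at hj
    exact eq_of_heq (Sigma.mk.inj hj).2

theorem apply_eq_mapProfile (h : Γ.MapsPlayers φ π) (s : Γ.Profile) (k : Γ.Player) :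
    φ ⟨k, s k⟩ = ⟨π k, Γ.mapProfile h s (π k)⟩ :=
  (mapProfile_eq_iff h s _).1 rfl k

theorem mapProfile_apply_eq_iff (h : Γ.MapsPlayers φ π) {s t : Γ.Profile} {k : Γ.Player} :
    Γ.mapProfile h s (π k) = Γ.mapProfile h t (π k) ↔ s k = t k := by
  have hmk : ∀ i (a b : Fin (Γ.numActions i)), (⟨i, a⟩ : Γ.Action) = ⟨i, b⟩ ↔ a = b := by simp
  rw [← hmk, ← apply_eq_mapProfile, ← apply_eq_mapProfile, φ.injective.eq_iff, hmk]

theorem mapProfile_injective (h : Γ.MapsPlayers φ π) : Injective (Γ.mapProfile h) :=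
  fun _ _ hst => funext fun k => (mapProfile_apply_eq_iff h).1 (congrFun hst (π k))

theorem induced_one (Γ : Game) : Γ.Induced 1 := ⟨1, fun _ => rfl, fun _ _ => rfl⟩

theorem Induced.mul (h : Γ.Induced π) (h' : Γ.Induced π') : Γ.Induced (π * π') := by
  obtain ⟨φ, hm, hu⟩ := h
  obtain ⟨φ', hm', hu'⟩ := h'
  have hmm : Γ.MapsPlayers (φ * φ') (π * π') := fun a => by
    rw [Equiv.Perm.mul_apply, hm, hm', Equiv.Perm.mul_apply]
  refine ⟨φ * φ', hmm, fun i s => ?_⟩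
  rw [hu' i s, hu]
  refine congrArg _ (Eq.symm ((mapProfile_eq_iff hmm s _).2 fun k => ?_))
  rw [Equiv.Perm.mul_apply, apply_eq_mapProfile hm', apply_eq_mapProfile hm, Equiv.Perm.mul_apply]

theorem allPlayerPermsInduced_iff_swap :
    Γ.AllPlayerPermsInduced ↔ ∀ i j, Γ.Induced (Equiv.swap i j) := by
  refine ⟨fun h i j => h _, fun h π => ?_⟩
  induction π using Equiv.Perm.swap_induction_on with
  | one => exact Γ.induced_one
  | swap_mul f x y _ ih => exact (h x y).mul ih

theorem mem_transpositions (i j : Γ.Player) : (i, j) ∈ Γ.transpositions ↔ i < j := by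
  simp [transpositions]

theorem allPlayerPermsInduced_iff_transpositions :
    Γ.AllPlayerPermsInduced ↔ ∀ p ∈ Γ.transpositions, Γ.Induced (Equiv.swap p.1 p.2) := by
  rw [allPlayerPermsInduced_iff_swap]
  constructor
  · exact fun h p _ => h _ _
  · intro h i j
    rcases lt_trichotomy i j with hij | rfl | hij
    · exact h (i, j) ((mem_transpositions i j).2 hij)
    · rw [Equiv.swap_self]
      exact Γ.induced_one
    · rw [Equiv.swap_comm]
      exact h (j, i) ((mem_transpositions j i).2 hij)

end Game

/-! ## Bimatrix games -/

/-- The two-player game in which both players have the actions `0, …, n - 1`, and player `i`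
receives `M i a b` if the players choose `a` and `b`. The matrices are indexed by natural numbers so
that they can be computed entry by entry. -/
abbrev bimatrixGame {n : ℕ} (hn : 0 < n) (M : Fin 2 → ℕ → ℕ → ℚ) : Game where
  numPlayers := 2
  numActions _ := n
  numActions_pos _ := hn
  payoff i s := M i (s 0) (s 1)

theorem encode_bimatrixGame {n : ℕ} (hn : 0 < n) (M : Fin 2 → ℕ → ℕ → ℚ) :
    (bimatrixGame hn M).encode = encodeUnary 2 ++ (encodeUnary n ++ encodeUnary n) ++
      (List.range n).flatMap fun a => (List.range n).flatMap fun b =>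
        encodeRat (M 0 a b) ++ encodeRat (M 1 a b) := by
  simp only [Game.encode, Game.allProfiles, List.finRange_succ, List.finRange_zero, List.map_nil,
    List.flatMap_cons, List.flatMap_nil, List.append_nil, List.map_cons, List.flatMap_assoc,
    List.flatMap_map, Fin.cons_zero, Fin.cons_one, ← finRange_flatMap]
  rfl

theorem PolyTime.bimatrixGame {α : Type} [Data α] {n : α → ℕ} {M : α → Fin 2 → ℕ → ℕ → ℚ}
    (hn : PolyTime n) (hM : ∀ i, PolyTime fun p : (α × ℕ) × ℕ => M p.1.1 i p.1.2 p.2)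
    (hpos : ∀ x, 0 < n x) : PolyTime fun x => bimatrixGame (hpos x) (M x) :=
  of_str (((const (encodeUnary 2)).append (hn.unary.append hn.unary)).append
    (flatMap_range (f := fun x a => (List.range (n x)).flatMap fun b =>
      encodeRat (M x 0 a b) ++ encodeRat (M x 1 a b)) hn (flatMap_range
        (hn.rearrange Rearranges.id.fst) ((hM 0).to_str.append (hM 1).to_str))) |>.congr
    fun x => (encode_bimatrixGame (hpos x) (M x)).symm)

section

variable {n : ℕ} {hn : 0 < n} {M : Fin 2 → ℕ → ℕ → ℚ}

theorem exists_perms_of_induced_swap (h : (bimatrixGame hn M).Induced (Equiv.swap (0 : Fin 2) 1)) :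
    ∃ ρ κ : Equiv.Perm (Fin n),
      ∀ a b : Fin n, M 0 a b = M 1 (κ b) (ρ a) ∧ M 1 a b = M 0 (κ b) (ρ a) := by
  obtain ⟨φ, h, hu⟩ := h
  have hinj : ∀ j : Fin 2, Injective fun a : Fin n =>
      (bimatrixGame hn M).mapProfile h (fun _ => a) (Equiv.swap (0 : Fin 2) 1 j) :=
    fun j a b hab => (Game.mapProfile_apply_eq_iff h (k := j)).1 hab
  refine ⟨.ofBijective _ (Finite.injective_iff_bijective.1 (hinj 0)),
    .ofBijective _ (Finite.injective_iff_bijective.1 (hinj 1)), fun a b => ?_⟩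
  let s : (bimatrixGame hn M).Profile := fun i : Fin 2 => if i = 0 then a else b
  have hs : (bimatrixGame hn M).mapProfile h s =
      fun j : Fin 2 => (bimatrixGame hn M).mapProfile h (fun _ => if j = 1 then a else b) j := by
    funext j
    change Fin 2 at j
    fin_cases j
    · exact (Game.mapProfile_apply_eq_iff h (k := (1 : Fin 2))).2 rfl
    · exact (Game.mapProfile_apply_eq_iff h (k := (0 : Fin 2))).2 rfl
  have hpayoff : ∀ i : Fin 2, M i a b = M (Equiv.swap (0 : Fin 2) 1 i)
    ((bimatrixGame hn M).mapProfile h s (0 : Fin 2))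
    ((bimatrixGame hn M).mapProfile h s (1 : Fin 2)) := fun i => hu i s
  rw [hs] at hpayoff
  exact ⟨hpayoff 0, hpayoff 1⟩

theorem induced_swap_of_perms (ρ κ : Equiv.Perm (Fin n))
    (h : ∀ a b : Fin n, M 0 a b = M 1 (κ b) (ρ a) ∧ M 1 a b = M 0 (κ b) (ρ a)) :
    (bimatrixGame hn M).Induced (Equiv.swap (0 : Fin 2) 1) := by
  let φ : Equiv.Perm (bimatrixGame hn M).Action :=
    Equiv.sigmaCongr (β₂ := fun _ : Fin 2 => Fin n) (Equiv.swap (0 : Fin 2) 1) ![ρ, κ]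
  refine ⟨φ, fun _ => rfl, fun i s => ?_⟩
  change Fin 2 at i
  fin_cases i
  · exact (h (s (0 : Fin 2)) (s (1 : Fin 2))).1
  · exact (h (s (0 : Fin 2)) (s (1 : Fin 2))).2

end

/-! ## Reduction of graph isomorphism to zero-sum games -/

namespace GraphPair

open Classical in
/-- One of the multiples `s`, `2 * s` and `3 * s` of `s`: a payoff that records the truth values of
two mutually exclusive propositions. -/
def select (s : ℚ) (P Q : Prop) : ℚ := if P then s else if Q then 2 * s else 3 * s

theorem select_neg (s : ℚ) (P Q : Prop) : select (-s) P Q = -select s P Q := by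
  unfold select
  split_ifs <;> ring

theorem select_one_eq_two {P Q : Prop} : select 1 P Q = 2 ↔ ¬P ∧ Q := by
  unfold select
  split_ifs with h h' <;> simp [*]

theorem select_one_eq_one {P Q : Prop} : select 1 P Q = 1 ↔ P := by
  unfold select
  split_ifs with h h' <;> simp [*]

theorem select_one_pos {P Q : Prop} : 0 < select 1 P Q := by
  unfold select
  split_ifs <;> norm_num

open Classical in
/-- The block diagonal matrix whose first block records adjacency and equality of the vertices of
the first graph, whose second block does so for the second graph with the opposite sign, and whose
last row and column are zero. -/
def matrix (s : ℚ) (p : GraphPair) (a b : ℕ) : ℚ :=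
  if a < p.1.order ∧ b < p.1.order then select s (p.1.adj a b) (a = b)
  else if (p.1.order ≤ a ∧ a - p.1.order < p.2.order) ∧
    (p.1.order ≤ b ∧ b - p.1.order < p.2.order) then
    select (-s) (p.2.adj (a - p.1.order) (b - p.1.order)) (a - p.1.order = b - p.1.order)
  else 0

/-- The number of actions of each player of the game of two graphs: the additional action makes it
positive even if both graphs are empty. -/
def numActions (p : GraphPair) : ℕ := p.1.order + p.2.order + 1

theorem numActions_pos (p : GraphPair) : 0 < p.numActions := Nat.succ_pos _

/-- The zero-sum game in which the swap of the players is induced by a symmetry if and only if the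
two graphs are isomorphic. -/
abbrev game (p : GraphPair) : Game :=
  bimatrixGame p.numActions_pos fun i => matrix (if i = 0 then 1 else -1) p

theorem matrix_neg (s : ℚ) (p : GraphPair) (a b : ℕ) : matrix (-s) p a b = -matrix s p a b := by
  unfold matrix
  split_ifs <;> simp [select_neg]

theorem isTwoPlayerZeroSum_game (p : GraphPair) : p.game.IsTwoPlayerZeroSum := by
  refine ⟨rfl, fun s => ?_⟩
  change ∑ i : Fin 2, matrix (if i = 0 then 1 else -1) p (s 0) (s 1) = 0
  simp [Fin.sum_univ_two, matrix_neg]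

theorem polyTime_select {α : Type} [Data α] (s : ℚ) {P Q : α → Prop} (hP : PolyTime P)
    (hQ : PolyTime Q) : PolyTime fun x => select s (P x) (Q x) := by
  classical
  exact hP.ite (.const s) (hQ.ite (.const (2 * s)) (.const (3 * s)))

theorem polyTime_matrix (s : ℚ) :
    PolyTime fun q : (GraphPair × ℕ) × ℕ => matrix s q.1.1 q.1.2 q.2 := by
  classical
  have hp : PolyTime fun q : (GraphPair × ℕ) × ℕ => q.1.1 := Rearranges.id.fst.fst.polyTime
  have ha : PolyTime fun q : (GraphPair × ℕ) × ℕ => q.1.2 := Rearranges.id.fst.snd.polyTime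
  have hb : PolyTime fun q : (GraphPair × ℕ) × ℕ => q.2 := Rearranges.id.snd.polyTime
  have hn := hp.order_fst
  have ha' := ha.sub hn
  have hb' := hb.sub hn
  exact .ite ((ha.lt hn).and (hb.lt hn)) (polyTime_select s (hp.adj_fst ha hb) (ha.eq hb))
    (.ite (((hn.le ha).and (ha'.lt hp.order_snd)).and ((hn.le hb).and (hb'.lt hp.order_snd)))
      (polyTime_select _ (hp.adj_snd ha' hb') (ha'.eq hb')) (.const 0))

theorem polyTime_game : PolyTime game :=
  .bimatrixGame (PolyTime.id.order_fst.add PolyTime.id.order_snd).succ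
    (fun _ => polyTime_matrix _) numActions_pos

/-- The actions of either player: the vertices of both graphs and an additional action. -/
def actionEquiv (p : GraphPair) :
    Fin p.numActions ≃ Option (Fin p.1.order ⊕ Fin p.2.order) :=
  finSuccEquivLast.trans (Equiv.optionCongr finSumFinEquiv.symm)

theorem actionEquiv_symm_none (p : GraphPair) :
    (p.actionEquiv.symm none : ℕ) = p.1.order + p.2.order := rfl

theorem actionEquiv_symm_inl (p : GraphPair) (u : Fin p.1.order) :
    (p.actionEquiv.symm (some (Sum.inl u)) : ℕ) = u := by
  change ((finSuccEquivLast.symm (some (finSumFinEquiv (Sum.inl u))) :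
    Fin (p.1.order + p.2.order + 1)) : ℕ) = u
  simp

theorem actionEquiv_symm_inr (p : GraphPair) (u : Fin p.2.order) :
    (p.actionEquiv.symm (some (Sum.inr u)) : ℕ) = p.1.order + u := by
  change ((finSuccEquivLast.symm (some (finSumFinEquiv (Sum.inr u))) :
    Fin (p.1.order + p.2.order + 1)) : ℕ) = p.1.order + u
  simp

/-- The payoff matrix of the first player, indexed by vertices. -/
def vertexMatrix (p : GraphPair) : Option (Fin p.1.order ⊕ Fin p.2.order) →
    Option (Fin p.1.order ⊕ Fin p.2.order) → ℚ
  | some (Sum.inl u), some (Sum.inl v) => select 1 (p.1.graph.Adj u v) (u = v)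
  | some (Sum.inr u), some (Sum.inr v) => -select 1 (p.2.graph.Adj u v) (u = v)
  | _, _ => 0

variable {p : GraphPair}

theorem matrix_actionEquiv_symm (x y : Option (Fin p.1.order ⊕ Fin p.2.order)) :
    matrix 1 p (p.actionEquiv.symm x) (p.actionEquiv.symm y) = p.vertexMatrix x y := by
  rcases x with _ | u | u <;> rcases y with _ | v | v <;>
    simp [actionEquiv_symm_none, actionEquiv_symm_inl, actionEquiv_symm_inr, matrix, vertexMatrix,
      select_neg, FinGraph.adj_coe, Fin.ext_iff]

theorem vertexMatrix_eq_two {x y} (h : p.vertexMatrix x y = 2) :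
    ∃ u, x = some (Sum.inl u) ∧ y = some (Sum.inl u) := by
  rcases x with _ | u | u <;> rcases y with _ | v | v <;> simp only [vertexMatrix] at h
  all_goals first | norm_num at h; done | skip
  · rw [select_one_eq_two] at h
    exact ⟨u, rfl, by rw [h.2]⟩
  · linarith [select_one_pos (P := p.2.graph.Adj u v) (Q := u = v)]

theorem vertexMatrix_eq_neg_two {x y} (h : p.vertexMatrix x y = -2) :
    ∃ u, x = some (Sum.inr u) ∧ y = some (Sum.inr u) := by
  rcases x with _ | u | u <;> rcases y with _ | v | v <;> simp only [vertexMatrix] at h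
  all_goals first | norm_num at h; done | skip
  · linarith [select_one_pos (P := p.1.graph.Adj u v) (Q := u = v)]
  · rw [neg_inj, select_one_eq_two] at h
    exact ⟨u, rfl, by rw [h.2]⟩

section

variable {ρ κ : Option (Fin p.1.order ⊕ Fin p.2.order) → Option (Fin p.1.order ⊕ Fin p.2.order)}

-- The entries `2` and `-2` occur exactly at the diagonals of the two blocks.
theorem exists_eq_inr_of_vertexMatrix
    (h : ∀ x y, p.vertexMatrix x y = -p.vertexMatrix (κ y) (ρ x)) (u : Fin p.1.order) :
    ∃ v, κ (some (Sum.inl u)) = some (Sum.inr v) ∧ ρ (some (Sum.inl u)) = some (Sum.inr v) := by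
  refine vertexMatrix_eq_neg_two ?_
  rw [eq_comm, ← neg_eq_iff_eq_neg.trans eq_comm, ← h]
  simp [vertexMatrix, select_one_eq_two]

theorem exists_eq_inl_of_vertexMatrix
    (h : ∀ x y, p.vertexMatrix x y = -p.vertexMatrix (κ y) (ρ x)) (u : Fin p.2.order) :
    ∃ v, κ (some (Sum.inr u)) = some (Sum.inl v) ∧ ρ (some (Sum.inr u)) = some (Sum.inl v) := by
  refine vertexMatrix_eq_two ?_
  rw [← neg_inj, ← h]
  simp [vertexMatrix, select_one_eq_two]

theorem nonempty_iso_of_vertexMatrix (hρ : Injective ρ)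
    (h : ∀ x y, p.vertexMatrix x y = -p.vertexMatrix (κ y) (ρ x)) :
    Nonempty (p.1.graph ≃g p.2.graph) := by
  choose f hfκ hfρ using exists_eq_inr_of_vertexMatrix h
  choose g _ hgρ using exists_eq_inl_of_vertexMatrix h
  have hf : Injective f := fun u v huv => by
    have := hρ ((hfρ u).trans ((congrArg (fun z => some (Sum.inr z)) huv).trans (hfρ v).symm))
    simpa using this
  have hg : Injective g := fun u v huv => by
    have := hρ ((hgρ u).trans ((congrArg (fun z => some (Sum.inl z)) huv).trans (hgρ v).symm))
    simpa using this
  have hb : Bijective f := by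
    rw [Fintype.bijective_iff_injective_and_card]
    exact ⟨hf, le_antisymm (Fintype.card_le_of_injective f hf) (Fintype.card_le_of_injective g hg)⟩
  refine ⟨⟨Equiv.ofBijective f hb, fun {u v} => ?_⟩⟩
  have hentry := h (some (Sum.inl u)) (some (Sum.inl v))
  rw [hfκ, hfρ] at hentry
  simp only [vertexMatrix, neg_neg] at hentry
  rw [Equiv.ofBijective_apply, Equiv.ofBijective_apply, SimpleGraph.adj_comm,
    ← select_one_eq_one (P := p.2.graph.Adj (f v) (f u)) (Q := f v = f u), ← hentry,
    select_one_eq_one]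

end

theorem exists_perm_vertexMatrix (e : p.1.graph ≃g p.2.graph) :
    ∃ σ : Equiv.Perm (Option (Fin p.1.order ⊕ Fin p.2.order)),
      ∀ x y, p.vertexMatrix x y = -p.vertexMatrix (σ y) (σ x) := by
  refine ⟨Equiv.optionCongr ((Equiv.sumCongr e.toEquiv e.toEquiv.symm).trans (Equiv.sumComm _ _)),
    fun x y => ?_⟩
  have hadj : ∀ u v, p.2.graph.Adj (e v) (e u) ↔ p.1.graph.Adj u v := fun u v => by
    rw [e.map_adj_iff, p.1.graph.adj_comm]
  have hadj' : ∀ u v, p.1.graph.Adj (e.symm v) (e.symm u) ↔ p.2.graph.Adj u v := fun u v => by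
    rw [e.symm.map_adj_iff, p.2.graph.adj_comm]
  have he : ∀ u v, e v = e u ↔ u = v := fun u v => by rw [e.injective.eq_iff, eq_comm]
  have he' : ∀ u v, e.toEquiv.symm v = e.toEquiv.symm u ↔ u = v := fun u v => by
    rw [e.toEquiv.symm.injective.eq_iff, eq_comm]
  rcases x with _ | u | u <;> rcases y with _ | v | v <;> simp only [vertexMatrix,
    Equiv.optionCongr_apply, Option.map_none, Option.map_some, Equiv.trans_apply,
    Equiv.sumCongr_apply, Sum.map_inl, Sum.map_inr, Equiv.sumComm_apply, Sum.swap_inl,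
    Sum.swap_inr, neg_zero]
  · simp only [RelIso.coe_fn_toEquiv, hadj, he, neg_neg]
  · rw [he', ← hadj' u v]
    rfl

variable (p)

theorem induced_swap_iff :
    p.game.Induced (Equiv.swap (0 : Fin 2) 1) ↔ Nonempty (p.1.graph ≃g p.2.graph) := by
  constructor
  · intro h
    obtain ⟨ρ, κ, h⟩ := exists_perms_of_induced_swap h
    refine nonempty_iso_of_vertexMatrix (ρ := p.actionEquiv.permCongr ρ)
      (κ := p.actionEquiv.permCongr κ) (Equiv.injective _) fun x y => ?_
    have := (h (p.actionEquiv.symm x) (p.actionEquiv.symm y)).1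
    simpa [matrix_neg, ← matrix_actionEquiv_symm, Equiv.permCongr_apply] using this
  · rintro ⟨e⟩
    obtain ⟨σ, hσ⟩ := exists_perm_vertexMatrix e
    let τ : Equiv.Perm (Fin p.numActions) := p.actionEquiv.symm.permCongr σ
    have hτ : ∀ a b : Fin p.numActions, matrix 1 p a b = -matrix 1 p (τ b) (τ a) := fun a b => by
      simpa [τ, ← matrix_actionEquiv_symm, Equiv.permCongr_apply] using
        hσ (p.actionEquiv a) (p.actionEquiv b)
    exact induced_swap_of_perms τ τ fun a b => by simp [matrix_neg, hτ a b]

end GraphPair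

theorem GraphPair.allPlayerPermsInduced_iff (p : GraphPair) :
    p.game.AllPlayerPermsInduced ↔ Nonempty (p.1.graph ≃g p.2.graph) := by
  rw [← p.induced_swap_iff]
  refine ⟨fun h => h _, fun h π => ?_⟩
  have hπ : ∀ π : Equiv.Perm (Fin 2), π = 1 ∨ π = Equiv.swap 0 1 := by decide
  rcases hπ π with rfl | rfl
  · exact p.game.induced_one
  · exact h

theorem graphIsomorphism_reduces : PolyTimeReduces graphIsomorphism allPlayerPermsInduced :=
  ⟨fun p => GraphPair.game ⟨p.1, p.2⟩, GraphPair.polyTime_game.polyTimeComputable.transport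
    (fun p => ⟨p.1, p.2⟩) (fun _ => rfl) (fun _ => rfl),
    fun p => (GraphPair.allPlayerPermsInduced_iff ⟨p.1, p.2⟩).symm⟩

theorem graphIsomorphism_reduces_zeroSum :
    PolyTimeReduces graphIsomorphism allPlayerPermsInducedTwoPlayerZeroSum :=
  ⟨fun p => ⟨GraphPair.game ⟨p.1, p.2⟩, GraphPair.isTwoPlayerZeroSum_game _⟩,
    GraphPair.polyTime_game.polyTimeComputable.transport
      (fun p => ⟨p.1, p.2⟩) (fun _ => rfl) (fun _ => rfl),
    fun p => (GraphPair.allPlayerPermsInduced_iff ⟨p.1, p.2⟩).symm⟩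

end

/-! ## The graph of a game -/

section

section

variable {V W : Type*} {G : SimpleGraph W} (ι : W ↪ V)

theorem exists_apply_eq_of_adj (e : G.map ι ≃g G.map ι) {x x' y : W} (hx : e (ι x) = ι x')
    (hxy : G.Adj x y) : ∃ y', e (ι y) = ι y' ∧ G.Adj x' y' := by
  have hadj : (G.map ι).Adj (e (ι x)) (e (ι y)) :=
    e.map_adj_iff.2 (SimpleGraph.map_adj_apply.2 hxy)
  rw [hx] at hadj
  obtain ⟨x'', y', h, hx', hy'⟩ := (SimpleGraph.map_adj _ _ _ _).1 hadj
  exact ⟨y', hy'.symm, ι.injective hx' ▸ h⟩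

theorem map_adj_iff_of_apply_eq {σ : Equiv.Perm W} (hσ : ∀ x y, G.Adj (σ x) (σ y) ↔ G.Adj x y)
    {e : Equiv.Perm V} (he : ∀ x, e (ι x) = ι (σ x)) (u v : V) :
    (G.map ι).Adj (e u) (e v) ↔ (G.map ι).Adj u v := by
  have hrange : ∀ {v y}, ι y = e v → ∃ x, ι x = v ∧ σ x = y := fun {v y} hv => by
    obtain ⟨x, rfl⟩ := σ.surjective y
    exact ⟨x, e.injective ((he x).trans hv), rfl⟩
  rw [SimpleGraph.map_adj, SimpleGraph.map_adj]
  constructor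
  · rintro ⟨x, y, hxy, hx, hy⟩
    obtain ⟨x, rfl, rfl⟩ := hrange hx
    obtain ⟨y, rfl, rfl⟩ := hrange hy
    exact ⟨x, y, (hσ x y).1 hxy, rfl, rfl⟩
  · rintro ⟨x, y, hxy, rfl, rfl⟩
    exact ⟨σ x, σ y, (hσ x y).2 hxy, (he x).symm, (he y).symm⟩

end

namespace Game

variable (Γ : Game)

/-- The vertices of the graph of a game: players, actions, profiles, and cells. The cell
`(k, s, l)` represents player `k` together with the payoff of player `l` at the profile `s`. -/
inductive Node
  | player (k : Γ.Player)
  | action (x : Γ.Action)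
  | profile (s : Γ.Profile)
  | cell (k : Γ.Player) (s : Γ.Profile) (l : Γ.Player)

variable {Γ}

/-- The edges of the graph of a game: actions belong to players, profiles consist of actions, and
profiles have payoffs. -/
def Link : Γ.Node → Γ.Node → Prop
  | .player k, .action x => x.1 = k
  | .action x, .profile s => s x.1 = x.2
  | .profile s, .cell k s' l => Γ.payoff k s = Γ.payoff l s'
  | _, _ => False

variable (Γ) in
/-- The graph of a game. A player permutation is induced by a symmetry if and only if its action on
players and cells extends to an automorphism of this graph. -/
def nodeGraph : SimpleGraph Γ.Node where
  Adj x y := Link x y ∨ Link y x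
  symm := ⟨fun _ _ h => h.symm⟩
  loopless := ⟨fun x h => by cases x <;> simp [Link] at h⟩

theorem nodeGraph_adj {x y : Γ.Node} : Γ.nodeGraph.Adj x y ↔ Link x y ∨ Link y x := Iff.rfl

/-- The permutation of the vertices of the graph of a game that is given by permutations of the
players, of the actions and of the profiles. The second and third component of a cell are fixed,
since they only stand for a payoff. -/
def nodePerm (π : Equiv.Perm Γ.Player) (φ : Equiv.Perm Γ.Action) (Φ : Equiv.Perm Γ.Profile) :
    Equiv.Perm Γ.Node where
  toFun
    | .player k => .player (π k)
    | .action x => .action (φ x)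
    | .profile s => .profile (Φ s)
    | .cell k s l => .cell (π k) s l
  invFun
    | .player k => .player (π.symm k)
    | .action x => .action (φ.symm x)
    | .profile s => .profile (Φ.symm s)
    | .cell k s l => .cell (π.symm k) s l
  left_inv x := by cases x <;> simp
  right_inv x := by cases x <;> simp

/-- The vertices on which a player permutation acts in a prescribed way: players and cells. -/
def Node.IsPin : Γ.Node → Prop
  | .player _ => True
  | .cell _ _ _ => True
  | _ => False

variable {φ : Equiv.Perm Γ.Action} {π : Equiv.Perm Γ.Player}

theorem mapProfile_apply_fst_eq_iff (h : Γ.MapsPlayers φ π) (s : Γ.Profile) (x : Γ.Action) :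
    Γ.mapProfile h s (φ x).1 = (φ x).2 ↔ s x.1 = x.2 := by
  have hs : ∀ (t : Γ.Profile) (y : Γ.Action), t y.1 = y.2 ↔ ⟨y.1, t y.1⟩ = y := fun t y => by
    simp [Sigma.ext_iff]
  rw [hs, hs s, ← φ.injective.eq_iff (a := ⟨x.1, s x.1⟩), apply_eq_mapProfile h, h]

theorem nodeGraph_adj_nodePerm (h : Γ.MapsPlayers φ π)
    (hu : ∀ i s, Γ.payoff i s = Γ.payoff (π i) (Γ.mapProfile h s)) {Φ : Equiv.Perm Γ.Profile}
    (hΦ : ∀ s, Φ s = Γ.mapProfile h s) (x y : Γ.Node) :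
    Γ.nodeGraph.Adj (nodePerm π φ Φ x) (nodePerm π φ Φ y) ↔ Γ.nodeGraph.Adj x y := by
  have hlink : ∀ x y : Γ.Node, Link (nodePerm π φ Φ x) (nodePerm π φ Φ y) ↔ Link x y := by
    intro x y
    cases x <;> cases y <;> simp only [nodePerm, Equiv.coe_fn_mk, Link]
    · rw [h, π.injective.eq_iff]
    · rw [hΦ, mapProfile_apply_fst_eq_iff]
    · rw [hΦ, ← hu]
  exact or_congr (hlink x y) (hlink y x)

variable {V : Type*} (ι : Γ.Node ↪ V)

section

variable (e : Γ.nodeGraph.map ι ≃g Γ.nodeGraph.map ι)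
  (he : ∀ x : Γ.Node, x.IsPin → e (ι x) = ι (nodePerm π 1 1 x))
include he

theorem exists_apply_action_eq (x : Γ.Action) :
    ∃ x' : Γ.Action, e (ι (.action x)) = ι (.action x') ∧ x'.1 = π x.1 := by
  obtain ⟨y, hy, h⟩ := exists_apply_eq_of_adj ι e (he (.player x.1) trivial)
    (y := .action x) (Or.inl rfl)
  cases y <;> simp only [nodePerm, Equiv.coe_fn_mk, nodeGraph_adj, Link, or_false, or_self] at h
  exact ⟨_, hy, h⟩

theorem exists_apply_profile_eq_payoff (s : Γ.Profile) (k : Γ.Player) :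
    ∃ s' : Γ.Profile, e (ι (.profile s)) = ι (.profile s') ∧
      Γ.payoff k s = Γ.payoff (π k) s' := by
  obtain ⟨y, hy, h⟩ := exists_apply_eq_of_adj ι e (he (.cell k s k) trivial)
    (y := .profile s) (Or.inr rfl)
  cases y <;> simp only [nodePerm, Equiv.coe_fn_mk, nodeGraph_adj, Link, false_or, or_self] at h
  exact ⟨_, hy, h.symm⟩

theorem exists_apply_profile_eq [Nonempty Γ.Player] (s : Γ.Profile) :
    ∃ s' : Γ.Profile, e (ι (.profile s)) = ι (.profile s') ∧
      ∀ k, Γ.payoff k s = Γ.payoff (π k) s' := by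
  obtain ⟨s', hs', -⟩ := exists_apply_profile_eq_payoff ι e he s (Classical.arbitrary _)
  refine ⟨s', hs', fun k => ?_⟩
  obtain ⟨t, ht, h⟩ := exists_apply_profile_eq_payoff ι e he s k
  have hts := ι.injective (ht.symm.trans hs')
  simp only [Node.profile.injEq] at hts
  rw [h, hts]

theorem induced_of_iso : Γ.Induced π := by
  rcases isEmpty_or_nonempty Γ.Player with _ | _
  · exact ⟨1, fun a => isEmptyElim a.1, fun i => isEmptyElim i⟩
  choose φ hφ hφπ using exists_apply_action_eq ι e he
  choose Φ hΦ hΦu using exists_apply_profile_eq ι e he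
  have hinj : Injective φ := fun x y hxy => by
    have hexy : e (ι (.action x)) = e (ι (.action y)) := by rw [hφ, hφ, hxy]
    simpa using ι.injective (e.injective hexy)
  let φ' : Equiv.Perm Γ.Action := .ofBijective φ (Finite.injective_iff_bijective.1 hinj)
  have hm : Γ.MapsPlayers φ' π := hφπ
  refine ⟨φ', hm, fun i s => ?_⟩
  rw [hΦu s i, (mapProfile_eq_iff hm s (Φ s)).2 fun k => ?_]
  have hk : (Γ.nodeGraph.map ι).Adj (e (ι (.action ⟨k, s k⟩))) (e (ι (.profile s))) :=
    e.map_adj_iff.2 (SimpleGraph.map_adj_apply.2 (Or.inl rfl))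
  rw [hφ, hΦ, SimpleGraph.map_adj_apply, nodeGraph_adj] at hk
  simp only [Link, or_false] at hk
  have hπ : (φ ⟨k, s k⟩).1 = π k := hφπ _
  refine Sigma.ext hπ ?_
  change (φ ⟨k, s k⟩).2 ≍ Φ s (π k)
  rw [← hk, hπ]

end

variable {pinned : V → Prop} {pin : Equiv.Perm V}

theorem exists_iso_of_induced (hpinned : ∀ x : Γ.Node, pinned (ι x) → x.IsPin)
    (hpin : ∀ x, pin (ι x) = ι (nodePerm π 1 1 x)) (h : Γ.Induced π) :
    ∃ e : Γ.nodeGraph.map ι ≃g Γ.nodeGraph.map ι, ∀ v, pinned v → e v = pin v := by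
  obtain ⟨φ, hm, hu⟩ := h
  let Φ : Equiv.Perm Γ.Profile := Equiv.ofBijective (Γ.mapProfile hm)
    (Finite.injective_iff_bijective.1 (mapProfile_injective hm))
  -- Vertices outside the range of `ι` may be pinned as well, hence `pin` is applied first.
  let e : Equiv.Perm V := (nodePerm 1 φ Φ).viaEmbedding ι * pin
  have heι : ∀ x, e (ι x) = ι (nodePerm π φ Φ x) := fun x => by
    simp only [e, Equiv.Perm.mul_apply, hpin]
    refine (Equiv.Perm.viaEmbedding_apply _ _ _).trans ?_
    cases x <;> rfl
  refine ⟨⟨e, fun {u v} => map_adj_iff_of_apply_eq ι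
    (nodeGraph_adj_nodePerm hm hu fun _ => rfl) heι u v⟩, fun v hv => ?_⟩
  change e v = pin v
  by_cases hr : v ∈ Set.range ι
  · obtain ⟨x, rfl⟩ := hr
    rw [heι, hpin]
    have hx := hpinned x hv
    cases x <;> first | rfl | exact hx.elim
  · refine Equiv.Perm.viaEmbedding_apply_of_notMem _ _ _ ?_
    rintro ⟨y, hy⟩
    obtain ⟨x, rfl⟩ := (nodePerm π 1 1).surjective y
    rw [← hpin] at hy
    exact hr ⟨x, pin.injective hy⟩

theorem induced_iff_exists_iso (hpinned : ∀ x : Γ.Node, pinned (ι x) ↔ x.IsPin)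
    (hpin : ∀ x, pin (ι x) = ι (nodePerm π 1 1 x)) : Γ.Induced π ↔
    ∃ e : Γ.nodeGraph.map ι ≃g Γ.nodeGraph.map ι, ∀ v, pinned v → e v = pin v :=
  ⟨exists_iso_of_induced ι (fun x => (hpinned x).1) hpin, fun ⟨e, he⟩ =>
    induced_of_iso ι e fun x hx => (he _ ((hpinned x).2 hx)).trans (hpin x)⟩

end Game

/-! ## Colours replaced by leaves -/

section

variable {V V' : Type*} (A : SimpleGraph V) (A' : SimpleGraph V') (c : V → ℕ) (c' : V' → ℕ) (Z : ℕ)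

/-- The graph `A` on the vertices `(v, 0)`, with leaves `(v, 1), …, (v, c v + 2)` attached to
`(v, 0)`. With at least two leaves at each vertex of `A`, the leaves can be told from the vertices
of `A`. -/
def leafGraph : SimpleGraph (V × Fin (Z + 3)) where
  Adj x y := (x.2 = 0 ∧ y.2 = 0 ∧ A.Adj x.1 y.1) ∨
    (x.1 = y.1 ∧ x.2 = 0 ∧ y.2 ≠ 0 ∧ y.2.val ≤ c x.1 + 2) ∨
    (x.1 = y.1 ∧ y.2 = 0 ∧ x.2 ≠ 0 ∧ x.2.val ≤ c x.1 + 2)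
  symm := ⟨by
    rintro ⟨x, y⟩ ⟨x', y'⟩ (⟨h₁, h₂, h⟩ | ⟨rfl, h⟩ | ⟨rfl, h⟩)
    · exact Or.inl ⟨h₂, h₁, h.symm⟩
    · exact Or.inr (Or.inr ⟨rfl, h⟩)
    · exact Or.inr (Or.inl ⟨rfl, h⟩)⟩
  loopless := ⟨by
    rintro ⟨x, y⟩ (⟨_, _, h⟩ | ⟨_, h₁, h₂, _⟩ | ⟨_, h₁, h₂, _⟩)
    · exact A.loopless.irrefl _ h
    · exact h₂ h₁
    · exact h₂ h₁⟩

variable {A A' c c' Z}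

theorem leafGraph_adj {x y : V × Fin (Z + 3)} : (leafGraph A c Z).Adj x y ↔
    (x.2 = 0 ∧ y.2 = 0 ∧ A.Adj x.1 y.1) ∨
    (x.1 = y.1 ∧ x.2 = 0 ∧ y.2 ≠ 0 ∧ y.2.val ≤ c x.1 + 2) ∨
    (x.1 = y.1 ∧ y.2 = 0 ∧ x.2 ≠ 0 ∧ x.2.val ≤ c x.1 + 2) := Iff.rfl

theorem leafGraph_adj_zero {u v : V} : (leafGraph A c Z).Adj (u, 0) (v, 0) ↔ A.Adj u v := by
  simp [leafGraph_adj]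

theorem leafGraph_snd_eq_zero_iff (x : V × Fin (Z + 3)) : x.2 = 0 ↔
    ∃ y z, y ≠ z ∧ (leafGraph A c Z).Adj x y ∧ (leafGraph A c Z).Adj x z := by
  constructor
  · intro h
    refine ⟨(x.1, ⟨1, by lia⟩), (x.1, ⟨2, by lia⟩), by simp, ?_, ?_⟩ <;>
      exact Or.inr (Or.inl ⟨rfl, h, by simp [Fin.ext_iff], by simp⟩)
  · rintro ⟨y, z, hyz, hy, hz⟩
    by_contra h
    simp only [leafGraph_adj, h, false_and, and_false, false_or] at hy hz
    exact hyz (Prod.ext (hy.1.symm.trans hz.1) (hy.2.1.trans hz.2.1.symm))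

theorem ncard_leaves {v : V} (hc : c v ≤ Z) :
    {y | (leafGraph A c Z).Adj (v, 0) y ∧ y.2 ≠ 0}.ncard = c v + 2 := by
  have himage : (fun y : V × Fin (Z + 3) => y.2.val) ''
      {y | (leafGraph A c Z).Adj (v, 0) y ∧ y.2 ≠ 0} = (Finset.Icc 1 (c v + 2) : Finset ℕ) := by
    ext z
    simp only [Set.mem_image, Set.mem_ofPred_eq, Finset.coe_Icc, Set.mem_Icc, leafGraph_adj]
    constructor
    · rintro ⟨y, ⟨h, h₀⟩, rfl⟩
      simp only [h₀, false_and, and_false, or_false, false_or] at h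
      exact ⟨Nat.one_le_iff_ne_zero.2 fun hy => h₀ (Fin.ext hy), h.2.2.2⟩
    · intro hz
      refine ⟨(v, ⟨z, by lia⟩), ⟨Or.inr (Or.inl ⟨rfl, trivial, ?_, hz.2⟩), ?_⟩, rfl⟩ <;>
        exact Fin.ne_of_val_ne (Nat.ne_of_gt hz.1)
  rw [← Set.InjOn.ncard_image (f := fun y : V × Fin (Z + 3) => y.2.val), himage,
    Set.ncard_coe_finset, Nat.card_Icc]
  · lia
  · rintro y ⟨hy, hy₀⟩ y' ⟨hy', hy₀'⟩ h
    simp only [leafGraph_adj, hy₀, hy₀', false_and, and_false, true_and, not_true, false_or,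
      or_false, ne_eq] at hy hy'
    exact Prod.ext (hy.1.symm.trans hy'.1) (Fin.ext h)

theorem leafGraph_iso_snd_eq_zero_iff (f : leafGraph A c Z ≃g leafGraph A' c' Z)
    (x : V × Fin (Z + 3)) : (f x).2 = 0 ↔ x.2 = 0 := by
  rw [leafGraph_snd_eq_zero_iff (A := A') (c := c'), leafGraph_snd_eq_zero_iff (A := A) (c := c)]
  simp [f.surjective.exists, f.map_adj_iff]

theorem leafGraph_iso_apply_zero (f : leafGraph A c Z ≃g leafGraph A' c' Z) (v : V) :
    f (v, 0) = ((f (v, 0)).1, 0) :=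
  Prod.ext rfl ((leafGraph_iso_snd_eq_zero_iff f (v, 0)).2 rfl)

theorem color_eq_of_leafGraph_iso (hc : ∀ v, c v ≤ Z) (hc' : ∀ v, c' v ≤ Z)
    (f : leafGraph A c Z ≃g leafGraph A' c' Z) (v : V) : c' (f (v, 0)).1 = c v := by
  have himage : f '' {y | (leafGraph A c Z).Adj (v, 0) y ∧ y.2 ≠ 0} =
      {y | (leafGraph A' c' Z).Adj ((f (v, 0)).1, 0) y ∧ y.2 ≠ 0} := by
    rw [← leafGraph_iso_apply_zero]
    ext y
    obtain ⟨y, rfl⟩ := f.surjective y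
    rw [f.injective.mem_set_image]
    simp only [Set.mem_ofPred_eq, f.map_adj_iff, ne_eq, leafGraph_iso_snd_eq_zero_iff]
  have hcard := congrArg Set.ncard himage
  rw [Set.ncard_image_of_injective _ f.injective, ncard_leaves (hc v), ncard_leaves (hc' _)]
    at hcard
  exact (Nat.add_right_cancel hcard).symm

theorem leafGraph_iso_iff (hc : ∀ v, c v ≤ Z) (hc' : ∀ v, c' v ≤ Z) :
    Nonempty (leafGraph A c Z ≃g leafGraph A' c' Z) ↔ ∃ e : A ≃g A', ∀ v, c' (e v) = c v := by
  constructor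
  · rintro ⟨f⟩
    refine ⟨⟨⟨fun v => (f (v, 0)).1, fun v => (f.symm (v, 0)).1, fun v => ?_, fun v => ?_⟩,
      fun {u v} => ?_⟩, color_eq_of_leafGraph_iso hc hc' f⟩
    · change (f.symm ((f (v, 0)).1, 0)).1 = v
      rw [← leafGraph_iso_apply_zero, f.symm_apply_apply]
    · change (f ((f.symm (v, 0)).1, 0)).1 = v
      rw [← leafGraph_iso_apply_zero f.symm, f.apply_symm_apply]
    · rw [Equiv.coe_fn_mk, ← leafGraph_adj_zero (c := c') (Z := Z), ← leafGraph_iso_apply_zero,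
        ← leafGraph_iso_apply_zero, f.map_adj_iff, leafGraph_adj_zero]
  · rintro ⟨e, hec⟩
    refine ⟨⟨Equiv.prodCongr e.toEquiv (Equiv.refl _), fun {x y} => ?_⟩⟩
    simp only [leafGraph_adj, Equiv.prodCongr_apply, Prod.map_fst, Prod.map_snd, Equiv.refl_apply,
      RelIso.coe_fn_toEquiv, hec, e.map_adj_iff, e.injective.eq_iff]

end

/-! ## Disjoint copies -/

section

variable {V ι : Type*}

/-- Disjoint copies of a graph. -/
def copies (A : SimpleGraph V) (ι : Type*) : SimpleGraph (ι × V) where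
  Adj x y := x.1 = y.1 ∧ A.Adj x.2 y.2
  symm := ⟨fun _ _ h => ⟨h.1.symm, h.2.symm⟩⟩
  loopless := ⟨fun _ h => A.loopless.irrefl _ h.2⟩

theorem copies_adj {A : SimpleGraph V} {x y : ι × V} :
    (copies A ι).Adj x y ↔ x.1 = y.1 ∧ A.Adj x.2 y.2 := Iff.rfl

variable {n Q : ℕ} {pinned : Fin n → Prop}

open Classical in
/-- The colour `v` in the `q`-th copy, if `u` is pinned; otherwise a colour that only depends on
the copy. -/
def copyColor (pinned : Fin n → Prop) (q : ℕ) (u v : Fin n) : ℕ :=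
  q * (n + 1) + if pinned u then v.val + 1 else 0

theorem copyColor_le {q : ℕ} (hq : q < Q) (u v : Fin n) :
    copyColor pinned q u v ≤ Q * (n + 1) := by
  have hQ : (q + 1) * (n + 1) ≤ Q * (n + 1) := Nat.mul_le_mul_right _ hq
  rw [Nat.succ_mul] at hQ
  unfold copyColor
  split_ifs <;> lia

theorem copyColor_div (q : ℕ) (u v : Fin n) : copyColor pinned q u v / (n + 1) = q := by
  unfold copyColor
  rw [Nat.mul_comm, Nat.mul_add_div n.succ_pos, Nat.div_eq_of_lt, Nat.add_zero]
  split_ifs <;> lia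

theorem copyColor_eq_iff {q q' : ℕ} {u v u' v' : Fin n} :
    copyColor pinned q u v = copyColor pinned q' u' v' ↔
      q = q' ∧ (pinned u ↔ pinned u') ∧ (pinned u → v = v') := by
  constructor
  · intro h
    have hq : q = q' := by rw [← copyColor_div q u v, h, copyColor_div]
    subst hq
    refine ⟨rfl, ?_⟩
    unfold copyColor at h
    by_cases hu : pinned u <;> by_cases hu' : pinned u' <;> simp_all [Fin.ext_iff]
  · rintro ⟨rfl, hu, hv⟩
    unfold copyColor
    by_cases h : pinned u
    · rw [if_pos h, if_pos (hu.1 h), hv h]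
    · rw [if_neg h, if_neg (mt hu.2 h)]

variable {A : SimpleGraph (Fin n)} {pin : Fin Q → Fin n → Fin n}

theorem exists_iso_of_copies_iso (hpin : ∀ q, Involutive (pin q))
    (e : copies A (Fin Q) ≃g copies A (Fin Q))
    (he : ∀ x, copyColor pinned (e x).1 (e x).2 (pin (e x).1 (e x).2) =
      copyColor pinned x.1 x.2 x.2) (q : Fin Q) :
    ∃ e' : A ≃g A, ∀ v, pinned v → e' v = pin q v := by
  simp only [copyColor_eq_iff, Fin.val_inj] at he
  have hfst : ∀ v, e (q, v) = (q, (e (q, v)).2) := fun v => Prod.ext (he (q, v)).1 rfl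
  have hinj : Injective fun v => (e (q, v)).2 := fun v w h => by
    have hvw : e (q, v) = e (q, w) := by rw [hfst v, hfst w]; exact congrArg _ h
    exact (Prod.mk.inj (e.injective hvw)).2
  refine ⟨⟨.ofBijective _ (Finite.injective_iff_bijective.1 hinj), fun {u v} => ?_⟩,
    fun v hv => ?_⟩
  · have hadj := e.map_adj_iff (v := (q, u)) (w := (q, v))
    rw [hfst u, hfst v] at hadj
    simpa [copies_adj] using hadj
  · obtain ⟨-, hiff, heq⟩ := he (q, v)
    have hpv := heq (hiff.2 hv)
    rw [(he (q, v)).1] at hpv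
    exact (hpin q).injective (hpv.trans (hpin q v).symm)

theorem exists_copies_iso (hpin : ∀ q, Involutive (pin q))
    (hpinned : ∀ q v, pinned (pin q v) ↔ pinned v)
    (h : ∀ q, ∃ e : A ≃g A, ∀ v, pinned v → e v = pin q v) :
    ∃ e : copies A (Fin Q) ≃g copies A (Fin Q), ∀ x,
      copyColor pinned (e x).1 (e x).2 (pin (e x).1 (e x).2) = copyColor pinned x.1 x.2 x.2 := by
  choose e he using h
  have hiff : ∀ q v, pinned (e q v) ↔ pinned v := fun q v => by
    constructor
    · intro h
      have hpv := he q (pin q (e q v)) ((hpinned _ _).2 h)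
      rw [hpin q] at hpv
      rwa [← (e q).injective hpv, hpinned]
    · intro h
      rwa [he q v h, hpinned]
  refine ⟨⟨⟨fun x => (x.1, e x.1 x.2), fun x => (x.1, (e x.1).symm x.2), fun x => by simp,
    fun x => by simp⟩, fun {x y} => ?_⟩, fun x => ?_⟩
  · simp only [copies_adj, Equiv.coe_fn_mk]
    refine and_congr_right fun hxy => ?_
    rw [hxy]
    exact (e y.1).map_adj_iff
  · refine copyColor_eq_iff.2 ⟨rfl, hiff x.1 x.2, fun hv => ?_⟩
    change pin x.1 (e x.1 x.2) = x.2
    rw [he x.1 x.2 ((hiff x.1 x.2).1 hv), hpin x.1]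

theorem copies_color_iff (hpin : ∀ q, Involutive (pin q))
    (hpinned : ∀ q v, pinned (pin q v) ↔ pinned v) :
    (∃ e : copies A (Fin Q) ≃g copies A (Fin Q), ∀ x,
      copyColor pinned (e x).1 (e x).2 (pin (e x).1 (e x).2) = copyColor pinned x.1 x.2 x.2) ↔
    ∀ q, ∃ e : A ≃g A, ∀ v, pinned v → e v = pin q v :=
  ⟨fun ⟨e, he⟩ => exists_iso_of_copies_iso hpin e he, exists_copies_iso hpin hpinned⟩

end

end

/-! ## Mixed radix digits -/

section

variable {N : ℕ}

/-- The function `m`, extended by zero to the natural numbers. -/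
def extend (m : Fin N → ℕ) (i : ℕ) : ℕ := if h : i < N then m ⟨i, h⟩ else 0

theorem extend_coe (m : Fin N → ℕ) (k : Fin N) : extend m k = m k := by simp [extend]

/-- The product of the last `i` values of `m`: the place values of the mixed radix system with
radices `m`, whose first digit is the most significant one. -/
def tailProd (m : Fin N → ℕ) (i : ℕ) : ℕ := ∏ j ∈ Finset.range i, extend m (N - 1 - j)

theorem tailProd_zero (m : Fin N → ℕ) : tailProd m 0 = 1 := Finset.prod_range_zero _

theorem tailProd_add_one (m : Fin N → ℕ) (i : ℕ) :
    tailProd m (i + 1) = tailProd m i * extend m (N - 1 - i) := Finset.prod_range_succ _ _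

theorem tailProd_tail (m : Fin (N + 1) → ℕ) {i : ℕ} (hi : i ≤ N) :
    tailProd m i = tailProd (fun k => m k.succ) i := by
  refine Finset.prod_congr rfl fun j hj => ?_
  have hj : j < N := (Finset.mem_range.1 hj).trans_le hi
  have h : N - j = N - 1 - j + 1 := by lia
  simp only [extend, Nat.add_sub_cancel, h]
  rw [dif_pos (by lia), dif_pos (by lia)]
  rfl

theorem tailProd_full_succ (m : Fin (N + 1) → ℕ) :
    tailProd m (N + 1) = m 0 * tailProd (fun k => m k.succ) N := by
  rw [tailProd_add_one, tailProd_tail m le_rfl, mul_comm]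
  simp [extend]

theorem tailProd_dvd (m : Fin N → ℕ) {i j : ℕ} (h : i ≤ j) : tailProd m i ∣ tailProd m j :=
  Finset.prod_dvd_prod_of_subset _ _ _ (Finset.range_mono h)

theorem tailProd_mul_dvd (m : Fin N → ℕ) (k : Fin N) :
    tailProd m (N - 1 - k) * m k ∣ tailProd m N := by
  have h : N - 1 - (N - 1 - k) = k.val := by lia
  have hprod : tailProd m (N - 1 - k) * m k = tailProd m (N - 1 - k + 1) := by
    rw [tailProd_add_one, h, extend_coe]
  exact hprod ▸ tailProd_dvd m (by lia)

end

namespace Game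

theorem length_allProfiles : ∀ (N : ℕ) (m : Fin N → ℕ), (allProfiles N m).length = tailProd m N
  | 0, m => by simp [allProfiles, tailProd_zero]
  | N + 1, m => by simp [allProfiles, length_allProfiles N, tailProd_full_succ]

theorem nodup_allProfiles : ∀ (N : ℕ) (m : Fin N → ℕ), (allProfiles N m).Nodup
  | 0, m => by simp [allProfiles]
  | N + 1, m => by
    rw [allProfiles, List.nodup_flatMap]
    refine ⟨fun a _ => (nodup_allProfiles N _).map fun s t h => (Fin.cons_inj.1 h).2, ?_⟩
    refine (List.nodup_finRange _).imp fun {a b} hab => ?_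
    rw [Function.onFun, List.disjoint_left]
    simp only [List.mem_map, not_exists, not_and]
    rintro _ ⟨s, _, rfl⟩ t _ h
    exact hab (Fin.cons_inj.1 h).1.symm

theorem getElem?_allProfiles_succ {N : ℕ} {m : Fin (N + 1) → ℕ} {c : ℕ} {s : ∀ i, Fin (m i)}
    (h : (allProfiles (N + 1) m)[c]? = some s) :
    (s 0).val = c / tailProd (fun k => m k.succ) N ∧
      (allProfiles N fun k => m k.succ)[c % tailProd (fun k => m k.succ) N]? =
        some (Fin.tail s) := by
  have hc : c < tailProd m (N + 1) := by
    rw [← length_allProfiles]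
    exact (List.getElem?_eq_some_iff.1 h).1
  rw [tailProd_full_succ] at hc
  set T := tailProd (fun k => m k.succ) N with hT
  have hT₀ : 0 < T := Nat.pos_of_ne_zero fun h => by simp [h] at hc
  rw [allProfiles, ← Nat.div_add_mod' c T, getElem?_flatMap_of_length (c := T) _
    (by simp [length_allProfiles, hT]) (Nat.mod_lt _ hT₀)] at h
  obtain ⟨a, ha, h⟩ := Option.bind_eq_some_iff.1 h
  rw [List.getElem?_map] at h
  obtain ⟨s', hs', rfl⟩ := Option.map_eq_some_iff.1 h
  obtain ⟨_, rfl⟩ := List.getElem?_eq_some_iff.1 ha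
  exact ⟨by simp, by simpa using hs'⟩

theorem val_of_getElem?_allProfiles : ∀ {N : ℕ} {m : Fin N → ℕ} {c : ℕ} {s : ∀ i, Fin (m i)},
    (allProfiles N m)[c]? = some s →
      ∀ k : Fin N, (s k).val = c / tailProd m (N - 1 - k) % m k
  | 0, _, _, _, _ => fun k => k.elim0
  | N + 1, m, c, s, h => by
    obtain ⟨hzero, htail⟩ := getElem?_allProfiles_succ h
    intro k
    induction k using Fin.cases with
    | zero =>
      rw [Fin.val_zero, Nat.add_sub_cancel, Nat.sub_zero, tailProd_tail m le_rfl, ← hzero,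
        Nat.mod_eq_of_lt (s 0).2]
    | succ k =>
      have hk : N + 1 - 1 - k.succ.val = N - 1 - k := by simp only [Fin.val_succ]; lia
      have ih := val_of_getElem?_allProfiles htail k
      obtain ⟨r, hr⟩ := tailProd_mul_dvd (fun k => m k.succ) k
      rw [hr, mul_assoc, Nat.mod_mul_right_div_self, Nat.mod_mul_right_mod] at ih
      rw [hk, tailProd_tail m (by lia), ← ih]
      rfl

/-! ## Reading games -/

variable (Γ : Game)

/-- The number of actions of the player `k`. -/
def acts (k : ℕ) : ℕ := extend Γ.numActions k

/-- The number of profiles. -/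
def numProfiles : ℕ := tailProd Γ.numActions Γ.numPlayers

/-- The action of the player `k` at the `c`-th profile. -/
def digit (c k : ℕ) : ℕ := c / tailProd Γ.numActions (Γ.numPlayers - 1 - k) % Γ.acts k

/-- The position of a profile in the list of all profiles. -/
def index (s : Γ.Profile) : ℕ := (allProfiles Γ.numPlayers Γ.numActions).idxOf s

variable {Γ}

theorem index_lt (s : Γ.Profile) : Γ.index s < Γ.numProfiles := by
  rw [numProfiles, ← length_allProfiles]
  exact List.idxOf_lt_length_of_mem (mem_allProfiles _ _ s)

theorem getElem?_index (s : Γ.Profile) :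
    (allProfiles Γ.numPlayers Γ.numActions)[Γ.index s]? = some s :=
  List.getElem?_idxOf (mem_allProfiles _ _ s)

theorem index_injective : Injective Γ.index := fun s t h => by
  rw [← Option.some_inj, ← getElem?_index s, h, getElem?_index]

theorem exists_index_eq {c : ℕ} (hc : c < Γ.numProfiles) : ∃ s, Γ.index s = c := by
  rw [numProfiles, ← length_allProfiles] at hc
  exact ⟨_, (nodup_allProfiles _ _).idxOf_getElem c hc⟩

theorem acts_coe (k : Γ.Player) : Γ.acts k = Γ.numActions k := extend_coe _ _

theorem digit_index (s : Γ.Profile) (k : Γ.Player) : Γ.digit (Γ.index s) k = s k := by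
  rw [digit, acts_coe]
  exact (val_of_getElem?_allProfiles (getElem?_index s) k).symm

theorem numProfiles_pos : 0 < Γ.numProfiles := by
  rw [numProfiles, tailProd]
  refine Finset.prod_pos fun j hj => ?_
  have hj := Finset.mem_range.1 hj
  rw [extend, dif_pos (by lia)]
  exact Γ.numActions_pos _

theorem tailProd_le {i : ℕ} (hi : i ≤ Γ.numPlayers) : tailProd Γ.numActions i ≤ Γ.numProfiles :=
  Nat.le_of_dvd numProfiles_pos (tailProd_dvd _ hi)

theorem acts_le (k : Γ.Player) : Γ.acts k ≤ Γ.numProfiles :=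
  Nat.le_of_dvd numProfiles_pos
    (acts_coe k ▸ (Dvd.intro_left _ rfl).trans (tailProd_mul_dvd Γ.numActions k))

theorem numPlayers_add_lt_length_encode :
    Γ.numPlayers + Γ.numProfiles * Γ.numPlayers < Γ.encode.length := by
  have hrat : ∀ q : ℚ, 1 ≤ (encodeRat q).length := fun q => by simp [encodeRat]
  have hprofile : ∀ s, Γ.numPlayers ≤
      ((List.finRange Γ.numPlayers).flatMap fun i => encodeRat (Γ.payoff i s)).length := fun s => by
    rw [List.length_flatMap]
    simpa using List.card_nsmul_le_sum ((List.finRange Γ.numPlayers).map fun i =>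
      (encodeRat (Γ.payoff i s)).length) 1 (by simp [hrat])
  have htable : Γ.numProfiles * Γ.numPlayers ≤
      ((allProfiles Γ.numPlayers Γ.numActions).flatMap fun s =>
        (List.finRange Γ.numPlayers).flatMap fun i => encodeRat (Γ.payoff i s)).length := by
    rw [numProfiles, ← length_allProfiles, List.length_flatMap, ← smul_eq_mul]
    refine le_trans (le_of_eq (by rw [List.length_map])) (List.card_nsmul_le_sum _ _ fun n hn => ?_)
    obtain ⟨s, -, rfl⟩ := List.mem_map.1 hn
    exact hprofile s
  have hunary : (encodeUnary Γ.numPlayers).length = Γ.numPlayers + 1 := by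
    simp [encodeUnary, encodeBits]
  simp only [encode, List.length_append]
  lia

theorem numProfiles_le_length_encode : Γ.numProfiles ≤ Γ.encode.length := by
  have hlength := numPlayers_add_lt_length_encode (Γ := Γ)
  rcases Nat.eq_zero_or_pos Γ.numPlayers with h | h
  · have hone : Γ.numProfiles = 1 := by simp [numProfiles, tailProd, h]
    lia
  · exact (Nat.le_mul_of_pos_right _ h).trans (by lia)

variable (Γ) in
/-- The comma-free blocks of the code of a game. -/
def blocks : List (List Γ') :=
  List.replicate Γ.numPlayers (Γ'.bit true) ::
    ((List.finRange Γ.numPlayers).map (fun i => List.replicate (Γ.numActions i) (Γ'.bit true)) ++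
      (allProfiles Γ.numPlayers Γ.numActions).flatMap fun s =>
        (List.finRange Γ.numPlayers).flatMap fun i =>
          [Γ'.bit (decide ((Γ.payoff i s).num < 0)) ::
              (encodeNat (Γ.payoff i s).num.natAbs).map Γ'.bit,
            (encodeNat (Γ.payoff i s).den).map Γ'.bit])

theorem encode_eq_blocks : Γ.encode = Γ.blocks.flatMap fun w => w ++ [Γ'.comma] := by
  simp [encode, blocks, encodeUnary, encodeBits, encodeRat, encodeBinary, List.flatMap_assoc,
    List.flatMap_map]

theorem comma_notMem_blocks : ∀ w ∈ Γ.blocks, Γ'.comma ∉ w := by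
  intro w hw
  simp only [blocks, List.mem_cons, List.mem_append, List.mem_map, List.mem_flatMap,
    List.not_mem_nil, or_false] at hw
  rcases hw with rfl | ⟨_, _, rfl⟩ | ⟨_, _, _, _, rfl | rfl⟩ <;> simp

theorem token_encode (i : ℕ) : token Γ.encode i = Γ.blocks[i]?.getD [] := by
  rw [encode_eq_blocks, token_flatMap comma_notMem_blocks]

theorem token_encode_acts (k : Γ.Player) :
    token Γ.encode (1 + k) = List.replicate (Γ.numActions k) (Γ'.bit true) := by
  rw [token_encode, blocks, Nat.add_comm, List.getElem?_cons_succ, List.getElem?_append_left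
    (by simp)]
  simp

theorem token_encode_payoff (s : Γ.Profile) (l : Γ.Player) {b : ℕ} (hb : b < 2) :
    token Γ.encode (1 + Γ.numPlayers + ((Γ.index s * Γ.numPlayers + l) * 2 + b)) =
      [Γ'.bit (decide ((Γ.payoff l s).num < 0)) ::
          (encodeNat (Γ.payoff l s).num.natAbs).map Γ'.bit,
        (encodeNat (Γ.payoff l s).den).map Γ'.bit][b]?.getD [] := by
  have hl := l.2
  rw [token_encode, blocks, Nat.add_assoc, Nat.add_comm, List.getElem?_cons_succ,
    List.getElem?_append_right (by simp)]
  have hposition : (Γ.index s * Γ.numPlayers + l) * 2 + b =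
      Γ.index s * (Γ.numPlayers * 2) + (l * 2 + b) := by ring
  rw [List.length_map, List.length_finRange, Nat.add_sub_cancel_left, hposition,
    getElem?_flatMap_of_length _ (by simp [List.length_flatMap]) (by lia),
    getElem?_index, Option.bind_some, getElem?_flatMap_of_length _ (by simp) hb]
  simp

variable (Γ) in
/-- The payoffs at the positions `c` and `c'` of the payoff table agree. -/
def SamePayoff (c c' : ℕ) : Prop := ∀ b < 2,
  token Γ.encode (1 + Γ.numPlayers + (c * 2 + b)) = token Γ.encode (1 + Γ.numPlayers + (c' * 2 + b))

theorem samePayoff_iff (k l : Γ.Player) (s t : Γ.Profile) :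
    Γ.SamePayoff (Γ.index s * Γ.numPlayers + k) (Γ.index t * Γ.numPlayers + l) ↔
      Γ.payoff k s = Γ.payoff l t := by
  constructor
  · intro h
    have hnum := h 0 (by lia)
    have hden := h 1 (by lia)
    rw [token_encode_payoff _ _ (by lia), token_encode_payoff _ _ (by lia)] at hnum
    rw [token_encode_payoff _ _ (by lia), token_encode_payoff _ _ (by lia)] at hden
    simp only [List.getElem?_cons_zero, List.getElem?_cons_succ, Option.getD_some] at hnum hden
    refine encodeRat_selfDelimiting.injective ?_
    simp only [encodeRat, encodeBinary, encodeBits, hden, ← List.cons_append, ← List.append_assoc,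
      hnum]
  · intro h b hb
    rw [token_encode_payoff _ _ hb, token_encode_payoff _ _ hb, h]

end Game

open Game

namespace PolyTime

variable {α : Type} [Data α]

theorem getElem?_eq {f g : α → List Γ'} {i : α → ℕ} (hf : PolyTime f) (hg : PolyTime g)
    (hi : PolyTime i) : PolyTime fun x => (f x)[i x]? = (g x)[i x]? := by
  refine (cases (f := fun o x => o = (g x)[i x]?) (fun o => ?_) (hf.drop hi)).congr fun x => by
    simp only [List.head?_drop]
  cases o with
  | none => exact (hg.length.le hi).congr fun x => by simp [eq_comm (a := none)]
  | some c => exact (hg.getElem?_eq_some hi c).congr fun x => propext eq_comm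

theorem eq_list {f g : α → List Γ'} (hf : PolyTime f) (hg : PolyTime g) :
    PolyTime fun x => f x = g x := by
  refine (forall_lt (p := fun x i => (f x)[i]? = (g x)[i]?) (hf.length.add hg.length)
    ((hf.rearrange Rearranges.id.fst).getElem?_eq (hg.rearrange Rearranges.id.fst)
      Rearranges.id.snd.polyTime)).congr fun x => propext ⟨fun h => ?_, fun h i _ => by rw [h]⟩
  refine List.ext_getElem? fun i => ?_
  by_cases hi : i < (f x).length + (g x).length
  · exact h i hi
  · rw [List.getElem?_eq_none (by lia), List.getElem?_eq_none (by lia)]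

variable {f : α → Game} {i j : α → ℕ}

theorem encode (hf : PolyTime f) : PolyTime fun x => (f x).encode := hf.to_str

theorem numPlayers (hf : PolyTime f) : PolyTime fun x => (f x).numPlayers :=
  (hf.encode.token (const 0)).length.congr fun x => by simp [token_encode, blocks]

theorem acts (hf : PolyTime f) (hi : PolyTime i) : PolyTime fun x => (f x).acts (i x) :=
  ((hi.lt hf.numPlayers).ite (hf.encode.token ((const 1).add hi)).length (const 0)).congr
    fun x => by
      split_ifs with h
      · rw [token_encode_acts ⟨i x, h⟩, ← acts_coe, List.length_replicate]
      · rw [Game.acts, extend, dif_neg h]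

theorem tailProd (hf : PolyTime f) (hi : PolyTime i) (h : ∀ x, i x ≤ (f x).numPlayers) :
    PolyTime fun x => tailProd (f x).numActions (i x) := by
  have hp : PolyTime fun p : (α × ℕ) × ℕ => f p.1.1 := hf.rearrange Rearranges.id.fst.fst
  refine recursion_nat (R := fun x i => GameSym.tailProd (f x).numActions i)
    (h := fun p : (α × ℕ) × ℕ => p.2 * (f p.1.1).acts ((f p.1.1).numPlayers - 1 - p.1.2))
    (Rearranges.id.snd.polyTime.mul
      (hp.acts ((hp.numPlayers.sub (const 1)).sub Rearranges.id.fst.snd.polyTime)))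
    (const 1) hi (polyBounded_of_nat hf.encode.length) (fun x => tailProd_zero _)
    (fun x i => tailProd_add_one _ _) fun x i hi => ?_
  rw [length_str_nat]
  exact (tailProd_le (hi.trans (h x))).trans numProfiles_le_length_encode

theorem numProfiles (hf : PolyTime f) : PolyTime fun x => (f x).numProfiles :=
  hf.tailProd hf.numPlayers fun _ => le_rfl

theorem digit (hf : PolyTime f) (hi : PolyTime i) (hj : PolyTime j) :
    PolyTime fun x => (f x).digit (i x) (j x) :=
  (hi.div (hf.tailProd ((hf.numPlayers.sub (const 1)).sub hj) fun x => by lia)).mod (hf.acts hj)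

theorem samePayoff (hf : PolyTime f) (hi : PolyTime i) (hj : PolyTime j) :
    PolyTime fun x => (f x).SamePayoff (i x) (j x) := by
  have htoken : ∀ {k : α → ℕ}, PolyTime k → PolyTime fun p : α × ℕ =>
      GameSym.token (f p.1).encode (1 + (f p.1).numPlayers + (k p.1 * 2 + p.2)) := fun hk =>
    (hf.rearrange Rearranges.id.fst).encode.token
      (((const 1).add (hf.numPlayers.rearrange Rearranges.id.fst)).add
        (((hk.rearrange Rearranges.id.fst).mul (const 2)).add Rearranges.id.snd.polyTime))
  exact forall_lt (const 2) ((htoken hi).eq_list (htoken hj))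

end PolyTime

/-! ## Coding the graph of a game -/

section

/-- The code of the triple `(t, a, b)` of numbers below `B`. -/
def triple (B t a b : ℕ) : ℕ := B * (B * t + a) + b

variable {B t a b : ℕ}

theorem triple_mod (hb : b < B) : triple B t a b % B = b := by
  rw [triple, Nat.mul_add_mod, Nat.mod_eq_of_lt hb]

theorem triple_div (hb : b < B) : triple B t a b / B = B * t + a := by
  rw [triple, Nat.mul_add_div (by lia), Nat.div_eq_of_lt hb, Nat.add_zero]

theorem triple_div_mod (ha : a < B) (hb : b < B) : triple B t a b / B % B = a := by
  rw [triple_div hb, Nat.mul_add_mod, Nat.mod_eq_of_lt ha]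

theorem triple_div_div (ha : a < B) (hb : b < B) : triple B t a b / B / B = t := by
  rw [triple_div hb, Nat.mul_add_div (by lia), Nat.div_eq_of_lt ha, Nat.add_zero]

theorem triple_of_div_mod (u : ℕ) : triple B (u / B / B) (u / B % B) (u % B) = u := by
  rw [triple, Nat.div_add_mod, Nat.div_add_mod]

theorem triple_lt (ht : t < B) (ha : a < B) (hb : b < B) : triple B t a b < B * B * B :=
  Nat.mul_add_lt_mul_of_lt_of_lt (Nat.mul_add_lt_mul_of_lt_of_lt ht ha) hb

theorem PolyTime.triple {α : Type} [Data α] {B t a b : α → ℕ} (hB : PolyTime B) (ht : PolyTime t)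
    (ha : PolyTime a) (hb : PolyTime b) : PolyTime fun x => triple (B x) (t x) (a x) (b x) :=
  (hB.mul ((hB.mul ht).add ha)).add hb

end

namespace Game

variable (Γ : Game)

/-- A bound for the numbers that occur in the codes of vertices. -/
def bound : ℕ := Γ.encode.length + 4

/-- The order of the coded graph of a game. -/
def order : ℕ := Γ.bound * Γ.bound * Γ.bound

variable {Γ}

theorem bound_pos : 0 < Γ.bound := Nat.succ_pos _

theorem numPlayers_lt_bound : Γ.numPlayers < Γ.bound := by
  have hlength := numPlayers_add_lt_length_encode (Γ := Γ)
  unfold bound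
  lia

theorem numProfiles_mul_lt_bound : Γ.numProfiles * Γ.numPlayers < Γ.bound := by
  have hlength := numPlayers_add_lt_length_encode (Γ := Γ)
  unfold bound
  lia

theorem numProfiles_lt_bound : Γ.numProfiles < Γ.bound :=
  numProfiles_le_length_encode.trans_lt (Nat.lt_add_of_pos_right four_pos)

theorem coe_lt_bound (k : Γ.Player) : k.val < Γ.bound := k.2.trans numPlayers_lt_bound

theorem index_mul_add_lt (s : Γ.Profile) (l : Γ.Player) :
    Γ.index s * Γ.numPlayers + l < Γ.numProfiles * Γ.numPlayers :=
  Nat.mul_comm _ (Γ.index s) ▸ Nat.mul_add_lt_mul_of_lt_of_lt (index_lt s) l.2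

theorem exists_index_mul_add {c : ℕ} (hc : c < Γ.numProfiles * Γ.numPlayers) :
    ∃ s l, Γ.index s * Γ.numPlayers + (l : Γ.Player).val = c := by
  have hN : 0 < Γ.numPlayers := Nat.pos_of_ne_zero fun h => by simp [h] at hc
  obtain ⟨s, hs⟩ := exists_index_eq (Nat.div_lt_of_lt_mul (Nat.mul_comm _ _ ▸ hc))
  exact ⟨s, ⟨c % Γ.numPlayers, Nat.mod_lt _ hN⟩, by rw [hs, Nat.div_add_mod']⟩

theorem index_mul_add_inj {s t : Γ.Profile} {l k : Γ.Player}
    (h : Γ.index s * Γ.numPlayers + l = Γ.index t * Γ.numPlayers + k) : s = t ∧ l = k := by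
  have hmod := congrArg (· % Γ.numPlayers) h
  simp only [Nat.mul_add_mod_self_right, Nat.mod_eq_of_lt l.2, Nat.mod_eq_of_lt k.2] at hmod
  rw [hmod] at h
  exact ⟨index_injective (Nat.eq_of_mul_eq_mul_right (Nat.zero_lt_of_lt l.2)
    (Nat.add_right_cancel h)), Fin.ext hmod⟩

namespace Node

/-- The kind of a vertex: the first component of its code. -/
def kind : Γ.Node → ℕ
  | .player _ => 0
  | .action _ => 1
  | .profile _ => 2
  | .cell _ _ _ => 3

/-- The second component of the code of a vertex. -/
def major : Γ.Node → ℕ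
  | .player k => k
  | .action x => x.1
  | .profile s => Γ.index s
  | .cell k _ _ => k

/-- The third component of the code of a vertex. -/
def minor : Γ.Node → ℕ
  | .player _ => 0
  | .action x => x.2
  | .profile _ => 0
  | .cell _ s l => Γ.index s * Γ.numPlayers + l

theorem kind_lt (x : Γ.Node) : x.kind < Γ.bound := by
  cases x <;> simp only [kind, bound] <;> lia

theorem major_lt (x : Γ.Node) : x.major < Γ.bound := by
  cases x with
  | player k => exact coe_lt_bound k
  | action x => exact coe_lt_bound x.1
  | profile s => exact (index_lt s).trans numProfiles_lt_bound
  | cell k s l => exact coe_lt_bound k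

theorem minor_lt (x : Γ.Node) : x.minor < Γ.bound := by
  cases x with
  | player k => exact bound_pos
  | action x => exact (x.2.2.trans_le (acts_coe x.1 ▸ acts_le x.1)).trans numProfiles_lt_bound
  | profile s => exact bound_pos
  | cell k s l => exact (index_mul_add_lt s l).trans numProfiles_mul_lt_bound

theorem ext_code {x y : Γ.Node} (hkind : x.kind = y.kind) (hmajor : x.major = y.major)
    (hminor : x.minor = y.minor) : x = y := by
  cases x <;> cases y <;> cases hkind
  case player.player k k' => rw [Fin.ext hmajor]
  case action.action x y =>
    rw [Sigma.ext (Fin.ext hmajor)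
      ((Fin.heq_ext_iff (congrArg Γ.numActions (Fin.ext hmajor))).2 hminor)]
  case profile.profile s t => rw [index_injective hmajor]
  case cell.cell k s l k' s' l' =>
    obtain ⟨rfl, rfl⟩ := index_mul_add_inj hminor
    rw [Fin.ext hmajor]

end Node

variable (Γ) in
/-- The vertices of the graph of a game, coded by numbers. -/
def code : Γ.Node ↪ Fin Γ.order where
  toFun x := ⟨triple Γ.bound x.kind x.major x.minor, triple_lt x.kind_lt x.major_lt x.minor_lt⟩
  inj' x y h := by
    have h : triple _ _ _ _ = triple _ _ _ _ := Fin.val_eq_of_eq h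
    refine Node.ext_code ?_ ?_ ?_
    · rw [← triple_div_div (t := x.kind) x.major_lt x.minor_lt, h,
        triple_div_div y.major_lt y.minor_lt]
    · rw [← triple_div_mod (t := x.kind) x.major_lt x.minor_lt, h,
        triple_div_mod y.major_lt y.minor_lt]
    · rw [← triple_mod (t := x.kind) (a := x.major) x.minor_lt, h, triple_mod y.minor_lt]

theorem code_val (x : Γ.Node) : (Γ.code x).val = triple Γ.bound x.kind x.major x.minor := rfl

theorem code_eq_iff {x : Γ.Node} {u : Fin Γ.order} : Γ.code x = u ↔
    x.kind = u / Γ.bound / Γ.bound ∧ x.major = u / Γ.bound % Γ.bound ∧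
      x.minor = u % Γ.bound := by
  rw [← Fin.val_inj, code_val]
  constructor
  · intro h
    rw [← h, triple_div_div x.major_lt x.minor_lt, triple_div_mod x.major_lt x.minor_lt,
      triple_mod x.minor_lt]
    exact ⟨rfl, rfl, rfl⟩
  · rintro ⟨hkind, hmajor, hminor⟩
    rw [hkind, hmajor, hminor, triple_of_div_mod]

variable (Γ) in
/-- The relation `Link` in terms of the components `(t, a, b)` and `(t', a', b')` of the codes of
two vertices. -/
def LinkCode (t a b t' a' b' : ℕ) : Prop :=
  (t = 0 ∧ t' = 1 ∧ a < Γ.numPlayers ∧ b = 0 ∧ a' = a ∧ b' < Γ.acts a) ∨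
  (t = 1 ∧ t' = 2 ∧ a < Γ.numPlayers ∧ a' < Γ.numProfiles ∧ b' = 0 ∧ b = Γ.digit a' a) ∨
  (t = 2 ∧ t' = 3 ∧ a < Γ.numProfiles ∧ b = 0 ∧ a' < Γ.numPlayers ∧
    b' < Γ.numProfiles * Γ.numPlayers ∧ Γ.SamePayoff (a * Γ.numPlayers + a') b')

theorem linkCode_of_link {x y : Γ.Node} (h : Link x y) :
    Γ.LinkCode x.kind x.major x.minor y.kind y.major y.minor := by
  cases x <;> cases y <;> simp only [Link] at h
  case player.action k x =>
    subst h
    exact Or.inl ⟨rfl, rfl, x.1.2, rfl, rfl, (acts_coe x.1).symm ▸ x.2.2⟩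
  case action.profile x s =>
    refine Or.inr (Or.inl ⟨rfl, rfl, x.1.2, index_lt s, rfl, ?_⟩)
    simp only [Node.major, Node.minor]
    rw [digit_index, h]
  case profile.cell s k s' l =>
    exact Or.inr (Or.inr ⟨rfl, rfl, index_lt s, rfl, k.2, index_mul_add_lt s' l,
      (samePayoff_iff k l s s').2 h⟩)

theorem exists_link_of_linkCode {t a b t' a' b' : ℕ} (h : Γ.LinkCode t a b t' a' b') :
    ∃ x y : Γ.Node, Link x y ∧ (x.kind = t ∧ x.major = a ∧ x.minor = b) ∧
      (y.kind = t' ∧ y.major = a' ∧ y.minor = b') := by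
  obtain ⟨rfl, rfl, ha, rfl, rfl, hb⟩ | ⟨rfl, rfl, ha, ha', rfl, rfl⟩ |
    ⟨rfl, rfl, ha, rfl, ha', hb', h⟩ := h
  · let k : Γ.Player := ⟨a', ha⟩
    exact ⟨.player k, .action ⟨k, b', acts_coe k ▸ hb⟩, rfl, ⟨rfl, rfl, rfl⟩, rfl, rfl, rfl⟩
  · let k : Γ.Player := ⟨a, ha⟩
    obtain ⟨s, rfl⟩ := exists_index_eq ha'
    exact ⟨.action ⟨k, s k⟩, .profile s, rfl, ⟨rfl, rfl, (digit_index s k).symm⟩, rfl, rfl, rfl⟩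
  · let k : Γ.Player := ⟨a', ha'⟩
    obtain ⟨s, rfl⟩ := exists_index_eq ha
    obtain ⟨s', l, rfl⟩ := exists_index_mul_add hb'
    exact ⟨.profile s, .cell k s' l, (samePayoff_iff k l s s').1 h, ⟨rfl, rfl, rfl⟩, rfl, rfl, rfl⟩

variable (Γ) in
/-- The edges of the coded graph, in one direction. -/
def Arc (u v : ℕ) : Prop := Γ.LinkCode (u / Γ.bound / Γ.bound) (u / Γ.bound % Γ.bound)
  (u % Γ.bound) (v / Γ.bound / Γ.bound) (v / Γ.bound % Γ.bound) (v % Γ.bound)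

theorem arc_iff {u v : Fin Γ.order} :
    Γ.Arc u v ↔ ∃ x y : Γ.Node, Link x y ∧ Γ.code x = u ∧ Γ.code y = v := by
  simp only [code_eq_iff]
  constructor
  · exact exists_link_of_linkCode
  · rintro ⟨x, y, h, ⟨hx₁, hx₂, hx₃⟩, hy₁, hy₂, hy₃⟩
    rw [Arc, ← hx₁, ← hx₂, ← hx₃, ← hy₁, ← hy₂, ← hy₃]
    exact linkCode_of_link h

variable (Γ) in
/-- The graph of a game on the codes of its vertices; the numbers that are not codes are isolated
vertices. -/
def codedGraph : SimpleGraph (Fin Γ.order) := Γ.nodeGraph.map Γ.code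

theorem codedGraph_adj {u v : Fin Γ.order} : Γ.codedGraph.Adj u v ↔ Γ.Arc u v ∨ Γ.Arc v u := by
  rw [codedGraph, SimpleGraph.map_adj, arc_iff, arc_iff]
  constructor
  · rintro ⟨x, y, h | h, hx, hy⟩
    · exact Or.inl ⟨x, y, h, hx, hy⟩
    · exact Or.inr ⟨y, x, h, hy, hx⟩
  · rintro (⟨x, y, h, hx, hy⟩ | ⟨x, y, h, hx, hy⟩)
    · exact ⟨x, y, Or.inl h, hx, hy⟩
    · exact ⟨y, x, Or.inr h, hy, hx⟩

variable (Γ)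

/-- The coded graph of a game, bundled with its order. -/
def finGraph : FinGraph := ⟨Γ.order, Γ.codedGraph⟩

/-- The codes whose images are prescribed: all except those of actions and profiles. -/
def Pinned (u : ℕ) : Prop := ¬(u / Γ.bound / Γ.bound = 1 ∨ u / Γ.bound / Γ.bound = 2)

open Classical in
/-- The action of a transposition of players on the codes of vertices. -/
def pin (i j u : ℕ) : ℕ :=
  if Γ.Pinned u then triple Γ.bound (u / Γ.bound / Γ.bound)
    (Equiv.swap i j (u / Γ.bound % Γ.bound)) (u % Γ.bound)
  else u

variable {Γ}

section

variable {i j : ℕ}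

theorem swap_lt {a n : ℕ} (hi : i < n) (hj : j < n) (ha : a < n) : Equiv.swap i j a < n := by
  rw [Equiv.swap_apply_def]
  split_ifs <;> assumption

variable (hi : i < Γ.bound) (hj : j < Γ.bound)
include hi hj

theorem swap_div_mod_lt (u : ℕ) : Equiv.swap i j (u / Γ.bound % Γ.bound) < Γ.bound :=
  swap_lt hi hj (Nat.mod_lt _ bound_pos)

theorem pin_lt {u : ℕ} (hu : u < Γ.order) : Γ.pin i j u < Γ.order := by
  unfold pin
  split_ifs
  · refine triple_lt ?_ (swap_div_mod_lt hi hj u) (Nat.mod_lt _ bound_pos)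
    rw [Nat.div_div_eq_div_mul]
    exact Nat.div_lt_of_lt_mul hu
  · exact hu

theorem pinned_pin (u : ℕ) : Γ.Pinned (Γ.pin i j u) ↔ Γ.Pinned u := by
  by_cases h : Γ.Pinned u
  · rw [pin, if_pos h, Pinned, Pinned,
      triple_div_div (swap_div_mod_lt hi hj u) (Nat.mod_lt _ bound_pos)]
  · rw [pin, if_neg h]

theorem pin_pin (u : ℕ) : Γ.pin i j (Γ.pin i j u) = u := by
  by_cases h : Γ.Pinned u
  · have ha := swap_div_mod_lt hi hj u
    have hb := Nat.mod_lt u (bound_pos (Γ := Γ))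
    rw [pin, if_pos ((pinned_pin hi hj u).2 h), pin, if_pos h, triple_div_div ha hb,
      triple_div_mod ha hb, triple_mod hb, Equiv.swap_apply_self, triple_of_div_mod]
  · rw [pin, if_neg (by rwa [pinned_pin hi hj]), pin, if_neg h]

end

variable (Γ) in
/-- The action of a transposition of players on the vertices of the coded graph. -/
def pinFin (i j : Γ.Player) (u : Fin Γ.order) : Fin Γ.order :=
  ⟨Γ.pin i j u, pin_lt (coe_lt_bound i) (coe_lt_bound j) u.2⟩

variable (i j : Γ.Player)

theorem pinFin_involutive : Involutive (Γ.pinFin i j) := fun u =>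
  Fin.ext (pin_pin (coe_lt_bound i) (coe_lt_bound j) u)

theorem pinned_pinFin (u : Fin Γ.order) : Γ.Pinned (Γ.pinFin i j u) ↔ Γ.Pinned u :=
  pinned_pin (coe_lt_bound i) (coe_lt_bound j) u

theorem pinned_code (x : Γ.Node) : Γ.Pinned (Γ.code x) ↔ x.IsPin := by
  rw [Pinned, code_val, triple_div_div x.major_lt x.minor_lt]
  cases x <;> simp [Node.kind, Node.IsPin]

theorem coe_swap {n : ℕ} (i j k : Fin n) : (Equiv.swap i j k).val = Equiv.swap i.val j.val k := by
  simp only [Equiv.swap_apply_def, Fin.ext_iff]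
  split_ifs <;> rfl

theorem pinFin_code (x : Γ.Node) :
    Γ.pinFin i j (Γ.code x) = Γ.code (nodePerm (Equiv.swap i j) 1 1 x) := by
  refine Fin.ext ?_
  change Γ.pin i j (Γ.code x) = _
  by_cases h : x.IsPin
  · rw [pin, if_pos ((pinned_code x).2 h)]
    simp only [code_val, triple_div_div x.major_lt x.minor_lt,
      triple_div_mod x.major_lt x.minor_lt, triple_mod x.minor_lt]
    cases x with
    | player | cell => simp only [nodePerm, Equiv.coe_fn_mk, Node.kind, Node.major, Node.minor,
        coe_swap]
    | action | profile => exact h.elim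
  · rw [pin, if_neg (mt (pinned_code x).1 h)]
    cases x with
    | player | cell => exact (h trivial).elim
    | action | profile => rfl

theorem induced_swap_iff : Γ.Induced (Equiv.swap i j) ↔
    ∃ e : Γ.codedGraph ≃g Γ.codedGraph, ∀ v : Fin Γ.order, Γ.Pinned v → e v = Γ.pinFin i j v :=
  induced_iff_exists_iso Γ.code (pin := (pinFin_involutive i j).toPerm)
    (pinned := fun v => Γ.Pinned v) pinned_code (pinFin_code i j)

end Game

namespace PolyTime

variable {α : Type} [Data α] {f : α → Game} {i j u v : α → ℕ}

theorem bound (hf : PolyTime f) : PolyTime fun x => (f x).bound :=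
  hf.encode.length.add (const 4)

theorem order (hf : PolyTime f) : PolyTime fun x => (f x).order :=
  (hf.bound.mul hf.bound).mul hf.bound

theorem arc (hf : PolyTime f) (hu : PolyTime u) (hv : PolyTime v) :
    PolyTime fun x => (f x).Arc (u x) (v x) := by
  have hB := hf.bound
  have hN := hf.numPlayers
  have hS := hf.numProfiles
  have ht := (hu.div hB).div hB
  have ha := (hu.div hB).mod hB
  have hb := hu.mod hB
  have ht' := (hv.div hB).div hB
  have ha' := (hv.div hB).mod hB
  have hb' := hv.mod hB
  refine or ?_ (or ?_ ?_)
  · exact (ht.eq (const 0)).and ((ht'.eq (const 1)).and ((ha.lt hN).and ((hb.eq (const 0)).and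
      ((ha'.eq ha).and (hb'.lt (hf.acts ha))))))
  · exact (ht.eq (const 1)).and ((ht'.eq (const 2)).and ((ha.lt hN).and ((ha'.lt hS).and
      ((hb'.eq (const 0)).and (hb.eq (hf.digit ha' ha))))))
  · exact (ht.eq (const 2)).and ((ht'.eq (const 3)).and ((ha.lt hS).and ((hb.eq (const 0)).and
      ((ha'.lt hN).and ((hb'.lt (hS.mul hN)).and
        (hf.samePayoff ((ha.mul hN).add ha') hb'))))))

theorem pinned (hf : PolyTime f) (hu : PolyTime u) : PolyTime fun x => (f x).Pinned (u x) :=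
  have ht := (hu.div hf.bound).div hf.bound
  ((ht.eq (const 1)).or (ht.eq (const 2))).not

theorem swap (hi : PolyTime i) (hj : PolyTime j) (hu : PolyTime u) :
    PolyTime fun x => Equiv.swap (i x) (j x) (u x) :=
  ((hu.eq hi).ite hj ((hu.eq hj).ite hi hu)).congr fun _ => (Equiv.swap_apply_def _ _ _).symm

open Classical in
theorem pin (hf : PolyTime f) (hi : PolyTime i) (hj : PolyTime j) (hu : PolyTime u) :
    PolyTime fun x => (f x).pin (i x) (j x) (u x) :=
  (hf.pinned hu).ite (hf.bound.triple ((hu.div hf.bound).div hf.bound)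
    (hi.swap hj ((hu.div hf.bound).mod hf.bound)) (hu.mod hf.bound)) hu

theorem finGraph_game (hf : PolyTime f) : PolyTime fun x => (f x).finGraph := by
  have hp : PolyTime fun p : (α × ℕ) × ℕ => f p.1.1 := hf.rearrange Rearranges.id.fst.fst
  have hu := (Rearranges.id (α := (α × ℕ) × ℕ)).fst.snd.polyTime
  have hv := (Rearranges.id (α := (α × ℕ) × ℕ)).snd.polyTime
  refine finGraph (A := fun x u v => (f x).Arc u v ∨ (f x).Arc v u) hf.order
    ((hp.arc hu hv).or (hp.arc hv hu)) (fun _ => rfl) fun x u v hu hv => ?_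
  exact ((f x).finGraph.adj_coe ⟨u, hu⟩ ⟨v, hv⟩).trans Game.codedGraph_adj

end PolyTime

/-! ## Restricted graph isomorphism -/

theorem flatMap_filter {ι X : Type*} (l : List ι) (p : ι → Prop) [DecidablePred p]
    (f : ι → List X) : (l.filter p).flatMap f = l.flatMap fun i => if p i then f i else [] := by
  induction l with
  | nil => rfl
  | cons i l ih => by_cases h : p i <;> simp [h, ih]

namespace Game

open Classical in
/-- The instance of restricted graph isomorphism for a transposition of players: is there an
automorphism of the graph of the game that acts on players and cells as the transposition does? -/
def restricted (Γ : Game) (p : Γ.Player × Γ.Player) : RestrictedInstance where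
  source := Γ.finGraph
  target := Γ.finGraph
  constraints := ((List.finRange Γ.order).filter fun v : Fin Γ.order => Γ.Pinned v).map fun v =>
    (v, Γ.pinFin p.1 p.2 v)

variable {Γ : Game}

theorem restricted_yes_iff (i j : Γ.Player) :
    (Γ.restricted (i, j)).Yes ↔ Γ.Induced (Equiv.swap i j) := by
  classical
  have hmem (v : Fin Γ.order) :
      v ∈ (List.finRange Γ.order).filter (fun v : Fin Γ.order => Γ.Pinned v) ↔ Γ.Pinned v := by
    simp only [List.mem_filter, List.mem_finRange, true_and, decide_eq_true_eq]
  rw [induced_swap_iff]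
  exact exists_congr fun e => List.forall_mem_map.trans
    (forall_congr' fun v => imp_congr_left (hmem v))

open Classical in
variable (Γ) in
/-- The code of the instance of restricted graph isomorphism for the transposition of two players,
which are given by their numbers. -/
def restrictedCode (i j : ℕ) : List Γ' :=
  Γ.finGraph.encode ++ Γ.finGraph.encode ++ (((List.range Γ.order).flatMap fun v =>
    if Γ.Pinned v then Γ'.bra :: (encodeUnary v ++ encodeUnary (Γ.pin i j v)) else []) ++ [Γ'.ket])

theorem encode_restricted (i j : Γ.Player) :
    (Γ.restricted (i, j)).encode = Γ.restrictedCode i j := by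
  classical
  rw [RestrictedInstance.encode, restrictedCode, encodeList, ← finRange_flatMap]
  congr 2
  exact (List.flatMap_map _ _ _).trans (flatMap_filter (List.finRange Γ.order) _ _)

variable (Γ) in
/-- The code of the list of instances of restricted graph isomorphism for all transpositions. -/
def restrictedListCode : List Γ' :=
  ((List.range Γ.numPlayers).flatMap fun i => (List.range Γ.numPlayers).flatMap fun j =>
    if i < j then Γ'.bra :: Γ.restrictedCode i j else []) ++ [Γ'.ket]

theorem encodeList_restricted :
    encodeList RestrictedInstance.encode (Γ.transpositions.map Γ.restricted) =
      Γ.restrictedListCode := by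
  simp only [encodeList, restrictedListCode, transpositions, List.flatMap_map, List.flatMap_assoc,
    flatMap_filter, encode_restricted, Fin.lt_def, ← finRange_flatMap]

end Game

section

variable {α : Type} [Data α] {f : α → Game} {i j : α → ℕ}

theorem PolyTime.restrictedCode (hf : PolyTime f) (hi : PolyTime i) (hj : PolyTime j) :
    PolyTime fun x => (f x).restrictedCode (i x) (j x) := by
  classical
  have hv := (Rearranges.id (α := α × ℕ)).snd.polyTime
  have hf' := hf.rearrange (Rearranges.id (α := α × ℕ)).fst
  have hi' := hi.rearrange (Rearranges.id (α := α × ℕ)).fst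
  have hj' := hj.rearrange (Rearranges.id (α := α × ℕ)).fst
  have hconstraints := flatMap_range (f := fun x v => if (f x).Pinned v then
      Γ'.bra :: (encodeUnary v ++ encodeUnary ((f x).pin (i x) (j x) v)) else []) hf.order
    ((hf'.pinned hv).ite ((hv.unary.append (hf'.pin hi' hj' hv).unary).cons _) nil)
  exact (hf.finGraph_game.to_str.append hf.finGraph_game.to_str).append
    (hconstraints.append (const [Γ'.ket]))

theorem PolyTime.restrictedListCode : PolyTime Game.restrictedListCode := by
  have hΓ := (Rearranges.id (α := (Game × ℕ) × ℕ)).fst.fst.polyTime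
  have hi := (Rearranges.id (α := (Game × ℕ) × ℕ)).fst.snd.polyTime
  have hj := (Rearranges.id (α := (Game × ℕ) × ℕ)).snd.polyTime
  have hN := id.numPlayers
  have hrow := flatMap_range (f := fun (p : Game × ℕ) j =>
      if p.2 < j then Γ'.bra :: p.1.restrictedCode p.2 j else []) (hN.rearrange Rearranges.id.fst)
    ((hi.lt hj).ite ((hΓ.restrictedCode hi hj).cons _) nil)
  exact (flatMap_range (f := fun (Γ : Game) i => (List.range Γ.numPlayers).flatMap fun j =>
    if i < j then Γ'.bra :: Γ.restrictedCode i j else []) hN hrow).append (const [Γ'.ket])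

end

theorem polyTimeComputable_restricted : PolyTimeComputable Game.encode
    (encodeList RestrictedInstance.encode) fun Γ => Γ.transpositions.map Γ.restricted :=
  PolyTime.restrictedListCode.polyTimeComputable.transport (fun Γ => Γ) (fun _ => rfl)
    fun _ => Game.encodeList_restricted.symm

/-! ## Reduction to graph isomorphism -/

section

variable {a b c : ℕ}

/-- The numbering of triples by an initial segment of the natural numbers. -/
def prodEquiv (a b c : ℕ) : (Fin a × Fin b) × Fin c ≃ Fin (a * b * c) :=
  (finProdFinEquiv.prodCongr (Equiv.refl _)).trans finProdFinEquiv

/-- A graph on triples, as a graph on an initial segment of the natural numbers. -/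
def FinGraph.ofProd (G : SimpleGraph ((Fin a × Fin b) × Fin c)) : FinGraph :=
  ⟨a * b * c, G.comap (prodEquiv a b c).symm⟩

theorem FinGraph.ofProd_iso_iff {G H : SimpleGraph ((Fin a × Fin b) × Fin c)} :
    Nonempty ((ofProd G).graph ≃g (ofProd H).graph) ↔ Nonempty (G ≃g H) :=
  have isoOfProd (G : SimpleGraph ((Fin a × Fin b) × Fin c)) : (ofProd G).graph ≃g G :=
    .comap (prodEquiv a b c).symm G
  ⟨fun ⟨e⟩ => ⟨((isoOfProd G).symm.trans e).trans (isoOfProd H)⟩,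
    fun ⟨e⟩ => ⟨((isoOfProd G).trans e).trans (isoOfProd H).symm⟩⟩

end

namespace Game

variable (Γ : Game)

/-- The number of ordered pairs of players. -/
def numPairs : ℕ := Γ.numPlayers * Γ.numPlayers

variable {Γ} in
theorem allPlayerPermsInduced_iff_fin : Γ.AllPlayerPermsInduced ↔
    ∀ q : Fin Γ.numPairs, Γ.Induced (Equiv.swap (Fin.divNat q) (Fin.modNat q)) := by
  rw [allPlayerPermsInduced_iff_swap, ← Prod.forall', ← finProdFinEquiv.symm.forall_congr_right]
  rfl

/-- A bound for the colours of the vertices in the copies of the coded graph. -/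
def numColors : ℕ := Γ.numPairs * (Γ.order + 1)

/-- Copies of the coded graph of a game, one for each pair of players, with numbers of leaves that
encode the vertices `W q v`, where `v` is a pinned vertex of the `q`-th copy. -/
def gadget (W : Fin Γ.numPairs → Fin Γ.order → Fin Γ.order) :
    SimpleGraph ((Fin Γ.numPairs × Fin Γ.order) × Fin (Γ.numColors + 3)) :=
  leafGraph (copies Γ.codedGraph (Fin Γ.numPairs))
    (fun x => copyColor (fun v => Γ.Pinned v) x.1 x.2 (W x.1 x.2)) Γ.numColors

theorem gadget_iso_iff : Nonempty (Γ.gadget (fun _ v => v) ≃g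
      Γ.gadget fun q => Γ.pinFin (Fin.divNat q) (Fin.modNat q)) ↔ Γ.AllPlayerPermsInduced := by
  rw [allPlayerPermsInduced_iff_fin]
  refine (leafGraph_iso_iff (fun _ => copyColor_le (Fin.is_lt _) _ _)
    fun _ => copyColor_le (Fin.is_lt _) _ _).trans ?_
  refine (copies_color_iff (fun q => pinFin_involutive _ _) fun q => pinned_pinFin _ _).trans ?_
  exact forall_congr' fun q => (induced_swap_iff _ _).symm

open Classical in
/-- The number of leaves at the vertex `v` of the `q`-th copy, if they encode `w`. -/
def numLeaves (w q v : ℕ) : ℕ := q * (Γ.order + 1) + (if Γ.Pinned v then w + 1 else 0) + 2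

/-- The adjacency of `(q, v, z)` and `(q', v', z')` in the gadget, in terms of numbers. -/
def GadgetArc (w : ℕ → ℕ → ℕ) (q v z q' v' z' : ℕ) : Prop :=
  (z = 0 ∧ z' = 0 ∧ q = q' ∧ (Γ.Arc v v' ∨ Γ.Arc v' v)) ∨
  (q = q' ∧ v = v' ∧ z = 0 ∧ z' ≠ 0 ∧ z' ≤ Γ.numLeaves (w q v) q v) ∨
  (q = q' ∧ v = v' ∧ z' = 0 ∧ z ≠ 0 ∧ z ≤ Γ.numLeaves (w q v) q v)

variable {Γ} {W : Fin Γ.numPairs → Fin Γ.order → Fin Γ.order} {w : ℕ → ℕ → ℕ}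

theorem gadget_adj_iff (hw : ∀ q v, (W q v).val = w q v)
    (x y : (Fin Γ.numPairs × Fin Γ.order) × Fin (Γ.numColors + 3)) :
    (Γ.gadget W).Adj x y ↔ Γ.GadgetArc w x.1.1 x.1.2 x.2 y.1.1 y.1.2 y.2 := by
  simp only [gadget, leafGraph_adj, copies_adj, codedGraph_adj, GadgetArc, numLeaves, copyColor,
    hw, Prod.ext_iff, ne_eq, Fin.ext_iff, Fin.val_zero, and_assoc]

theorem ofProd_gadget_adj (hw : ∀ q v, (W q v).val = w q v) {x y : ℕ}
    (hx : x < Γ.numPairs * Γ.order * (Γ.numColors + 3))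
    (hy : y < Γ.numPairs * Γ.order * (Γ.numColors + 3)) :
    (FinGraph.ofProd (Γ.gadget W)).adj x y ↔
      Γ.GadgetArc w (x / (Γ.numColors + 3) / Γ.order) (x / (Γ.numColors + 3) % Γ.order)
        (x % (Γ.numColors + 3)) (y / (Γ.numColors + 3) / Γ.order)
        (y / (Γ.numColors + 3) % Γ.order) (y % (Γ.numColors + 3)) :=
  ((FinGraph.ofProd (Γ.gadget W)).adj_coe ⟨x, hx⟩ ⟨y, hy⟩).trans (gadget_adj_iff hw _ _)

end Game

namespace PolyTime

variable {α : Type} [Data α] {f : α → Game}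

theorem numPairs (hf : PolyTime f) : PolyTime fun x => (f x).numPairs :=
  hf.numPlayers.mul hf.numPlayers

theorem numColors (hf : PolyTime f) : PolyTime fun x => (f x).numColors :=
  hf.numPairs.mul hf.order.succ

open Classical in
theorem numLeaves {w q v : α → ℕ} (hf : PolyTime f) (hw : PolyTime w) (hq : PolyTime q)
    (hv : PolyTime v) : PolyTime fun x => (f x).numLeaves (w x) (q x) (v x) :=
  ((hq.mul hf.order.succ).add ((hf.pinned hv).ite hw.succ (const 0))).add (const 2)

theorem gadgetArc {w : α → ℕ → ℕ → ℕ} {q v z q' v' z' : α → ℕ} (hf : PolyTime f)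
    (hw : PolyTime fun x => w x (q x) (v x)) (hq : PolyTime q) (hv : PolyTime v) (hz : PolyTime z)
    (hq' : PolyTime q') (hv' : PolyTime v') (hz' : PolyTime z') :
    PolyTime fun x => (f x).GadgetArc (w x) (q x) (v x) (z x) (q' x) (v' x) (z' x) := by
  have hl := hf.numLeaves hw hq hv
  have hz₀ := hz.eq (const 0)
  have hz₀' := hz'.eq (const 0)
  refine or ?_ (or ?_ ?_)
  · exact hz₀.and (hz₀'.and ((hq.eq hq').and ((hf.arc hv hv').or (hf.arc hv' hv))))
  · exact (hq.eq hq').and ((hv.eq hv').and (hz₀.and (hz₀'.not.and (hz'.le hl))))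
  · exact (hq.eq hq').and ((hv.eq hv').and (hz₀'.and (hz₀.not.and (hz.le hl))))

theorem gadget {w : Game → ℕ → ℕ → ℕ}
    (hw : PolyTime fun p : (Game × ℕ) × ℕ => w p.1.1 p.1.2 p.2)
    {W : ∀ Γ : Game, Fin Γ.numPairs → Fin Γ.order → Fin Γ.order}
    (hW : ∀ Γ q v, (W Γ q v).val = w Γ q v) :
    PolyTime fun Γ : Game => FinGraph.ofProd (Γ.gadget (W Γ)) := by
  have hΓ := (Rearranges.id (α := (Game × ℕ) × ℕ)).fst.fst.polyTime
  have hx := (Rearranges.id (α := (Game × ℕ) × ℕ)).fst.snd.polyTime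
  have hy := (Rearranges.id (α := (Game × ℕ) × ℕ)).snd.polyTime
  have hl := hΓ.numColors.add (const 3)
  have hw' := bind (f := fun p : ((Game × ℕ) × ℕ) × ℕ => w p.1.1.1
      (p.1.1.2 / (p.1.1.1.numColors + 3) / p.1.1.1.order) p.2)
    (bind (f := fun p : (((Game × ℕ) × ℕ) × ℕ) × ℕ => w p.1.1.1.1 p.2 p.1.2)
      (hw.rearrange ((Rearranges.id.fst.fst.fst.fst.pair Rearranges.id.snd).pair
        Rearranges.id.fst.snd))
      (((hx.div hl).div hΓ.order).rearrange Rearranges.id.fst)) ((hx.div hl).mod hΓ.order)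
  exact finGraph (A := fun Γ x y => Γ.GadgetArc (w Γ) (x / (Γ.numColors + 3) / Γ.order)
      (x / (Γ.numColors + 3) % Γ.order) (x % (Γ.numColors + 3)) (y / (Γ.numColors + 3) / Γ.order)
      (y / (Γ.numColors + 3) % Γ.order) (y % (Γ.numColors + 3)))
    ((id.numPairs.mul id.order).mul (id.numColors.add (const 3)))
    (hΓ.gadgetArc (w := fun p => w p.1.1) hw' ((hx.div hl).div hΓ.order)
      ((hx.div hl).mod hΓ.order) (hx.mod hl) ((hy.div hl).div hΓ.order) ((hy.div hl).mod hΓ.order)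
      (hy.mod hl))
    (fun _ => rfl) fun Γ x y hx hy => Game.ofProd_gadget_adj (hW Γ) hx hy

end PolyTime

theorem allPlayerPermsInduced_mem_GI : allPlayerPermsInduced ∈ GI := by
  have hΓ := (Rearranges.id (α := (Game × ℕ) × ℕ)).fst.fst.polyTime
  have hq := (Rearranges.id (α := (Game × ℕ) × ℕ)).fst.snd.polyTime
  have hv := (Rearranges.id (α := (Game × ℕ) × ℕ)).snd.polyTime
  have hsource := PolyTime.gadget (w := fun _ _ v => v) hv (W := fun _ _ v => v) fun _ _ _ => rfl
  have htarget := PolyTime.gadget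
    (w := fun Γ q v => Γ.pin (q / Γ.numPlayers) (q % Γ.numPlayers) v)
    (hΓ.pin (hq.div hΓ.numPlayers) (hq.mod hΓ.numPlayers) hv)
    (W := fun Γ q => Γ.pinFin (Fin.divNat q) (Fin.modNat q)) fun _ _ _ => rfl
  exact ⟨fun Γ => (.ofProd (Γ.gadget fun _ v => v),
      .ofProd (Γ.gadget fun q => Γ.pinFin (Fin.divNat q) (Fin.modNat q))),
    (hsource.graphPair htarget).polyTimeComputable.transport (fun Γ : Game => Γ) (fun _ => rfl)
      fun _ => rfl,
    fun Γ => Γ.gadget_iso_iff.symm.trans FinGraph.ofProd_iso_iff.symm⟩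

end GameSym

end

theorem mainTheorem5 :
    GameSym.GIComplete GameSym.allPlayerPermsInduced ∧
    GameSym.GIHard GameSym.allPlayerPermsInducedTwoPlayerZeroSum ∧
    ∃ R : (Γ : GameSym.Game) → Γ.Player × Γ.Player → GameSym.RestrictedInstance,
      GameSym.PolyTimeComputable GameSym.Game.encode
        (GameSym.encodeList GameSym.RestrictedInstance.encode)
        (fun Γ => Γ.transpositions.map (R Γ)) ∧
      (∀ (Γ : GameSym.Game) (i j : Γ.Player), i < j →
        ((R Γ (i, j)).Yes ↔ Γ.Induced (Equiv.swap i j))) ∧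
      (∀ Γ : GameSym.Game,
        Γ.AllPlayerPermsInduced ↔ ∀ p ∈ Γ.transpositions, (R Γ p).Yes) :=
  ⟨⟨GameSym.allPlayerPermsInduced_mem_GI,
      GameSym.GIHard.of_reduces GameSym.graphIsomorphism_reduces⟩,
    GameSym.GIHard.of_reduces GameSym.graphIsomorphism_reduces_zeroSum,
    GameSym.Game.restricted, GameSym.polyTimeComputable_restricted,
    fun _ i j _ => GameSym.Game.restricted_yes_iff i j, fun _ =>
      GameSym.Game.allPlayerPermsInduced_iff_transpositions.trans
        (forall₂_congr fun p _ => (GameSym.Game.restricted_yes_iff p.1 p.2).symm)⟩
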